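/- A partial field $\mathbb{P}=(P,+,\cdot,0,1)$ is a set $P$ with distinguished elements $0,1$, a commutative binary operation $\cdot$ with $0p=0$ for all $p$, and a partially defined binary operation $+$, such that: $(P\setminus\{0\},\cdot,1)$ is an abelian group; $p+0=p$ for all $p$; every $p$ has a unique $-p$ with $p+(-p)=0$; if $p+q$ is defined then so is $q+p$, and $p+q=q+p$; if $q+r$ is defined then so is $pq+pr$, and $p(q+r)=pq+pr$; and the associative law holds: if some bracketing of a finite multiset $S$ of elements has all its intermediate sums and its total defined, with total $r$, then for every other bracketing of $S$ (in any order) all of whose intermediate sums other than the last one are defined, the last sum is defined as well and the total is $r$. We write $p+q\doteq r$ if $p+q$ is defined and equal to $r$. A sum $p_1+\cdots+p_n$ is defined, with value $r$, if there is a finite multiset $Z=\{z_1,-z_1,\dots,z_k,-z_k\}$ such that some bracketing of the multiset $\{p_1,\dots,p_n\}\cup Z$ has all its sums defined and total $r$. A matrix over $\mathbb{P}$ is a $\mathbb{P}$-matrix if the determinant $\sum_\sigma \operatorname{sgn}(\sigma)\prod_i a_{i\sigma(i)}$ of each of its square submatrices is defined; its rank is the largest size of a square submatrix with nonzero determinant.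 A (finite) matroid $M$ on $E$ is $\mathbb{P}$-representable if for some $r$ there is an $r\times E$ $\mathbb{P}$-matrix $A$ of rank $r$ such that the bases of $M$ are exactly the sets $B\subseteq E$ with $|B|=r$ and $\det A[r,B]\neq 0$, where $A[r,B]$ consists of the columns of $A$ in $B$. The set of fundamental elements of $\mathbb{P}$ is $\mathcal{F}(\mathbb{P})=\{p\in \mathbb{P} : 1-p \text{ is defined}\}$. A homomorphism $\phi:\hat{\mathbb{P}}\to\mathbb{P}$ of partial fields is a map such that $\phi(pq)=\phi(p)\phi(q)$ for all $p,q$, and $\phi(p)+\phi(q)\doteq\phi(p+q)$ whenever $p+q$ is defined. A lifting function for $\phi$ is a function ${}^\uparrow:\mathcal{F}(\mathbb{P})\to\hat{\mathbb{P}}$ such that for all $p,q\in\mathcal{F}(\mathbb{P})$: $\phi(p^\uparrow)=p$; if $p+q\doteq 1$ then $p^\uparrow+q^\uparrow\doteq 1$; if $pq=1$ then $p^\uparrow q^\uparrow=1$. Corollary. Let $\mathbb{P}$, $\hat{\mathbb{P}}$ be partial fields, let $\phi:\hat{\mathbb{P}}\to\mathbb{P}$ be a homomorphism, and let ${}^\uparrow:\mathcal{F}(\mathbb{P})\to\hat{\mathbb{P}}$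 be a lifting function for $\phi$. Suppose that 1. if $1+1\doteq 0$ in $\mathbb{P}$, then $1+1\doteq 0$ in $\hat{\mathbb{P}}$; 2. if $1+1$ is defined and nonzero in $\mathbb{P}$, then $1+1$ is defined and nonzero in $\hat{\mathbb{P}}$; 3. for all $p,q,r\in\mathcal{F}(\mathbb{P})$ with $pqr=1$, we have $p^\uparrow q^\uparrow r^\uparrow=1$. Then a matroid is $\mathbb{P}$-representable if and only if it is $\hat{\mathbb{P}}$-representable. -/

import Mathlib

/-- `Association add S r`: there is a binary tree whose leaves are labelled with the elements of the
multiset `S` (one leaf for each element), in which every inner node is labelled with the sum of the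
labels of its two children (all these sums being defined for the partial operation `add`), and whose
root has label `r`. -/
inductive Association {P : Type*} (add : P → P → Option P) : Multiset P → P → Prop
  | leaf (p : P) : Association add {p} p
  | node {S T : Multiset P} {u w r : P} : Association add S u → Association add T w →
      add u w = some r → Association add (S + T) r

/-- A partial field: a set with a multiplication that makes the nonzero elements an abelian group
(and `0 * p = 0`), and a partially defined addition `padd` (`padd p q = some r` says that `p + q` is
defined and equal to `r`).

In `padd_mul`, for `p ≠ 0`, the converse (if `p * q + p * r` is defined then so is `q + r`) follows
by multiplying with `p⁻¹`; for `p = 0` the converse is not meant, as it would make every sum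
defined. -/
class PartialField (P : Type*) extends CommGroupWithZero P, Neg P where
  /-- the partial addition -/
  padd : P → P → Option P
  padd_zero : ∀ p : P, padd p 0 = some p
  padd_neg : ∀ p : P, padd p (-p) = some 0
  neg_unique : ∀ p q : P, padd p q = some 0 → q = -p
  padd_comm : ∀ p q s : P, padd p q = some s → padd q p = some s
  padd_mul : ∀ p q r s : P, padd q r = some s → padd (p * q) (p * r) = some (p * s)
  /-- The associative law: if `S` has an association with root label `r`, then for every other
  tree on `S`, with labels `u` and `w` at the two children of its root, `u + w` is defined and
  equal to `r`. -/
  padd_assoc : ∀ (S : Multiset P) (r : P), Association padd S r →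
    ∀ (S₁ S₂ : Multiset P) (u w : P), S₁ + S₂ = S →
      Association padd S₁ u → Association padd S₂ w → padd u w = some r

namespace PartialField

/-- The sum of the multiset `S` is defined and equal to `r`: for some finite multiset
`{z₁, -z₁, …, zₖ, -zₖ}`, its union with `S` has an association with root label `r`. -/
def SumsTo {P : Type*} [PartialField P] (S : Multiset P) (r : P) : Prop :=
  ∃ Z : Multiset P, Association (padd (P := P)) (S + (Z + Z.map (fun z => -z))) r

/-- The multiset of the `n!` terms `sign(σ) a_{1σ(1)} ⋯ a_{nσ(n)}` of the determinant. -/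
def detTerms {P : Type*} [PartialField P] {n : ℕ} (A : Matrix (Fin n) (Fin n) P) : Multiset P :=
  (Finset.univ : Finset (Equiv.Perm (Fin n))).val.map
    (fun σ => if Equiv.Perm.sign σ = 1 then ∏ i, A i (σ i) else -(∏ i, A i (σ i)))

/-- `det A` is defined and equal to `d`. -/
def HasDet {P : Type*} [PartialField P] {n : ℕ} (A : Matrix (Fin n) (Fin n) P) (d : P) : Prop :=
  SumsTo (detTerms A) d

/-- `A` is a `P`-matrix: the determinant of every square submatrix is defined. A square submatrix
is given by choosing, in some order, `k` distinct rows and `k` distinct columns. -/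
def IsPMatrix {P : Type*} [PartialField P] {X Y : Type*} (A : Matrix X Y P) : Prop :=
  ∀ (k : ℕ) (f : Fin k ↪ X) (g : Fin k ↪ Y), ∃ d : P, HasDet (A.submatrix f g) d

/-- `r` is the rank of `A`, that is, the largest size of a square submatrix with nonzero
determinant. -/
def HasRank {P : Type*} [PartialField P] {X Y : Type*} (A : Matrix X Y P) (r : ℕ) : Prop :=
  IsGreatest {k : ℕ | ∃ (f : Fin k ↪ X) (g : Fin k ↪ Y) (d : P),
    HasDet (A.submatrix f g) d ∧ d ≠ 0} r

/-- The family of the `r`-element sets `B` of columns with `det A[r, B] ≠ 0`, for an `r × E`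
matrix `A` (the order `g` in which the columns are listed affects only the sign). -/
def columnBases {P : Type*} [PartialField P] {r : ℕ} {E : Type*} (A : Matrix (Fin r) E P) :
    Set (Set E) :=
  {B | ∃ g : Fin r ↪ E, Set.range g = B ∧ ∃ d : P, HasDet (A.submatrix id g) d ∧ d ≠ 0}

/-- The matroid `M` is `P`-representable: for some `r` there is an `r × E` `P`-matrix `A` of rank
`r`, where `E` is the ground set of `M`, such that `M = M[A]`, that is, the bases of `M` are the
members of `columnBases A`. -/
def IsRepresentable (P : Type*) [PartialField P] {α : Type*} (M : Matroid α) : Prop :=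
  ∃ (r : ℕ) (A : Matrix (Fin r) M.E P), IsPMatrix A ∧ HasRank A r ∧
    ∀ B : Set M.E, M.IsBase (Subtype.val '' B) ↔ B ∈ columnBases A

/-- The set of fundamental elements: those `p` for which `1 - p` is defined. -/
def fundamentals (P : Type*) [PartialField P] : Set P :=
  {p | ∃ q : P, padd 1 (-p) = some q}

/-- Homomorphisms of partial fields. -/
structure Hom (P : Type*) (Q : Type*) [PartialField P] [PartialField Q] where
  /-- the underlying function -/
  toFun : P → Q
  map_mul : ∀ p q : P, toFun (p * q) = toFun p * toFun q
  map_padd : ∀ p q s : P, padd p q = some s → padd (toFun p) (toFun q) = some (toFun s)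

/-- `up` is a lifting function for the homomorphism `φ : Q → P`. -/
structure IsLiftingFunction {P : Type*} {Q : Type*} [PartialField P] [PartialField Q]
    (φ : Hom Q P) (up : fundamentals P → Q) : Prop where
  section_eq : ∀ p : fundamentals P, φ.toFun (up p) = p
  map_add_one : ∀ p q : fundamentals P, padd (p : P) (q : P) = some 1 →
    padd (up p) (up q) = some 1
  map_mul_one : ∀ p q : fundamentals P, (p : P) * (q : P) = 1 → up p * up q = 1

end PartialField

/-!
In the commutative ring generated by the elements of a partial field, subject to the sums that are
defined, distinct elements stay distinct: this is what the associative law says. Determinants over a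
partial field are therefore determinants over that ring, and a `P`-matrix is a matrix whose minors
lie in the image of `P`. A homomorphism that maps `1` to `1` preserves defined determinants and
whether they vanish, which gives one direction.

For the other direction, bring a representation into the form `[I | A]`. Its minors are in `P` if
and only if every matrix obtained from `A` by pivoting has entries in `P` and fundamental cross
ratios `A i u * A j v / (A i v * A j u)`. Such a matrix is lifted to pairs of nonzero elements of
`P` and `Q` whose cross ratios are of the form `(p, u p)` for fundamental `p`, by induction on the
number of nonzero rows and columns. If two lines can be deleted so that the rest is connected and
meets every remaining line, the lifts of the two smaller matrices agree up to scaling and can be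
glued. The glued matrix stays admissible under pivoting: a defect would involve few rows, and
pivoting shortens the paths between those rows until they have nonzero entries in a common column,
where the three laws of a lifting function apply. Matrices without two such lines reduce to a single
column or to size `2 × 2`.
-/

/-! ### The universal ring -/

namespace PartialField

section UniversalRing

variable {P : Type*} [PartialField P]

theorem neg_eq_mul_neg_one (p : P) : -p = p * -1 :=
  (neg_unique _ _ (by simpa using padd_mul p 1 (-1) 0 (padd_neg 1))).symm

instance : HasDistribNeg P where
  neg_neg p := (neg_unique _ _ (padd_comm _ _ _ (padd_neg p))).symm
  neg_mul p q := by
    rw [neg_eq_mul_neg_one p, neg_eq_mul_neg_one (p * q), mul_right_comm]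
  mul_neg p q := by
    rw [neg_eq_mul_neg_one q, neg_eq_mul_neg_one (p * q), mul_assoc]

theorem zero_padd (p : P) : padd 0 p = some p := padd_comm _ _ _ (padd_zero p)

/-- The multiset `{z₁, …, zₖ, -z₁, …, -zₖ}` of cancelling pairs that may be added to a sum. -/
def cancelling (Z : Multiset P) : Multiset P := Z + Z.map (fun z => -z)

theorem cancelling_add (Z W : Multiset P) :
    cancelling (Z + W) = cancelling Z + cancelling W := by
  simp only [cancelling, Multiset.map_add]
  abel

theorem cancelling_cons (z : P) (Z : Multiset P) :
    cancelling (z ::ₘ Z) = {z} + {-z} + cancelling Z := by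
  rw [← Multiset.singleton_add, cancelling_add]
  simp [cancelling]

theorem _root_.Association.add_cancelling {S : Multiset P} {r : P} (h : Association padd S r)
    (Z : Multiset P) : Association padd (S + cancelling Z) r := by
  induction Z using Multiset.induction_on generalizing S with
  | empty => simpa [cancelling] using h
  | cons z Z ih =>
    rw [cancelling_cons, ← add_assoc]
    exact ih (.node h (.node (.leaf z) (.leaf (-z)) (padd_neg z)) (padd_zero r))

theorem _root_.Association.map_mul_left (a : P) {S : Multiset P} {r : P}
    (h : Association padd S r) : Association padd (S.map (a * ·)) (a * r) := by
  induction h with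
  | leaf p => simpa using Association.leaf (a * p)
  | node _ _ h ih₁ ih₂ =>
    rw [Multiset.map_add]
    exact .node ih₁ ih₂ (padd_mul _ _ _ _ h)

theorem sumsTo_iff_exists_cancelling {S : Multiset P} {r : P} :
    SumsTo S r ↔ ∃ Z : Multiset P, Association padd (S + cancelling Z) r := Iff.rfl

theorem sumsTo_singleton (p : P) : SumsTo {p} p := ⟨0, by simpa using Association.leaf p⟩

theorem sumsTo_empty : SumsTo (0 : Multiset P) 0 :=
  ⟨{0}, by simpa using Association.node (.leaf (0 : P)) (.leaf (-0)) (padd_neg 0)⟩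

theorem SumsTo.add {S T : Multiset P} {u w r : P} (hS : SumsTo S u) (hT : SumsTo T w)
    (h : padd u w = some r) : SumsTo (S + T) r := by
  rw [sumsTo_iff_exists_cancelling] at *
  obtain ⟨Z, hZ⟩ := hS
  obtain ⟨W, hW⟩ := hT
  exact ⟨Z + W, by rw [cancelling_add, add_add_add_comm]; exact .node hZ hW h⟩

theorem sumsTo_add_cancelling_iff {S W : Multiset P} {r : P} :
    SumsTo (S + cancelling W) r ↔ SumsTo S r := by
  simp only [sumsTo_iff_exists_cancelling]
  constructor
  · rintro ⟨Z, hZ⟩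
    exact ⟨W + Z, by rwa [cancelling_add, ← add_assoc]⟩
  · rintro ⟨Z, hZ⟩
    exact ⟨Z, by rw [add_right_comm]; exact hZ.add_cancelling W⟩

theorem SumsTo.map_mul_left (a : P) {S : Multiset P} {r : P} (h : SumsTo S r) :
    SumsTo (S.map (a * ·)) (a * r) := by
  obtain ⟨Z, hZ⟩ := h
  exact ⟨Z.map (a * ·), by simpa [Function.comp_def] using hZ.map_mul_left a⟩

theorem SumsTo.map_neg {S : Multiset P} {r : P} (h : SumsTo S r) :
    SumsTo (S.map (fun p => -p)) (-r) := by
  simpa using h.map_mul_left (-1)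

/-- The formal sum of a multiset of elements of `P`, in the group ring `ℤ[P]`. -/
noncomputable def formalSum : Multiset P →+ MonoidAlgebra ℤ P where
  toFun S := (S.map (MonoidAlgebra.of ℤ P)).sum
  map_zero' := by simp
  map_add' := by simp

theorem formalSum_singleton (p : P) : formalSum {p} = MonoidAlgebra.of ℤ P p := by
  simp [formalSum]

theorem of_mul_formalSum (a : P) (S : Multiset P) :
    MonoidAlgebra.of ℤ P a * formalSum S = formalSum (S.map (a * ·)) := by
  simp [formalSum, ← Multiset.sum_map_mul_left]

theorem coeff_formalSum [DecidableEq P] (S : Multiset P) (p : P) :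
    (formalSum S : MonoidAlgebra ℤ P).coeff p = S.count p := by
  induction S using Multiset.induction_on with
  | empty => simp
  | cons a S ih =>
    rw [← Multiset.singleton_add, map_add, formalSum_singleton, Multiset.count_add]
    simp [ih, Finsupp.single_apply, Multiset.count_singleton, eq_comm]

theorem formalSum_injective :
    Function.Injective (formalSum : Multiset P → MonoidAlgebra ℤ P) := by
  classical
  intro S T h
  ext p
  simpa [coeff_formalSum] using congrArg (fun f : MonoidAlgebra ℤ P => f.coeff p) h

variable (P) in
/-- The differences of formal sums `∑ sᵢ - ∑ tⱼ` for which `∑ sᵢ + ∑ (-tⱼ)` is defined in `P` and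
equal to `0`. -/
def nullSums : AddSubgroup (MonoidAlgebra ℤ P) where
  carrier := {x | ∃ S T : Multiset P,
    x = formalSum S - formalSum T ∧ SumsTo (S + T.map (fun t => -t)) 0}
  zero_mem' := ⟨0, 0, by simp, by simpa using sumsTo_empty⟩
  add_mem' := by
    rintro _ _ ⟨S, T, rfl, h⟩ ⟨S', T', rfl, h'⟩
    refine ⟨S + S', T + T', by simp only [map_add]; abel, ?_⟩
    rw [Multiset.map_add, add_add_add_comm]
    exact h.add h' (padd_zero 0)
  neg_mem' := by
    rintro _ ⟨S, T, rfl, h⟩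
    refine ⟨T, S, by abel, ?_⟩
    simpa [Function.comp_def, add_comm] using h.map_neg

theorem mul_mem_nullSums {x : MonoidAlgebra ℤ P} (hx : x ∈ nullSums P) (y : MonoidAlgebra ℤ P) :
    y * x ∈ nullSums P := by
  induction y using MonoidAlgebra.induction_on with
  | of a =>
    obtain ⟨S, T, rfl, h⟩ := hx
    refine ⟨S.map (a * ·), T.map (a * ·), by simp only [mul_sub, of_mul_formalSum], ?_⟩
    simpa [Function.comp_def] using h.map_mul_left a
  | add f g hf hg => rw [add_mul]; exact add_mem hf hg
  | smul n f hf => rw [smul_mul_assoc]; exact zsmul_mem hf n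

variable (P) in
/-- The ideal of `ℤ[P]` generated by the relations `[p] + [q] - [p + q]`. -/
noncomputable def relIdeal : Ideal (MonoidAlgebra ℤ P) :=
  Ideal.span {x | ∃ p q r : P, padd p q = some r ∧
    x = MonoidAlgebra.of ℤ P p + MonoidAlgebra.of ℤ P q - MonoidAlgebra.of ℤ P r}

theorem mem_nullSums_of_mem_relIdeal {x : MonoidAlgebra ℤ P} (hx : x ∈ relIdeal P) :
    x ∈ nullSums P := by
  refine Submodule.span_induction ?_ (zero_mem _) (fun _ _ _ _ => add_mem)
    (fun y _ _ h => mul_mem_nullSums h y) hx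
  rintro _ ⟨p, q, r, h, rfl⟩
  refine ⟨{p} + {q}, {r}, by simp only [map_add, formalSum_singleton], ?_⟩
  rw [Multiset.map_singleton]
  exact ((sumsTo_singleton p).add (sumsTo_singleton q) h).add (sumsTo_singleton (-r)) (padd_neg r)

theorem sumsTo_zero_of_formalSum_sub_mem_relIdeal {S T : Multiset P}
    (h : (formalSum S - formalSum T : MonoidAlgebra ℤ P) ∈ relIdeal P) :
    SumsTo (S + T.map (fun t => -t)) 0 := by
  obtain ⟨A, B, hAB, hsum⟩ := mem_nullSums_of_mem_relIdeal h
  have hST : S + B = A + T := formalSum_injective (by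
    rw [map_add, map_add]
    linear_combination (exp := 1) hAB)
  have hcancel : S + T.map (fun t => -t) + cancelling B =
      A + B.map (fun t => -t) + cancelling T :=
    calc S + T.map (fun t => -t) + (B + B.map (fun z => -z))
        = (S + B) + (T.map (fun t => -t) + B.map (fun z => -z)) := by abel
      _ = A + B.map (fun t => -t) + (T + T.map (fun z => -z)) := by rw [hST]; abel
  rwa [← sumsTo_add_cancelling_iff (W := B), hcancel, sumsTo_add_cancelling_iff]

variable (P) in
/-- The universal ring of a partial field: the commutative ring generated by the elements of `P`
subject to all the sums and products that hold in `P`. -/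
abbrev UnivRing : Type _ := MonoidAlgebra ℤ P ⧸ relIdeal P

theorem mk_of_add_mk_of {p q r : P} (h : padd p q = some r) :
    Ideal.Quotient.mk (relIdeal P) (MonoidAlgebra.of ℤ P p) +
      Ideal.Quotient.mk (relIdeal P) (MonoidAlgebra.of ℤ P q) =
      Ideal.Quotient.mk (relIdeal P) (MonoidAlgebra.of ℤ P r) := by
  rw [← map_add, Ideal.Quotient.eq]
  exact Ideal.subset_span ⟨p, q, r, h, rfl⟩

/-- The canonical map from a partial field to its universal ring. -/
noncomputable def iota : P →*₀ UnivRing P where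
  toFun p := Ideal.Quotient.mk (relIdeal P) (MonoidAlgebra.of ℤ P p)
  map_zero' := by simpa using mk_of_add_mk_of (padd_zero (0 : P))
  map_one' := by rw [map_one, map_one]
  map_mul' p q := by rw [map_mul, map_mul]

theorem iota_add_iota {p q r : P} (h : padd p q = some r) : iota p + iota q = iota r :=
  mk_of_add_mk_of h

@[simp] theorem iota_neg (p : P) : iota (-p) = -iota p := by
  have h := iota_add_iota (padd_neg p)
  rw [map_zero] at h
  exact (neg_eq_of_add_eq_zero_right h).symm

theorem mk_formalSum (S : Multiset P) :
    Ideal.Quotient.mk (relIdeal P) (formalSum S) = (S.map iota).sum := by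
  simp [formalSum, map_multiset_sum, iota]

theorem sum_map_iota_cancelling (Z : Multiset P) : ((cancelling Z).map iota).sum = 0 := by
  simp [cancelling, Multiset.map_map]

theorem _root_.Association.sum_map_iota {S : Multiset P} {r : P} (h : Association padd S r) :
    (S.map iota).sum = iota r := by
  induction h with
  | leaf p => simp
  | node _ _ h ih₁ ih₂ => rw [Multiset.map_add, Multiset.sum_add, ih₁, ih₂, iota_add_iota h]

theorem sumsTo_iff_sum_map_iota {S : Multiset P} {r : P} :
    SumsTo S r ↔ (S.map iota).sum = iota r := by
  constructor
  · intro h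
    obtain ⟨Z, hZ⟩ := sumsTo_iff_exists_cancelling.1 h
    simpa [sum_map_iota_cancelling] using hZ.sum_map_iota
  · intro h
    have h₀ : SumsTo (S + ({r} : Multiset P).map (fun t => -t)) 0 := by
      apply sumsTo_zero_of_formalSum_sub_mem_relIdeal
      rw [← Ideal.Quotient.eq, mk_formalSum, mk_formalSum, h]
      simp
    have h₁ := h₀.add (sumsTo_singleton r) (zero_padd r)
    rwa [add_assoc, add_comm (Multiset.map _ _), ← cancelling, sumsTo_add_cancelling_iff] at h₁

theorem padd_eq_some_iff {p q r : P} : padd p q = some r ↔ iota p + iota q = iota r := by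
  refine ⟨iota_add_iota, fun h => ?_⟩
  obtain ⟨Z, hZ⟩ := sumsTo_iff_exists_cancelling.1
    (sumsTo_iff_sum_map_iota (S := {p} + {q}).2 (by simpa using h))
  exact padd_assoc _ r hZ {p} ({q} + cancelling Z) p q (by rw [add_assoc]) (.leaf p)
    ((Association.leaf q).add_cancelling Z)

theorem iota_injective : Function.Injective (iota : P → UnivRing P) := by
  intro p q h
  have hpq : padd p 0 = some q := padd_eq_some_iff.2 (by rw [map_zero, add_zero, h])
  exact Option.some.inj ((padd_zero p).symm.trans hpq)

instance : Nontrivial (UnivRing P) :=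
  ⟨iota 0, iota 1, fun h => zero_ne_one (iota_injective h)⟩

theorem hasDet_iff_det_map_iota {n : ℕ} {A : Matrix (Fin n) (Fin n) P} {d : P} :
    HasDet A d ↔ (A.map iota).det = iota d := by
  have hsum : ((detTerms A).map iota).sum = (A.map iota).det := by
    rw [← Matrix.det_transpose, Matrix.det_apply, detTerms, Multiset.map_map]
    refine congrArg Multiset.sum (Multiset.map_congr rfl fun σ _ => ?_)
    rcases Int.units_eq_one_or (Equiv.Perm.sign σ) with h | h <;> simp [h]
  rw [HasDet, sumsTo_iff_sum_map_iota, hsum]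

end UniversalRing

end PartialField

/-! ### Cross ratios and pivoting -/

namespace MatrixLift

open Matrix

/-- A group of units of a ring, together with a set of ring elements that are allowed as cross
ratios. Matrices with entries in the group or zero, all of whose cross ratios are allowed, play the
role of the matrices whose `2 × 2` submatrices have determinants defined in a partial field. -/
structure CrossSystem (R : Type*) [CommRing R] where
  /-- the group of units -/
  units : Subgroup Rˣ
  /-- the set of allowed cross ratios -/
  ratios : Set R
  neg_one_mem : -1 ∈ units
  zero_mem_ratios : 0 ∈ ratios
  one_mem_ratios : 1 ∈ ratios

section Basic

variable {R : Type*} [CommRing R] {X Y : Type*} (D : CrossSystem R)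

/-- The elements of the group of units together with `0`, as a multiplicative submonoid. -/
def CrossSystem.elems : Submonoid R where
  carrier := {x | x = 0 ∨ ∃ g ∈ D.units, (g : R) = x}
  one_mem' := .inr ⟨1, D.units.one_mem, rfl⟩
  mul_mem' := by
    rintro _ _ (rfl | ⟨g, hg, rfl⟩) (rfl | ⟨g', hg', rfl⟩)
    · exact .inl (zero_mul _)
    · exact .inl (zero_mul _)
    · exact .inl (mul_zero _)
    · exact .inr ⟨g * g', D.units.mul_mem hg hg', by simp⟩

variable {D}

theorem zero_mem_elems : (0 : R) ∈ D.elems := Or.inl rfl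

theorem unit_mem_elems {g : Rˣ} (hg : g ∈ D.units) : (g : R) ∈ D.elems := Or.inr ⟨g, hg, rfl⟩

theorem neg_mem_elems {a : R} (ha : a ∈ D.elems) : -a ∈ D.elems := by
  simpa using mul_mem (unit_mem_elems (D := D) D.neg_one_mem) ha

theorem inverse_mem_elems {a : R} (ha : a ∈ D.elems) : Ring.inverse a ∈ D.elems := by
  rcases ha with rfl | ⟨g, hg, rfl⟩
  · exact .inl (Ring.inverse_zero _)
  · exact .inr ⟨g⁻¹, D.units.inv_mem hg, by simp⟩

theorem exists_unit {a : R} (ha : a ∈ D.elems) (h : a ≠ 0) : ∃ g ∈ D.units, (g : R) = a :=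
  ha.resolve_left h

theorem isUnit_of_mem_elems {a : R} (ha : a ∈ D.elems) (h : a ≠ 0) : IsUnit a :=
  let ⟨g, _, hga⟩ := exists_unit ha h
  ⟨g, hga⟩

theorem mul_inverse {a : R} (ha : a ∈ D.elems) (h : a ≠ 0) : a * Ring.inverse a = 1 :=
  Ring.mul_inverse_cancel a (isUnit_of_mem_elems ha h)

theorem mul_ne_zero_of_mem_elems {a b : R} (ha : a ∈ D.elems) (h : a ≠ 0) (hb : b ≠ 0) :
    a * b ≠ 0 :=
  mt (isUnit_of_mem_elems ha h).mul_right_eq_zero.1 hb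

theorem inverse_ne_zero {a : R} (ha : a ∈ D.elems) (h : a ≠ 0) : Ring.inverse a ≠ 0 :=
  have := nontrivial_of_ne a 0 h
  (isUnit_of_mem_elems ha h).ringInverse.ne_zero

theorem map_inverse {S : Type*} [CommRing S] (π : R →+* S) {a : R} (ha : a ∈ D.elems) :
    π (Ring.inverse a) = Ring.inverse (π a) := by
  rcases ha with rfl | ⟨g, -, rfl⟩
  · simp
  · rw [Ring.inverse_unit]
    exact (Ring.inverse_unit (Units.map (π : R →* S) g)).symm

/-- The submatrix of `A` in rows `i`, `j` and columns `u`, `v` has an allowed cross ratio. -/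
def CrossSystem.Cross (D : CrossSystem R) (A : Matrix X Y R) (i j : X) (u v : Y) : Prop :=
  ∃ h ∈ D.ratios, A i u * A j v = h * (A i v * A j u)

theorem cross_of_mul_eq_zero {A : Matrix X Y R} {i j : X} {u v : Y} (h : A i u * A j v = 0) :
    D.Cross A i j u v :=
  ⟨0, D.zero_mem_ratios, by rw [h, zero_mul]⟩

theorem CrossSystem.Cross.symm {A : Matrix X Y R} {i j : X} {u v : Y} (h : D.Cross A i j u v) :
    D.Cross A j i v u := by
  obtain ⟨t, ht, e⟩ := h
  exact ⟨t, ht, by linear_combination e⟩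

theorem cross_same_row (A : Matrix X Y R) (i : X) (u v : Y) : D.Cross A i i u v :=
  ⟨1, D.one_mem_ratios, by ring⟩

theorem cross_same_col (A : Matrix X Y R) (i j : X) (u : Y) : D.Cross A i j u u :=
  ⟨1, D.one_mem_ratios, by ring⟩

/-- A matrix with entries in `D.elems`, all of whose cross ratios are allowed. Only submatrices in
which the denominator of the cross ratio is nonzero are constrained. -/
structure CrossSystem.Admissible (D : CrossSystem R) (A : Matrix X Y R) : Prop where
  mem : ∀ i j, A i j ∈ D.elems
  cross : ∀ {i j u v}, A i v ≠ 0 → A j u ≠ 0 → D.Cross A i j u v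

/-- Multiply rows and columns by units. -/
def scale (r : X → Rˣ) (c : Y → Rˣ) (A : Matrix X Y R) : Matrix X Y R :=
  fun i j => r i * A i j * c j

theorem scale_ne_zero {r : X → Rˣ} {c : Y → Rˣ} {A : Matrix X Y R} {i : X} {j : Y} :
    scale r c A i j ≠ 0 ↔ A i j ≠ 0 := by
  simp [scale]

theorem scale_scale (r r' : X → Rˣ) (c c' : Y → Rˣ) (A : Matrix X Y R) :
    scale r c (scale r' c' A) = scale (r * r') (c * c') A := by
  ext i j
  simp only [scale, Pi.mul_apply, Units.val_mul]
  ring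

theorem scale_one (A : Matrix X Y R) : scale 1 1 A = A := by
  ext i j
  simp [scale]

theorem inverse_scale (r : X → Rˣ) (c : Y → Rˣ) (A : Matrix X Y R) (k : X) (l : Y) :
    Ring.inverse (scale r c A k l) = ((c l)⁻¹ : Rˣ) * Ring.inverse (A k l) * ((r k)⁻¹ : Rˣ) := by
  simp only [scale, Ring.mul_inverse_rev, Ring.inverse_unit]
  ring

/-- `B` arises from `A` by multiplying rows and columns by elements of `K`. -/
def ScalingEquiv (K : Subgroup Rˣ) (A B : Matrix X Y R) : Prop :=
  ∃ (r : X → Rˣ) (c : Y → Rˣ), (∀ i, r i ∈ K) ∧ (∀ j, c j ∈ K) ∧ scale r c A = B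

theorem ScalingEquiv.refl (K : Subgroup Rˣ) (A : Matrix X Y R) : ScalingEquiv K A A :=
  ⟨1, 1, fun _ => K.one_mem, fun _ => K.one_mem, scale_one A⟩

theorem ScalingEquiv.trans {K : Subgroup Rˣ} {A B C : Matrix X Y R} :
    ScalingEquiv K A B → ScalingEquiv K B C → ScalingEquiv K A C := by
  rintro ⟨r, c, hr, hc, rfl⟩ ⟨r', c', hr', hc', rfl⟩
  exact ⟨r' * r, c' * c, fun i => K.mul_mem (hr' i) (hr i), fun j => K.mul_mem (hc' j) (hc j),
    (scale_scale _ _ _ _ _).symm⟩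

theorem ScalingEquiv.ne_zero_iff {K : Subgroup Rˣ} {A B : Matrix X Y R} (h : ScalingEquiv K A B)
    {i : X} {j : Y} : B i j ≠ 0 ↔ A i j ≠ 0 := by
  obtain ⟨r, c, -, -, rfl⟩ := h
  exact scale_ne_zero

namespace CrossSystem.Admissible

theorem scalingEquiv {A B : Matrix X Y R} (h : D.Admissible A) (hAB : ScalingEquiv D.units A B) :
    D.Admissible B := by
  obtain ⟨r, c, hr, hc, rfl⟩ := hAB
  refine ⟨fun i j => mul_mem (mul_mem (unit_mem_elems (hr i)) (h.mem i j))
    (unit_mem_elems (hc j)), fun {i j u v} hiv hju => ?_⟩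
  obtain ⟨t, ht, e⟩ := h.cross (scale_ne_zero.1 hiv) (scale_ne_zero.1 hju)
  refine ⟨t, ht, ?_⟩
  simp only [scale]
  linear_combination (r i * c u * r j * c v : R) * e

theorem transpose {A : Matrix X Y R} (h : D.Admissible A) : D.Admissible Aᵀ := by
  refine ⟨fun _ _ => h.mem _ _, fun hiv hju => ?_⟩
  obtain ⟨t, ht, e⟩ := h.cross hju hiv
  exact ⟨t, ht, by simpa [mul_comm] using e⟩

theorem submatrix {X' Y' : Type*} {A : Matrix X Y R} (h : D.Admissible A) (f : X' → X)
    (g : Y' → Y) : D.Admissible (A.submatrix f g) :=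
  ⟨fun _ _ => h.mem _ _, h.cross⟩

end CrossSystem.Admissible

/-- Replace a column by zeros. -/
def dropCol [DecidableEq Y] (A : Matrix X Y R) (x : Y) : Matrix X Y R :=
  fun i j => if j = x then 0 else A i j

@[simp] theorem dropCol_same [DecidableEq Y] (A : Matrix X Y R) (x : Y) (i : X) :
    dropCol A x i x = 0 := by
  simp [dropCol]

theorem dropCol_of_ne [DecidableEq Y] (A : Matrix X Y R) {x j : Y} (h : j ≠ x) (i : X) :
    dropCol A x i j = A i j := by
  simp [dropCol, h]

theorem ne_of_dropCol_ne_zero [DecidableEq Y] {A : Matrix X Y R} {x j : Y} {i : X}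
    (h : dropCol A x i j ≠ 0) : j ≠ x := by
  rintro rfl
  exact h (dropCol_same _ _ _)

theorem CrossSystem.Admissible.dropCol [DecidableEq Y] {A : Matrix X Y R} (h : D.Admissible A)
    (x : Y) : D.Admissible (dropCol A x) := by
  refine ⟨fun i j => ?_, fun {i j u v} hiv hju => ?_⟩
  · by_cases hj : j = x
    · subst hj; rw [dropCol_same]; exact zero_mem_elems
    · rw [dropCol_of_ne _ hj]; exact h.mem i j
  · have hv := ne_of_dropCol_ne_zero hiv
    have hu := ne_of_dropCol_ne_zero hju
    simp only [CrossSystem.Cross, dropCol_of_ne _ hv, dropCol_of_ne _ hu] at *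
    exact h.cross hiv hju

variable [DecidableEq X] [DecidableEq Y]

/-- Pivoting on the entry in row `k` and column `l`. -/
noncomputable def pivot (A : Matrix X Y R) (k : X) (l : Y) : Matrix X Y R := fun i j =>
  if i = k then (if j = l then Ring.inverse (A k l) else Ring.inverse (A k l) * A k j)
  else if j = l then -(A i l * Ring.inverse (A k l))
    else A i j - A i l * Ring.inverse (A k l) * A k j

theorem pivot_same (A : Matrix X Y R) (k : X) (l : Y) :
    pivot A k l k l = Ring.inverse (A k l) := by simp [pivot]

theorem pivot_row (A : Matrix X Y R) (k : X) {l j : Y} (h : j ≠ l) :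
    pivot A k l k j = Ring.inverse (A k l) * A k j := by simp [pivot, h]

theorem pivot_col (A : Matrix X Y R) {k i : X} (l : Y) (h : i ≠ k) :
    pivot A k l i l = -(A i l * Ring.inverse (A k l)) := by simp [pivot, h]

theorem pivot_other (A : Matrix X Y R) {k i : X} {l j : Y} (hi : i ≠ k) (hj : j ≠ l) :
    pivot A k l i j = A i j - A i l * Ring.inverse (A k l) * A k j := by simp [pivot, hi, hj]

theorem pivot_row_of_zero (A : Matrix X Y R) {k i : X} {l : Y} (hi : i ≠ k) (h0 : A i l = 0)
    (j : Y) : pivot A k l i j = A i j := by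
  by_cases hj : j = l
  · subst hj; rw [pivot_col _ _ hi, h0]; simp
  · rw [pivot_other _ hi hj, h0]; simp

theorem pivot_col_of_zero (A : Matrix X Y R) {k : X} {l j : Y} (hj : j ≠ l) (h0 : A k j = 0)
    (i : X) : pivot A k l i j = A i j := by
  by_cases hi : i = k
  · subst hi; rw [pivot_row _ _ hj, h0]; simp
  · rw [pivot_other _ hi hj, h0]; simp

theorem pivot_pivot (A : Matrix X Y R) {k : X} {l : Y} (h : IsUnit (A k l)) :
    pivot (pivot A k l) k l = A := by
  have hmul := Ring.mul_inverse_cancel _ h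
  have hinv : Ring.inverse (Ring.inverse (A k l)) = A k l := Ring.inverse_inverse h
  ext i j
  by_cases hi : i = k
  · subst hi
    by_cases hj : j = l
    · subst hj; rw [pivot_same, pivot_same, hinv]
    · rw [pivot_row _ _ hj, pivot_same, hinv, pivot_row _ _ hj]
      linear_combination A i j * hmul
  · by_cases hj : j = l
    · subst hj
      rw [pivot_col _ _ hi, pivot_same, hinv, pivot_col _ _ hi]
      linear_combination A i j * hmul
    · rw [pivot_other _ hi hj, pivot_same, hinv, pivot_col _ _ hi, pivot_row _ _ hj,
        pivot_other _ hi hj]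
      linear_combination A i l * Ring.inverse (A k l) * A k j * hmul

theorem pivot_scale (A : Matrix X Y R) (r : X → Rˣ) (c : Y → Rˣ) (k : X) (l : Y) :
    pivot (scale r c A) k l =
      scale (Function.update r k (c l)⁻¹) (Function.update c l (r k)⁻¹) (pivot A k l) := by
  have hr : ((r k : Rˣ) : R) * ((r k)⁻¹ : Rˣ) = 1 := (r k).mul_inv
  have hc : ((c l : Rˣ) : R) * ((c l)⁻¹ : Rˣ) = 1 := (c l).mul_inv
  ext i j
  by_cases hi : i = k
  · subst hi
    by_cases hj : j = l
    · subst hj; rw [pivot_same, inverse_scale]; simp [scale, pivot_same]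
    · rw [pivot_row _ _ hj, inverse_scale]
      simp only [scale, pivot_row _ _ hj, Function.update_self, Function.update_of_ne hj]
      linear_combination (((c l)⁻¹ : Rˣ) * Ring.inverse (A i l) * A i j * c j : R) * hr
  · by_cases hj : j = l
    · subst hj
      rw [pivot_col _ _ hi, inverse_scale]
      simp only [scale, pivot_col _ _ hi, Function.update_self, Function.update_of_ne hi]
      linear_combination (-((r k)⁻¹ : Rˣ) * Ring.inverse (A k j) * A i j * r i : R) * hc
    · rw [pivot_other _ hi hj, inverse_scale]
      simp only [scale, pivot_other _ hi hj, Function.update_of_ne hi, Function.update_of_ne hj]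
      linear_combination -(Ring.inverse (A k l) * A i l * r i * c j * A k j : R) *
        (hc * (r k * ((r k)⁻¹ : Rˣ)) + hr)

theorem ScalingEquiv.pivot {K : Subgroup Rˣ} {A B : Matrix X Y R} (h : ScalingEquiv K A B)
    (k : X) (l : Y) : ScalingEquiv K (pivot A k l) (pivot B k l) := by
  obtain ⟨r, c, hr, hc, rfl⟩ := h
  exact ⟨_, _, Function.forall_update_iff r (p := fun _ x => x ∈ K) |>.2
      ⟨K.inv_mem (hc l), fun i _ => hr i⟩,
    Function.forall_update_iff c (p := fun _ x => x ∈ K) |>.2 ⟨K.inv_mem (hr k), fun j _ => hc j⟩,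
    (pivot_scale _ _ _ _ _).symm⟩

theorem pivot_transpose (A : Matrix X Y R) (k : X) (l : Y) :
    pivot Aᵀ l k = scale (Function.update 1 l (-1)) (Function.update 1 k (-1))
      (pivot A k l)ᵀ := by
  ext j i
  by_cases hi : i = k
  · subst hi
    by_cases hj : j = l
    · subst hj; simp [scale, pivot_same]
    · rw [pivot_col _ _ hj]
      simp [scale, pivot_row _ _ hj, Function.update_of_ne hj, mul_comm]
  · by_cases hj : j = l
    · subst hj
      rw [pivot_row _ _ hi]
      simp [scale, pivot_col _ _ hi, Function.update_of_ne hi, mul_comm]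
    · rw [pivot_other _ hj hi]
      simp only [scale, transpose_apply, pivot_other _ hi hj, Function.update_of_ne hi,
        Function.update_of_ne hj, Pi.one_apply, Units.val_one]
      ring

theorem scalingEquiv_pivot_transpose {K : Subgroup Rˣ} (hK : -1 ∈ K) (A : Matrix X Y R) (k : X)
    (l : Y) : ScalingEquiv K (pivot A k l)ᵀ (pivot Aᵀ l k) :=
  ⟨_, _, Function.forall_update_iff _ (p := fun _ x => x ∈ K) |>.2 ⟨hK, fun _ _ => K.one_mem⟩,
    Function.forall_update_iff _ (p := fun _ x => x ∈ K) |>.2 ⟨hK, fun _ _ => K.one_mem⟩,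
    (pivot_transpose A k l).symm⟩

theorem pivot_dropCol (A : Matrix X Y R) {x l : Y} (h : l ≠ x) (k : X) :
    pivot (dropCol A x) k l = dropCol (pivot A k l) x := by
  ext i j
  by_cases hj : j = x
  · subst hj
    rw [dropCol_same, pivot_col_of_zero _ h.symm (dropCol_same _ _ _), dropCol_same]
  · simp only [dropCol_of_ne _ hj, pivot, dropCol_of_ne _ h]

/-- `B` arises from `A` by pivoting once, on a nonzero entry. -/
def PivotStep (A B : Matrix X Y R) : Prop := ∃ k l, A k l ≠ 0 ∧ pivot A k l = B

/-- All matrices that arise from `A` by sequences of pivots are admissible. This replaces the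
condition that all subdeterminants of a matrix over a partial field are defined. -/
def CrossSystem.PivotAdmissible (D : CrossSystem R) (A : Matrix X Y R) : Prop :=
  ∀ B, Relation.ReflTransGen PivotStep A B → D.Admissible B

namespace CrossSystem.PivotAdmissible

variable {A : Matrix X Y R}

theorem admissible (h : D.PivotAdmissible A) : D.Admissible A := h A .refl

theorem mem (h : D.PivotAdmissible A) (i : X) (j : Y) : A i j ∈ D.elems := h.admissible.mem i j

theorem pivot (h : D.PivotAdmissible A) {k : X} {l : Y} (hkl : A k l ≠ 0) :
    D.PivotAdmissible (pivot A k l) :=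
  fun B hB => h B (.head ⟨k, l, hkl, rfl⟩ hB)

theorem of_invariant {S : Set (Matrix X Y R)} (hadm : ∀ B ∈ S, D.Admissible B)
    (hpivot : ∀ B ∈ S, ∀ k l, B k l ≠ 0 → MatrixLift.pivot B k l ∈ S) (hA : A ∈ S) :
    D.PivotAdmissible A := fun B hB => by
  refine hadm B ?_
  induction hB with
  | refl => exact hA
  | tail _ hstep ih =>
    obtain ⟨k, l, hkl, rfl⟩ := hstep
    exact hpivot _ ih k l hkl

theorem of_invariant_scaling {S : Set (Matrix X Y R)} (hadm : ∀ B ∈ S, D.Admissible B)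
    (hpivot : ∀ B ∈ S, ∀ k l, B k l ≠ 0 →
      ∃ B' ∈ S, ScalingEquiv D.units B' (MatrixLift.pivot B k l))
    {A' : Matrix X Y R} (hA : A ∈ S) (hAA' : ScalingEquiv D.units A A') :
    D.PivotAdmissible A' := by
  refine of_invariant (S := {C | ∃ B ∈ S, ScalingEquiv D.units B C}) ?_ ?_ ⟨A, hA, hAA'⟩
  · rintro C ⟨B, hB, hBC⟩
    exact (hadm B hB).scalingEquiv hBC
  · rintro C ⟨B, hB, hBC⟩ k l hkl
    obtain ⟨B', hB', hB'B⟩ := hpivot B hB k l (hBC.ne_zero_iff.1 hkl)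
    exact ⟨B', hB', hB'B.trans (hBC.pivot k l)⟩

theorem scalingEquiv (h : D.PivotAdmissible A) {B : Matrix X Y R}
    (hAB : ScalingEquiv D.units A B) : D.PivotAdmissible B :=
  of_invariant_scaling (S := {C | D.PivotAdmissible C}) (fun _ hC => hC.admissible)
    (fun _ hC _ _ hkl => ⟨_, hC.pivot hkl, .refl _ _⟩) h hAB

theorem transpose (h : D.PivotAdmissible A) : D.PivotAdmissible Aᵀ :=
  of_invariant_scaling (S := {C | D.PivotAdmissible Cᵀ}) (fun _ hC => hC.admissible.transpose)
    (fun C hC k l hkl => ⟨(MatrixLift.pivot Cᵀ l k)ᵀ, hC.pivot hkl,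
      scalingEquiv_pivot_transpose D.neg_one_mem Cᵀ l k⟩)
    (by simpa using h) (.refl _ _)

theorem dropCol (h : D.PivotAdmissible A) (x : Y) : D.PivotAdmissible (dropCol A x) := by
  refine of_invariant (S := {C | ∃ B, D.PivotAdmissible B ∧ MatrixLift.dropCol B x = C}) ?_ ?_
    ⟨A, h, rfl⟩
  · rintro _ ⟨B, hB, rfl⟩
    exact hB.admissible.dropCol x
  · rintro _ ⟨B, hB, rfl⟩ k l hkl
    have hl := ne_of_dropCol_ne_zero hkl
    rw [dropCol_of_ne _ hl] at hkl
    exact ⟨_, hB.pivot hkl, (pivot_dropCol _ hl _).symm⟩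

end CrossSystem.PivotAdmissible

end Basic

/-! ### Lifting units and cross ratios -/

/-- Data for lifting matrices along `π : R →+* R₁`: units and allowed cross ratios of `R₁` lift to
`R`, uniquely for cross ratios, and products and negatives of allowed cross ratios are allowed as
soon as their images are. -/
structure IsLiftSystem {R R₁ : Type*} [CommRing R] [CommRing R₁] (D : CrossSystem R)
    (D₁ : CrossSystem R₁) (π : R →+* R₁) : Prop where
  one_ne_zero : (1 : R₁) ≠ 0
  exists_units_lift : ∀ g₁ ∈ D₁.units, ∃ g ∈ D.units, Units.map (π : R →* R₁) g = g₁
  ratios_subset : D.ratios ⊆ D.elems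
  one_sub_mem_ratios : ∀ h ∈ D.ratios, 1 - h ∈ D.ratios
  inverse_mem_ratios : ∀ h ∈ D.ratios, h ≠ 0 → Ring.inverse h ∈ D.ratios
  mul_mem_ratios : ∀ h ∈ D.ratios, ∀ h' ∈ D.ratios, π (h * h') ∈ D₁.ratios → h * h' ∈ D.ratios
  neg_mem_ratios : ∀ h ∈ D.ratios, π (-h) ∈ D₁.ratios → -h ∈ D.ratios
  injOn : Set.InjOn π D.ratios
  exists_ratios_lift : ∀ p ∈ D₁.ratios, ∃ h ∈ D.ratios, π h = p

section CrossRatios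

variable {R R₁ : Type*} [CommRing R] [CommRing R₁] {X Y : Type*} {D : CrossSystem R}
  {D₁ : CrossSystem R₁} {π : R →+* R₁} {A : Matrix X Y R} {i j k : X} {u v w : Y}

namespace IsLiftSystem

theorem map_ne_zero (L : IsLiftSystem D D₁ π) {a : R} (ha : a ∈ D.elems) (h : a ≠ 0) :
    π a ≠ 0 :=
  have := nontrivial_of_ne _ _ L.one_ne_zero
  ((isUnit_of_mem_elems ha h).map π).ne_zero

theorem map_eq_zero (L : IsLiftSystem D D₁ π) {a : R} (ha : a ∈ D.elems) : π a = 0 ↔ a = 0 :=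
  ⟨fun h => by_contra fun h0 => L.map_ne_zero ha h0 h, fun h => by rw [h, map_zero]⟩

theorem exists_lift (L : IsLiftSystem D D₁ π) {a : R₁} (ha : a ∈ D₁.elems) :
    ∃ b ∈ D.elems, π b = a := by
  rcases ha with rfl | ⟨g, hg, rfl⟩
  · exact ⟨0, zero_mem_elems, map_zero _⟩
  · obtain ⟨g', hg', rfl⟩ := L.exists_units_lift g hg
    exact ⟨g', unit_mem_elems hg', rfl⟩

theorem map_mem_ratios_of_eq_mul (L : IsLiftSystem D D₁ π) (hA : ∀ i j, A i j ∈ D.elems)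
    (hπ : D₁.Admissible (A.map π)) (hiv : A i v ≠ 0) (hju : A j u ≠ 0) {t : R}
    (e : A i u * A j v = t * (A i v * A j u)) : π t ∈ D₁.ratios := by
  obtain ⟨p, hp, hpe⟩ := hπ.cross (L.map_ne_zero (hA i v) hiv) (L.map_ne_zero (hA j u) hju)
  have hunit : IsUnit (π (A i v * A j u)) :=
    (isUnit_of_mem_elems (mul_mem (hA i v) (hA j u))
      (mul_ne_zero_of_mem_elems (hA i v) hiv hju)).map π
  have : π t = p := hunit.mul_right_cancel (by
    simpa only [map_apply, ← map_mul, e] using hpe)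
  rwa [this]

theorem cross_of_eq_mul (L : IsLiftSystem D D₁ π) (hA : ∀ i j, A i j ∈ D.elems)
    (hπ : D₁.Admissible (A.map π)) (hiv : A i v ≠ 0) (hju : A j u ≠ 0) {h h' : R}
    (hh : h ∈ D.ratios) (hh' : h' ∈ D.ratios)
    (e : A i u * A j v = h * h' * (A i v * A j u)) : D.Cross A i j u v :=
  ⟨h * h', L.mul_mem_ratios h hh h' hh' (L.map_mem_ratios_of_eq_mul hA hπ hiv hju e), e⟩

theorem cross_of_eq_neg (L : IsLiftSystem D D₁ π) (hA : ∀ i j, A i j ∈ D.elems)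
    (hπ : D₁.Admissible (A.map π)) (hiv : A i v ≠ 0) (hju : A j u ≠ 0) {h : R}
    (hh : h ∈ D.ratios) (e : A i u * A j v = -h * (A i v * A j u)) : D.Cross A i j u v :=
  ⟨-h, L.neg_mem_ratios h hh (L.map_mem_ratios_of_eq_mul hA hπ hiv hju e), e⟩

theorem cross_swap (L : IsLiftSystem D D₁ π) (hA : ∀ i j, A i j ∈ D.elems) (hiu : A i u ≠ 0)
    (hjv : A j v ≠ 0) (h : D.Cross A i j u v) : D.Cross A j i u v := by
  obtain ⟨t, ht, e⟩ := h
  have ht0 : t ≠ 0 := fun h0 =>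
    mul_ne_zero_of_mem_elems (hA i u) hiu hjv (by rw [e, h0, zero_mul])
  refine ⟨_, L.inverse_mem_ratios t ht ht0, ?_⟩
  linear_combination -Ring.inverse t * e - A j u * A i v * mul_inverse (L.ratios_subset ht) ht0

theorem cross_trans_row (L : IsLiftSystem D D₁ π) (hA : ∀ i j, A i j ∈ D.elems)
    (hπ : D₁.Admissible (A.map π)) (hku : A k u ≠ 0) (hkv : A k v ≠ 0) (hiv : A i v ≠ 0)
    (hju : A j u ≠ 0) (h₁ : D.Cross A i k u v) (h₂ : D.Cross A k j u v) :
    D.Cross A i j u v := by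
  obtain ⟨t, ht, e⟩ := h₁
  obtain ⟨s, hs, e'⟩ := h₂
  refine L.cross_of_eq_mul hA hπ hiv hju ht hs ?_
  apply (isUnit_of_mem_elems (hA k u) hku).mul_left_cancel
  apply (isUnit_of_mem_elems (hA k v) hkv).mul_left_cancel
  linear_combination A k u * A j v * e + t * (A i v * A k u) * e'

theorem cross_trans_col (L : IsLiftSystem D D₁ π) (hA : ∀ i j, A i j ∈ D.elems)
    (hπ : D₁.Admissible (A.map π)) (hiw : A i w ≠ 0) (hjw : A j w ≠ 0) (hiv : A i v ≠ 0)
    (hju : A j u ≠ 0) (h₁ : D.Cross A i j u w) (h₂ : D.Cross A i j w v) :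
    D.Cross A i j u v := by
  obtain ⟨t, ht, e⟩ := h₁
  obtain ⟨s, hs, e'⟩ := h₂
  refine L.cross_of_eq_mul hA hπ hiv hju ht hs ?_
  apply (isUnit_of_mem_elems (hA i w) hiw).mul_left_cancel
  apply (isUnit_of_mem_elems (hA j w) hjw).mul_left_cancel
  linear_combination A i w * A j v * e + t * (A i w * A j u) * e'

end IsLiftSystem

end CrossRatios

section RowPivot

variable {R R₁ : Type*} [CommRing R] [CommRing R₁] {X Y : Type*} [DecidableEq X]
  {D : CrossSystem R} {D₁ : CrossSystem R₁} {π : R →+* R₁}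

/-- Row operations that turn column `l` into the unit vector of row `k`. -/
noncomputable def rowPivot (M : Matrix X Y R) (k : X) (l : Y) : Matrix X Y R := fun i j =>
  if i = k then Ring.inverse (M k l) * M k j else M i j - M i l * Ring.inverse (M k l) * M k j

variable {M : Matrix X Y R} {i j k : X} {l l₀ u v : Y}

theorem rowPivot_row (M : Matrix X Y R) (k : X) (l j : Y) :
    rowPivot M k l k j = Ring.inverse (M k l) * M k j := by simp [rowPivot]

theorem rowPivot_other (M : Matrix X Y R) (hi : i ≠ k) (l j : Y) :
    rowPivot M k l i j = M i j - M i l * Ring.inverse (M k l) * M k j := by simp [rowPivot, hi]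

theorem rowPivot_of_row_zero (hi : i ≠ k) (hil : M i l = 0) (j : Y) :
    rowPivot M k l i j = M i j := by
  rw [rowPivot_other _ hi, hil, zero_mul, zero_mul, sub_zero]

theorem rowPivot_of_col_zero (hi : i ≠ k) {j : Y} (hkj : M k j = 0) (l : Y) :
    rowPivot M k l i j = M i j := by
  rw [rowPivot_other _ hi, hkj, mul_zero, sub_zero]

theorem rowPivot_submatrix_update {c : X → Y} (h : M.submatrix id c = 1) {i : X} {e : Y}
    (hu : IsUnit (M i e)) : (rowPivot M i e).submatrix id (Function.update c i e) = 1 := by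
  have hmul := Ring.mul_inverse_cancel _ hu
  have hM : ∀ a b, M a (c b) = (1 : Matrix X X R) a b := fun a b => by rw [← h]; rfl
  ext a b
  rw [submatrix_apply, id]
  by_cases hb : b = i
  · subst hb
    rw [Function.update_self]
    by_cases ha : a = b
    · subst ha; rw [rowPivot_row, one_apply_eq, mul_comm, hmul]
    · rw [rowPivot_other _ ha, one_apply_ne ha]
      linear_combination -M a e * hmul
  · rw [Function.update_of_ne hb]
    by_cases ha : a = i
    · subst ha; rw [rowPivot_row, hM, one_apply_ne (Ne.symm hb), mul_zero]
    · rw [rowPivot_of_col_zero ha (by rw [hM, one_apply_ne (Ne.symm hb)]), hM]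

theorem rowPivot_eq_of_cross (hkl : IsUnit (M k l)) (hi : i ≠ k) {p : R}
    (h : M i u * M k l = p * (M i l * M k u)) :
    rowPivot M k l i u = -((1 - p) * (M i l * M k u * Ring.inverse (M k l))) := by
  rw [rowPivot_other _ hi]
  linear_combination Ring.inverse (M k l) * h - M i u * Ring.mul_inverse_cancel _ hkl

theorem rowPivot_row_ne_zero (hM : D.Admissible M) (hkl : M k l ≠ 0) (hku : M k u ≠ 0) :
    rowPivot M k l k u ≠ 0 := by
  rw [rowPivot_row]
  exact mul_ne_zero_of_mem_elems (inverse_mem_elems (hM.mem k l))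
    (inverse_ne_zero (hM.mem k l) hkl) hku

/-- Let `k, i, j` be rows and `l, u, v` columns whose `3 × 3` submatrix of `M` has zeros at
`(k, u)`, `(i, l)` and `(j, v)` only. Its determinant has two nonzero terms, and their ratio is
required to be allowed. This is the one condition that `rowPivot M k l` needs beyond admissibility
of `M`. -/
def CrossSystem.Hexagon (D : CrossSystem R) (M : Matrix X Y R) (k : X) (l : Y) : Prop :=
  ∀ i j u v, M k u = 0 → M i l = 0 → M j v = 0 → M i u ≠ 0 → M j l ≠ 0 → M k v ≠ 0 →
    M i v ≠ 0 → M j u ≠ 0 →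
    ∃ h ∈ D.ratios, -(M i u * M j l * M k v) = h * (M i v * M j u * M k l)

namespace IsLiftSystem

theorem rowPivot_mem (L : IsLiftSystem D D₁ π) (hM : D.Admissible M) (hkl : M k l ≠ 0) (i : X)
    (j : Y) : rowPivot M k l i j ∈ D.elems := by
  have hinv := inverse_mem_elems (hM.mem k l)
  by_cases hi : i = k
  · subst hi; rw [rowPivot_row]; exact mul_mem hinv (hM.mem _ _)
  by_cases hil : M i l = 0
  · rw [rowPivot_of_row_zero hi hil]; exact hM.mem i j
  by_cases hkj : M k j = 0
  · rw [rowPivot_of_col_zero hi hkj]; exact hM.mem i j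
  obtain ⟨p, hp, e⟩ := hM.cross (i := i) (j := k) (u := j) (v := l) hil hkj
  rw [rowPivot_eq_of_cross (isUnit_of_mem_elems (hM.mem k l) hkl) hi e]
  exact neg_mem_elems (mul_mem (L.ratios_subset (L.one_sub_mem_ratios p hp))
    (mul_mem (mul_mem (hM.mem _ _) (hM.mem _ _)) hinv))

theorem rowPivot_cross_row (L : IsLiftSystem D D₁ π) (hM : D.Admissible M) (hkl : M k l ≠ 0)
    (hπ : D₁.Admissible ((rowPivot M k l).map π)) (hiv : rowPivot M k l i v ≠ 0)
    (hku : rowPivot M k l k u ≠ 0) : D.Cross (rowPivot M k l) i k u v := by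
  have hmem := L.rowPivot_mem hM hkl
  by_cases hik : i = k
  · subst hik; exact cross_same_row _ _ _ _
  have hku' : M k u ≠ 0 := fun h => hku (by rw [rowPivot_row, h, mul_zero])
  by_cases hkv : M k v = 0
  · exact cross_of_mul_eq_zero (by rw [rowPivot_row, hkv, mul_zero, mul_zero])
  by_cases hil : M i l = 0
  · rw [rowPivot_of_row_zero hik hil] at hiv
    obtain ⟨t, ht, e⟩ := hM.cross hiv hku'
    refine ⟨t, ht, ?_⟩
    rw [rowPivot_of_row_zero hik hil, rowPivot_of_row_zero hik hil, rowPivot_row, rowPivot_row]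
    linear_combination Ring.inverse (M k l) * e
  obtain ⟨p, hp, ep⟩ := hM.cross (i := i) (j := k) (u := u) (v := l) hil hku'
  obtain ⟨q, hq, eq⟩ := hM.cross (i := i) (j := k) (u := v) (v := l) hil hkv
  have hunit := isUnit_of_mem_elems (hM.mem k l) hkl
  have eu := rowPivot_eq_of_cross hunit hik ep
  have ev := rowPivot_eq_of_cross hunit hik eq
  have hq0 : 1 - q ≠ 0 := fun h => hiv (by rw [ev, h, zero_mul, neg_zero])
  have hq1 := L.one_sub_mem_ratios q hq
  refine L.cross_of_eq_mul hmem hπ hiv hku (L.one_sub_mem_ratios p hp)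
    (L.inverse_mem_ratios _ hq1 hq0) ?_
  rw [eu, ev, rowPivot_row, rowPivot_row]
  linear_combination (1 - p) * (M i l * M k u * Ring.inverse (M k l) ^ 2 * M k v) *
    mul_inverse (L.ratios_subset hq1) hq0

theorem rowPivot_cross_of_ne_zero (L : IsLiftSystem D D₁ π) (hM : D.Admissible M)
    (hkl : M k l ≠ 0) (hπ : D₁.Admissible ((rowPivot M k l).map π))
    (hiv : rowPivot M k l i v ≠ 0) (hju : rowPivot M k l j u ≠ 0) (hku : M k u ≠ 0)
    (hkv : M k v ≠ 0) : D.Cross (rowPivot M k l) i j u v :=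
  have hku' := rowPivot_row_ne_zero hM hkl hku
  have hkv' := rowPivot_row_ne_zero hM hkl hkv
  L.cross_trans_row (L.rowPivot_mem hM hkl) hπ hku' hkv' hiv hju
    (L.rowPivot_cross_row hM hkl hπ hiv hku') (L.rowPivot_cross_row hM hkl hπ hju hkv').symm

theorem rowPivot_cross_of_hexagon (L : IsLiftSystem D D₁ π) (hM : D.Admissible M)
    (hkl : M k l ≠ 0) (hπ : D₁.Admissible ((rowPivot M k l).map π)) (hex : D.Hexagon M k l)
    (hiv : rowPivot M k l i v ≠ 0) (hju : rowPivot M k l j u ≠ 0) (hku : M k u = 0)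
    (hkv : M k v ≠ 0) (hik : i ≠ k) (hjk : j ≠ k) (hil : M i l = 0) (hjl : M j l ≠ 0) :
    D.Cross (rowPivot M k l) i j u v := by
  have he := mul_inverse (hM.mem k l) hkl
  have hi : ∀ j, rowPivot M k l i j = M i j := rowPivot_of_row_zero hik hil
  have hj : rowPivot M k l j u = M j u := rowPivot_of_col_zero hjk hku l
  have hiv' : M i v ≠ 0 := hi v ▸ hiv
  have hju' : M j u ≠ 0 := hj ▸ hju
  by_cases hiu : M i u = 0
  · exact cross_of_mul_eq_zero (by rw [hi, hiu, zero_mul])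
  by_cases hjv : M j v = 0
  · obtain ⟨t, ht, e⟩ := hex i j u v hku hil hjv hiu hjl hkv hiv' hju'
    refine ⟨t, ht, ?_⟩
    rw [hi, hi, hj, rowPivot_other _ hjk, hjv]
    linear_combination Ring.inverse (M k l) * e + t * M i v * M j u * he
  · obtain ⟨p, hp, ep⟩ := hM.cross (i := k) (j := j) (u := v) (v := l) hkl hjv
    obtain ⟨s, hs, es⟩ := hM.cross (i := i) (j := j) (u := u) (v := v) hiv' hju'
    refine L.cross_of_eq_mul (L.rowPivot_mem hM hkl) hπ hiv hju hs (L.one_sub_mem_ratios p hp) ?_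
    rw [hi, hi, hj, rowPivot_other _ hjk]
    linear_combination (1 - p) * es - M i u * Ring.inverse (M k l) * ep -
      M i u * p * M j v * he

theorem rowPivot_cross_of_unit_col (L : IsLiftSystem D D₁ π) (hM : D.Admissible M)
    (hkl : M k l ≠ 0) (hπ : D₁.Admissible ((rowPivot M k l).map π)) (hl₀ : M k l₀ ≠ 0)
    (hl₀' : ∀ i ≠ k, M i l₀ = 0) (hiv : rowPivot M k l i v ≠ 0) (hju : rowPivot M k l j u ≠ 0)
    (hku : M k u = 0) (hkv : M k v ≠ 0) (hik : i ≠ k) (hjk : j ≠ k) (hil : M i l ≠ 0)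
    (hjl : M j l ≠ 0) : D.Cross (rowPivot M k l) i j u v := by
  have hcol : ∀ i ≠ k, rowPivot M k l i l₀ = -(M i l * (Ring.inverse (M k l) * M k l₀)) :=
    fun i hi => by rw [rowPivot_other _ hi, hl₀' i hi]; ring
  have hcol_ne : ∀ i ≠ k, M i l ≠ 0 → rowPivot M k l i l₀ ≠ 0 := fun i hi hil => by
    rw [hcol i hi, neg_ne_zero, ← rowPivot_row]
    exact mul_ne_zero_of_mem_elems (hM.mem i l) hil (rowPivot_row_ne_zero hM hkl hl₀)
  have hcross : D.Cross (rowPivot M k l) i j u l₀ := by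
    rw [rowPivot_of_col_zero hjk hku] at hju
    obtain ⟨t, ht, e⟩ := hM.cross (i := i) (j := j) (u := u) (v := l) hil hju
    refine ⟨t, ht, ?_⟩
    rw [hcol i hik, hcol j hjk, rowPivot_of_col_zero hik hku, rowPivot_of_col_zero hjk hku]
    linear_combination -(Ring.inverse (M k l) * M k l₀) * e
  exact L.cross_trans_col (L.rowPivot_mem hM hkl) hπ (hcol_ne i hik hil) (hcol_ne j hjk hjl) hiv
    hju hcross (L.rowPivot_cross_of_ne_zero hM hkl hπ hiv (hcol_ne j hjk hjl) hl₀ hkv)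

theorem rowPivot_cross_of_left_zero (L : IsLiftSystem D D₁ π) (hM : D.Admissible M)
    (hkl : M k l ≠ 0) (hπ : D₁.Admissible ((rowPivot M k l).map π)) (hex : D.Hexagon M k l)
    (hl₀ : M k l₀ ≠ 0) (hl₀' : ∀ i ≠ k, M i l₀ = 0) (hiv : rowPivot M k l i v ≠ 0)
    (hju : rowPivot M k l j u ≠ 0) (hku : M k u = 0) (hkv : M k v ≠ 0) (hik : i ≠ k)
    (hjk : j ≠ k) : D.Cross (rowPivot M k l) i j u v := by
  by_cases hil : M i l = 0 <;> by_cases hjl : M j l = 0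
  · simp only [CrossSystem.Cross, rowPivot_of_row_zero hik hil, rowPivot_of_row_zero hjk hjl]
      at hiv hju ⊢
    exact hM.cross hiv hju
  · exact L.rowPivot_cross_of_hexagon hM hkl hπ hex hiv hju hku hkv hik hjk hil hjl
  · by_cases hiu : rowPivot M k l i u = 0
    · exact cross_of_mul_eq_zero (by rw [hiu, zero_mul])
    by_cases hjv : rowPivot M k l j v = 0
    · exact cross_of_mul_eq_zero (by rw [hjv, mul_zero])
    exact L.cross_swap (L.rowPivot_mem hM hkl) hju hiv
      (L.rowPivot_cross_of_hexagon hM hkl hπ hex hjv hiu hku hkv hjk hik hjl hil)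
  · exact L.rowPivot_cross_of_unit_col hM hkl hπ hl₀ hl₀' hiv hju hku hkv hik hjk hil hjl

theorem admissible_rowPivot (L : IsLiftSystem D D₁ π) (hM : D.Admissible M) (hkl : M k l ≠ 0)
    (hπ : D₁.Admissible ((rowPivot M k l).map π)) (hex : D.Hexagon M k l) (hl₀ : M k l₀ ≠ 0)
    (hl₀' : ∀ i ≠ k, M i l₀ = 0) : D.Admissible (rowPivot M k l) := by
  refine ⟨L.rowPivot_mem hM hkl, fun {i j u v} hiv hju => ?_⟩
  by_cases hik : i = k
  · subst hik; exact (L.rowPivot_cross_row hM hkl hπ hju hiv).symm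
  by_cases hjk : j = k
  · subst hjk; exact L.rowPivot_cross_row hM hkl hπ hiv hju
  by_cases hku : M k u = 0 <;> by_cases hkv : M k v = 0
  · simp only [CrossSystem.Cross, rowPivot_of_col_zero hik hku, rowPivot_of_col_zero hjk hku,
      rowPivot_of_col_zero hik hkv, rowPivot_of_col_zero hjk hkv] at hiv hju ⊢
    exact hM.cross hiv hju
  · exact L.rowPivot_cross_of_left_zero hM hkl hπ hex hl₀ hl₀' hiv hju hku hkv hik hjk
  · exact (L.rowPivot_cross_of_left_zero hM hkl hπ hex hl₀ hl₀' hju hiv hkv hku hjk hik).symm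
  · exact L.rowPivot_cross_of_ne_zero hM hkl hπ hiv hju hku hkv

end IsLiftSystem

theorem exists_ratio_of_rowPivot_left (hM : D.Admissible M) (hik : i ≠ k) (hij : i ≠ j)
    (hiu : M i u ≠ 0) (h : D.Admissible (rowPivot M i u)) (hku : M k u = 0) (hil : M i l = 0)
    (hjv : M j v = 0) (hkl : M k l ≠ 0) (hiv : M i v ≠ 0) (hju : M j u ≠ 0) :
    ∃ h ∈ D.ratios, -(M i u * M j l * M k v) = h * (M i v * M j u * M k l) := by
  have hinv := inverse_mem_elems (hM.mem i u)
  have hk : ∀ w, rowPivot M i u k w = M k w := rowPivot_of_row_zero hik.symm hku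
  have hjv' : rowPivot M i u j v = -(M j u * Ring.inverse (M i u) * M i v) := by
    rw [rowPivot_other _ hij.symm, hjv, zero_sub]
  have hjv0 : rowPivot M i u j v ≠ 0 := by
    rw [hjv', neg_ne_zero]
    exact mul_ne_zero_of_mem_elems (mul_mem (hM.mem _ _) hinv) (mul_ne_zero_of_mem_elems
      (hM.mem _ _) hju (inverse_ne_zero (hM.mem i u) hiu)) hiv
  obtain ⟨t, ht, e⟩ := h.cross (i := j) (j := k) (u := l) (v := v) hjv0 (by rwa [hk])
  rw [hk, hk, rowPivot_of_col_zero hij.symm hil, hjv'] at e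
  exact ⟨t, ht, by
    linear_combination -M i u * e + t * M j u * M i v * M k l * mul_inverse (hM.mem i u) hiu⟩

theorem exists_ratio_of_rowPivot_right (hM : D.Admissible M) (hik : i ≠ k) (hij : i ≠ j)
    (hiv : M i v ≠ 0) (h : D.Admissible (rowPivot M i v)) (hku : M k u = 0) (hil : M i l = 0)
    (hjv : M j v = 0) (hkl : M k l ≠ 0) (hju : M j u ≠ 0) :
    ∃ h ∈ D.ratios, -(M i u * M j l * M k v) = h * (M i v * M j u * M k l) := by
  have hj : ∀ w, rowPivot M i v j w = M j w := rowPivot_of_row_zero hij.symm hjv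
  have hkl' : rowPivot M i v k l = M k l := rowPivot_of_col_zero hik.symm hil v
  have hku' : rowPivot M i v k u = -(M k v * Ring.inverse (M i v) * M i u) := by
    rw [rowPivot_other _ hik.symm, hku, zero_sub]
  obtain ⟨t, ht, e⟩ := h.cross (i := k) (j := j) (u := u) (v := l) (by rwa [hkl']) (by rwa [hj])
  rw [hj, hj, hkl', hku'] at e
  exact ⟨t, ht, by
    linear_combination M i v * e + M k v * M i u * M j l * mul_inverse (hM.mem i v) hiv⟩

theorem hexagon_of_admissible_rowPivot (hM : D.Admissible M) (hkl : M k l ≠ 0) {W : Set Y}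
    (hW : ∀ u v, u ≠ v → u ≠ l → v ≠ l → u ∈ W ∨ v ∈ W)
    (h : ∀ i, ∀ w ∈ W, M i w ≠ 0 → D.Admissible (rowPivot M i w)) : D.Hexagon M k l := by
  intro i j u v hku hil hjv hiu hjl hkv hiv hju
  have huv : u ≠ v := by rintro rfl; exact hkv hku
  have hul : u ≠ l := by rintro rfl; exact hkl hku
  have hvl : v ≠ l := by rintro rfl; exact hjl hjv
  have hik : i ≠ k := by rintro rfl; exact hkl hil
  have hij : i ≠ j := by rintro rfl; exact hiv hjv
  rcases hW u v huv hul hvl with hu | hv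
  · exact exists_ratio_of_rowPivot_left hM hik hij hiu (h i u hu hiu) hku hil hjv hkl hiv hju
  · exact exists_ratio_of_rowPivot_right hM hik hij hiv (h i v hv hiv) hku hil hjv hkl hju

end RowPivot

/-! ### Minors of `[I | A]` -/

section ReduceAt

variable {R : Type*} {X E E' : Type*}

theorem submatrix_update [DecidableEq X] (N : Matrix X E R) (c : X → E) (i : X) (e : E) :
    N.submatrix id (Function.update c i e) = (N.submatrix id c).updateCol i (fun k => N k e) := by
  ext a b
  by_cases hb : b = i
  · subst hb; simp
  · simp [hb]

variable [CommRing R] [Fintype X]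

theorem mul_submatrix_id (U : Matrix X X R) (N : Matrix X E R) (c : E' → E) :
    (U * N).submatrix id c = U * N.submatrix id c := by
  rw [submatrix_mul U N id id c Function.bijective_id, submatrix_id_id]

variable [DecidableEq X]

/-- The matrix obtained from `N` by the row operations that turn the columns `c` into the identity
matrix. It is meaningful only if the determinant of these columns is a unit. -/
noncomputable def reduceAt (N : Matrix X E R) (c : X → E) : Matrix X E R :=
  (N.submatrix id c)⁻¹ * N

variable {N : Matrix X E R} {c : X → E}

theorem reduceAt_submatrix (N : Matrix X E R) (σ : E' → E) (c : X → E') :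
    reduceAt (N.submatrix id σ) c = (reduceAt N (σ ∘ c)).submatrix id σ := by
  rw [reduceAt, reduceAt, mul_submatrix_id, submatrix_submatrix, Function.comp_id]

theorem reduceAt_mul {U : Matrix X X R} (hU : IsUnit U.det) (N : Matrix X E R) (c : X → E) :
    reduceAt (U * N) c = reduceAt N c := by
  rw [reduceAt, reduceAt, mul_submatrix_id, Matrix.mul_inv_rev, Matrix.mul_assoc,
    nonsing_inv_mul_cancel_left _ _ hU]

theorem reduceAt_eq_self (h : N.submatrix id c = 1) : reduceAt N c = N := by
  rw [reduceAt, h, inv_one, Matrix.one_mul]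

theorem reduceAt_submatrix_self (h : IsUnit (N.submatrix id c).det) :
    (reduceAt N c).submatrix id c = 1 := by
  rw [reduceAt, mul_submatrix_id, nonsing_inv_mul _ h]

theorem mul_reduceAt (h : IsUnit (N.submatrix id c).det) :
    N.submatrix id c * reduceAt N c = N := by
  rw [reduceAt, mul_nonsing_inv_cancel_left _ _ h]

theorem reduceAt_reduceAt (h : IsUnit (N.submatrix id c).det) (c' : X → E) :
    reduceAt (reduceAt N c) c' = reduceAt N c' :=
  reduceAt_mul (by rw [det_nonsing_inv]; exact h.ringInverse) N c'

theorem det_submatrix_update (h : IsUnit (N.submatrix id c).det) (i : X) (e : E) :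
    (N.submatrix id (Function.update c i e)).det =
      (N.submatrix id c).det * reduceAt N c i e := by
  conv_lhs => rw [← mul_reduceAt h, mul_submatrix_id, det_mul, submatrix_update,
    reduceAt_submatrix_self h, ← cramer_apply, cramer_one]
  rfl

theorem reduceAt_map {R₁ : Type*} [CommRing R₁] (π : R →+* R₁)
    (h : IsUnit (N.submatrix id c).det) : (reduceAt N c).map π = reduceAt (N.map π) c := by
  have hmul : (N.map π).submatrix id c * (reduceAt N c).map π = N.map π := by
    rw [submatrix_map, ← Matrix.map_mul, mul_reduceAt h]
  have hunit : IsUnit ((N.map π).submatrix id c).det := by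
    rw [submatrix_map, ← RingHom.mapMatrix_apply, ← RingHom.map_det]
    exact h.map π
  rw [← nonsing_inv_mul_cancel_left _ ((reduceAt N c).map π) hunit, hmul, reduceAt]

/-- The matrix of the row operations of `rowPivot`. -/
noncomputable def rowPivotMatrix (M : Matrix X E R) (k : X) (l : E) : Matrix X X R :=
  (1 : Matrix X X R).updateCol k
    (fun i => if i = k then Ring.inverse (M k l) else -(M i l * Ring.inverse (M k l)))

theorem det_rowPivotMatrix (M : Matrix X E R) (k : X) (l : E) :
    (rowPivotMatrix M k l).det = Ring.inverse (M k l) := by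
  rw [rowPivotMatrix, ← cramer_apply, cramer_one]
  simp

theorem rowPivotMatrix_mul (M : Matrix X E R) (k : X) (l : E) :
    rowPivotMatrix M k l * M = rowPivot M k l := by
  ext i j
  rw [mul_apply, ← Finset.add_sum_erase _ _ (Finset.mem_univ k), rowPivotMatrix]
  by_cases hi : i = k
  · subst hi
    rw [rowPivot_row, Finset.sum_eq_zero, updateCol_self]
    · simp
    · intro a ha
      have := Finset.ne_of_mem_erase ha
      rw [updateCol_ne this, one_apply_ne this.symm, zero_mul]
  · rw [rowPivot_other _ hi, Finset.sum_eq_single i]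
    · rw [updateCol_self, updateCol_ne hi, one_apply_eq, if_neg hi]
      ring
    · intro a ha hai
      rw [updateCol_ne (Finset.ne_of_mem_erase ha), one_apply_ne hai.symm, zero_mul]
    · intro h
      exact absurd (Finset.mem_erase.2 ⟨hi, Finset.mem_univ _⟩) h

theorem isUnit_det_rowPivotMatrix {M : Matrix X E R} {k : X} {l : E} (h : IsUnit (M k l)) :
    IsUnit (rowPivotMatrix M k l).det := by
  rw [det_rowPivotMatrix]
  exact h.ringInverse

theorem reduceAt_update (h : IsUnit (N.submatrix id c).det) {i : X} {e : E}
    (hu : IsUnit (reduceAt N c i e)) :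
    reduceAt N (Function.update c i e) = rowPivot (reduceAt N c) i e := by
  rw [← reduceAt_reduceAt h, ← reduceAt_mul (isUnit_det_rowPivotMatrix hu), rowPivotMatrix_mul]
  exact reduceAt_eq_self (rowPivot_submatrix_update (reduceAt_submatrix_self h) hu)

theorem exists_perm_of_det_ne_zero {M : Matrix X X R} (h : M.det ≠ 0) :
    ∃ σ : Equiv.Perm X, ∀ i, M (σ i) i ≠ 0 := by
  contrapose! h
  rw [det_apply]
  refine Finset.sum_eq_zero fun σ _ => ?_
  obtain ⟨i, hi⟩ := h σ
  have hprod : ∏ i, M (σ i) i = 0 := Finset.prod_eq_zero (Finset.mem_univ i) hi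
  simp [hprod]

end ReduceAt

section Augmented

variable {R : Type*} [CommRing R] {X Y : Type*} [DecidableEq X] {D : CrossSystem R}

/-- The matrix `[I | A]`. -/
abbrev augmented (A : Matrix X Y R) : Matrix X (X ⊕ Y) R := fromCols 1 A

theorem CrossSystem.Admissible.fromCols_one {A : Matrix X Y R} (hA : D.Admissible A) :
    D.Admissible (augmented A) := by
  constructor
  · rintro i (a | j)
    · by_cases h : i = a
      · subst h; simp
      · simpa [one_apply_ne h] using zero_mem_elems
    · exact hA.mem i j
  · intro i j u v hiv hju
    by_cases hij : i = j
    · subst hij; exact cross_same_row _ _ _ _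
    rcases u with a | u
    · have : j = a := by by_contra h; exact hju (by simp [one_apply_ne h])
      subst this
      exact cross_of_mul_eq_zero (by simp [one_apply_ne hij])
    rcases v with b | v
    · have : i = b := by by_contra h; exact hiv (by simp [one_apply_ne h])
      subst this
      exact cross_of_mul_eq_zero (by simp [one_apply_ne (Ne.symm hij)])
    · exact hA.cross hiv hju

section Exchange

variable [DecidableEq Y]

/-- The permutation of the columns of `[I | A]` that accompanies pivoting on the entry `(k, l)`. -/
abbrev exchange (k : X) (l : Y) : Equiv.Perm (X ⊕ Y) := Equiv.swap (.inl k) (.inr l)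

theorem rowPivot_augmented (A : Matrix X Y R) {k : X} {l : Y} (h : IsUnit (A k l)) :
    rowPivot (augmented A) k (.inr l) =
      (augmented (pivot A k l)).submatrix id (exchange k l) := by
  have hmul := Ring.mul_inverse_cancel _ h
  ext i e
  rw [submatrix_apply, id]
  rcases e with a | j
  · by_cases ha : a = k
    · subst ha
      rw [Equiv.swap_apply_left]
      by_cases hi : i = a
      · subst hi; simp [rowPivot_row, pivot_same]
      · simp [rowPivot_other _ hi, pivot_col _ _ hi, one_apply_ne hi]
    · rw [Equiv.swap_apply_of_ne_of_ne (by simpa using ha) (by simp)]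
      by_cases hi : i = k
      · subst hi; simp [rowPivot_row, one_apply_ne (Ne.symm ha)]
      · simp [rowPivot_other _ hi, one_apply_ne (Ne.symm ha)]
  · by_cases hj : j = l
    · subst hj
      rw [Equiv.swap_apply_right]
      by_cases hi : i = k
      · subst hi; simp [rowPivot_row, mul_comm, hmul]
      · simp only [rowPivot_other _ hi, fromCols_apply_inr, fromCols_apply_inl, one_apply_ne hi]
        linear_combination -A i j * hmul
    · rw [Equiv.swap_apply_of_ne_of_ne (by simp) (by simpa using hj)]
      by_cases hi : i = k
      · subst hi; simp [rowPivot_row, pivot_row _ _ hj]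
      · simp [rowPivot_other _ hi, pivot_other _ hi hj]

theorem exchange_comp_eq_inr_iff {k : X} {l l' : Y} {c : X → X ⊕ Y} (hk : ∀ i, c i ≠ .inl k)
    (i : X) : (exchange k l ∘ c) i = .inr l' ↔ c i = .inr l' ∧ c i ≠ .inr l := by
  rw [Function.comp_apply]
  by_cases hi : c i = .inr l
  · simp [hi]
  · rw [Equiv.swap_apply_of_ne_of_ne (hk i) hi]
    simp [hi]

end Exchange

variable [Fintype X]

theorem exists_ne_zero_of_det_augmented_ne_zero {A : Matrix X Y R} {c : X → X ⊕ Y}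
    (h : ((augmented A).submatrix id c).det ≠ 0) {i₀ : X} {l : Y} (hi₀ : c i₀ = .inr l) :
    ∃ k, A k l ≠ 0 ∧ ∀ i, c i ≠ .inl k := by
  obtain ⟨σ, hσ⟩ := exists_perm_of_det_ne_zero h
  refine ⟨σ i₀, by simpa [hi₀] using hσ i₀, fun i hi => ?_⟩
  have hne : (1 : Matrix X X R) (σ i) (σ i₀) ≠ 0 := by simpa [hi] using hσ i
  have : σ i = σ i₀ := by_contra fun h => hne (one_apply_ne h)
  rw [σ.injective this, hi₀] at hi
  cases hi

theorem exists_perm_of_det_augmented_ne_zero {A : Matrix X Y R} {c : X → X ⊕ Y}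
    (h : ((augmented A).submatrix id c).det ≠ 0) (hc : ∀ i l, c i ≠ .inr l) :
    ∃ σ : Equiv.Perm X, c = fun i => .inl (σ i) := by
  have : ∀ i, ∃ a, c i = .inl a := fun i => by
    rcases hi : c i with a | l
    · exact ⟨a, rfl⟩
    · exact absurd hi (hc i l)
  choose τ hτ using this
  have hinj : Function.Injective τ := fun i j hij => by_contra fun hne =>
    h (det_zero_of_column_eq hne fun k => by simp [hτ, hij])
  exact ⟨.ofBijective τ (Finite.injective_iff_bijective.1 hinj), funext hτ⟩

/-- The determinant of the columns `c` of `N` is in the group of units, and `N` becomes admissible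
after turning these columns into the identity matrix. -/
structure CrossSystem.AdmissibleAt (D : CrossSystem R) {E : Type*} (N : Matrix X E R)
    (c : X → E) : Prop where
  det : ∃ g ∈ D.units, (g : R) = (N.submatrix id c).det
  admissible : D.Admissible (reduceAt N c)

theorem CrossSystem.Admissible.admissibleAt_inl {A : Matrix X Y R} (hA : D.Admissible A)
    (σ : Equiv.Perm X) : D.AdmissibleAt (augmented A) fun i => .inl (σ i) := by
  have hsub : (augmented A).submatrix id (fun i => .inl (σ i)) =
      (1 : Matrix X X R).submatrix id σ := rfl
  constructor
  · rw [hsub, det_permute', det_one, mul_one]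
    rcases Int.units_eq_one_or (Equiv.Perm.sign σ) with h | h
    · exact ⟨1, D.units.one_mem, by simp [h]⟩
    · exact ⟨-1, D.neg_one_mem, by simp [h]⟩
  · have hinv : ((1 : Matrix X X R).submatrix id σ)⁻¹ = (1 : Matrix X X R).submatrix σ id := by
      simpa using inv_submatrix_equiv (1 : Matrix X X R) (.refl X) σ
    have hmul := one_submatrix_mul (σ : X → X) (.refl X) (augmented A)
    rw [reduceAt, hsub, hinv]
    exact hmul ▸ hA.fromCols_one.submatrix _ _

theorem admissible_of_admissibleAt [Nontrivial R] {A : Matrix X Y R}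
    (h : ∀ c, ((augmented A).submatrix id c).det ≠ 0 → D.AdmissibleAt (augmented A) c) :
    D.Admissible A := by
  have hinl : (augmented A).submatrix id Sum.inl = 1 := rfl
  have hadm := (h Sum.inl (by rw [hinl, det_one]; exact one_ne_zero)).admissible
  rw [reduceAt_eq_self hinl] at hadm
  exact hadm.submatrix id Sum.inr

variable [DecidableEq Y]

theorem card_isRight_exchange_comp_lt {k : X} {l : Y} {c : X → X ⊕ Y} (hk : ∀ i, c i ≠ .inl k)
    {i₀ : X} (hi₀ : c i₀ = .inr l) :
    (Finset.univ.filter fun i => ((exchange k l ∘ c) i).isRight).card <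
      (Finset.univ.filter fun i => (c i).isRight).card := by
  refine Finset.card_lt_card ⟨fun i hi => ?_, fun hsub => ?_⟩
  · rw [Finset.mem_filter_univ] at hi ⊢
    obtain ⟨l', hl'⟩ := Sum.isRight_iff.1 hi
    rw [((exchange_comp_eq_inr_iff hk i).1 hl').1]
    rfl
  · have := hsub (x := i₀) (by simp [hi₀])
    simp [hi₀] at this

theorem det_augmented_pivot {A : Matrix X Y R} {k : X} {l : Y} (h : IsUnit (A k l))
    (c : X → X ⊕ Y) :
    ((augmented (pivot A k l)).submatrix id (exchange k l ∘ c)).det =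
      Ring.inverse (A k l) * ((augmented A).submatrix id c).det := by
  have hmul := rowPivotMatrix_mul (augmented A) k (.inr l)
  rw [rowPivot_augmented A h] at hmul
  rw [← fromCols_apply_inr (1 : Matrix X X R) A, ← det_rowPivotMatrix, ← det_mul,
    ← mul_submatrix_id, hmul, submatrix_submatrix, Function.id_comp]

theorem det_augmented_pivot_ne_zero {A : Matrix X Y R} {k : X} {l : Y} (h : IsUnit (A k l))
    {c : X → X ⊕ Y} : ((augmented (pivot A k l)).submatrix id (exchange k l ∘ c)).det ≠ 0 ↔
      ((augmented A).submatrix id c).det ≠ 0 := by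
  rw [det_augmented_pivot h, Ne, h.ringInverse.mul_right_eq_zero]

theorem reduceAt_augmented_pivot {A : Matrix X Y R} {k : X} {l : Y} (h : IsUnit (A k l))
    (c : X → X ⊕ Y) :
    (reduceAt (augmented (pivot A k l)) (exchange k l ∘ c)).submatrix id (exchange k l) =
      reduceAt (augmented A) c := by
  rw [← reduceAt_submatrix, ← rowPivot_augmented A h, ← rowPivotMatrix_mul,
    reduceAt_mul (isUnit_det_rowPivotMatrix (by exact h))]

theorem admissibleAt_augmented_pivot {A : Matrix X Y R} {k : X} {l : Y} (hkl : A k l ∈ D.elems)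
    (hkl0 : A k l ≠ 0) {c : X → X ⊕ Y} :
    D.AdmissibleAt (augmented (pivot A k l)) (exchange k l ∘ c) ↔
      D.AdmissibleAt (augmented A) c := by
  obtain ⟨a, ha, hakl⟩ := exists_unit hkl hkl0
  have hunit := isUnit_of_mem_elems hkl hkl0
  have hdet := det_augmented_pivot hunit c
  have hred := reduceAt_augmented_pivot hunit c
  rw [← hakl, Ring.inverse_unit] at hdet
  constructor
  · rintro ⟨⟨g, hg, hgdet⟩, hadm⟩
    refine ⟨⟨a * g, D.units.mul_mem ha hg, by rw [Units.val_mul, hgdet, hdet]; simp⟩, ?_⟩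
    rw [← hred]
    exact hadm.submatrix _ _
  · rintro ⟨⟨g, hg, hgdet⟩, hadm⟩
    refine ⟨⟨a⁻¹ * g, D.units.mul_mem (D.units.inv_mem ha) hg,
      by rw [Units.val_mul, hgdet, hdet]⟩, ?_⟩
    rw [← hred] at hadm
    have hsub := hadm.submatrix id (exchange k l)
    rwa [submatrix_submatrix, ← Equiv.coe_trans, Equiv.swap_swap] at hsub

/-- Every nonzero maximal minor of `[I | A]` can be reached by pivoting on columns it uses. -/
theorem admissibleAt_of_invariant {S : Set (Matrix X Y R)} {W : Set Y}
    (hadm : ∀ B ∈ S, D.Admissible B)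
    (hpivot : ∀ B ∈ S, ∀ k, ∀ l ∈ W, B k l ≠ 0 → pivot B k l ∈ S) {A : Matrix X Y R} (hA : A ∈ S)
    {c : X → X ⊕ Y} (hc : ∀ i l, c i = .inr l → l ∈ W)
    (hdet : ((augmented A).submatrix id c).det ≠ 0) : D.AdmissibleAt (augmented A) c := by
  induction hn : (Finset.univ.filter fun i => (c i).isRight).card using Nat.strong_induction_on
    generalizing A c with
  | _ n ih =>
  by_cases hr : ∃ i l, c i = .inr l
  · obtain ⟨i₀, l, hl⟩ := hr
    obtain ⟨k, hkl, hk⟩ := exists_ne_zero_of_det_augmented_ne_zero hdet hl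
    have hmem := (hadm A hA).mem k l
    rw [← admissibleAt_augmented_pivot hmem hkl]
    exact ih _ (hn ▸ card_isRight_exchange_comp_lt hk hl) (hpivot A hA k l (hc i₀ l hl) hkl)
      (fun i l' h => hc i l' ((exchange_comp_eq_inr_iff hk i).1 h).1)
      ((det_augmented_pivot_ne_zero (isUnit_of_mem_elems hmem hkl)).2 hdet) rfl
  · push Not at hr
    obtain ⟨σ, rfl⟩ := exists_perm_of_det_augmented_ne_zero hdet hr
    exact (hadm A hA).admissibleAt_inl σ

theorem CrossSystem.PivotAdmissible.admissibleAt {A : Matrix X Y R} (hA : D.PivotAdmissible A)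
    {c : X → X ⊕ Y} (hdet : ((augmented A).submatrix id c).det ≠ 0) :
    D.AdmissibleAt (augmented A) c :=
  admissibleAt_of_invariant (S := {B | D.PivotAdmissible B}) (W := Set.univ)
    (fun _ hB => hB.admissible) (fun _ hB _ _ _ hkl => hB.pivot hkl) hA
    (fun _ _ _ => Set.mem_univ _) hdet

theorem pivotAdmissible_of_admissibleAt [Nontrivial R] {A : Matrix X Y R}
    (h : ∀ c, ((augmented A).submatrix id c).det ≠ 0 → D.AdmissibleAt (augmented A) c) :
    D.PivotAdmissible A := by
  refine .of_invariant (S := {B | ∀ c, ((augmented B).submatrix id c).det ≠ 0 →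
    D.AdmissibleAt (augmented B) c}) (fun B hB => admissible_of_admissibleAt hB)
    (fun B hB k l hkl c hc => ?_) h
  have hmem := (admissible_of_admissibleAt hB).mem k l
  have hcomp : c = exchange k l ∘ (exchange k l ∘ c) := by ext i; simp
  rw [hcomp] at hc ⊢
  rw [admissibleAt_augmented_pivot hmem hkl]
  exact hB _ ((det_augmented_pivot_ne_zero (isUnit_of_mem_elems hmem hkl)).1 hc)

end Augmented

/-! ### Gluing two lifts -/

section

variable {R R₁ : Type*} [CommRing R] [CommRing R₁] {X Y : Type*} [DecidableEq X]
  {D : CrossSystem R} {D₁ : CrossSystem R₁} {π : R →+* R₁}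

theorem IsLiftSystem.nontrivial_domain (L : IsLiftSystem D D₁ π) : Nontrivial R :=
  have := nontrivial_of_ne _ _ L.one_ne_zero
  π.domain_nontrivial

theorem IsLiftSystem.nontrivial_codomain (L : IsLiftSystem D D₁ π) : Nontrivial R₁ :=
  nontrivial_of_ne _ _ L.one_ne_zero

theorem map_augmented (π : R →+* R₁) (A : Matrix X Y R) :
    (augmented A).map π = augmented (A.map π) := by
  ext i (j | j)
  · simp [one_apply, apply_ite π]
  · rfl

variable [Fintype X]

theorem exists_update_inl_det_ne_zero (A : Matrix X Y R) {c : X → X ⊕ Y}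
    (h : ((augmented A).submatrix id c).det ≠ 0) (i : X) :
    ∃ k, ((augmented A).submatrix id (Function.update c i (.inl k))).det ≠ 0 := by
  contrapose! h
  set Z := (augmented A).submatrix id c
  have hcramer : ∀ k, cramer Z (Pi.single k 1) i = 0 := fun k => by
    rw [cramer_apply, ← h k, submatrix_update]
    congr 2
    ext a
    simp [one_apply, Pi.single_apply]
  calc Z.det = cramer Z (fun k => Z k i) i := by rw [cramer_apply, updateCol_eq_self]
    _ = ∑ k, Z k i * cramer Z (Pi.single k 1) i := by
      conv_lhs => rw [← Finset.univ_sum_single fun k => Z k i]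
      rw [map_sum, Finset.sum_apply]
      refine Finset.sum_congr rfl fun k _ => ?_
      rw [← smul_eq_mul, ← Pi.smul_apply, ← map_smul, ← Pi.single_smul, smul_eq_mul, mul_one]
    _ = 0 := Finset.sum_eq_zero fun k _ => by rw [hcramer, mul_zero]

theorem det_submatrix_update_ne_zero {E : Type*} {N : Matrix X E R} {c : X → E}
    (h : IsUnit (N.submatrix id c).det) {i : X} {e : E} :
    (N.submatrix id (Function.update c i e)).det ≠ 0 ↔ reduceAt N c i e ≠ 0 := by
  rw [det_submatrix_update h, Ne, h.mul_right_eq_zero]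

variable [DecidableEq Y]

theorem CrossSystem.PivotAdmissible.admissible_map_reduceAt [Nontrivial R₁] {A : Matrix X Y R}
    (hπ : D₁.PivotAdmissible (A.map π)) {c : X → X ⊕ Y}
    (h : IsUnit ((augmented A).submatrix id c).det) :
    D₁.Admissible ((reduceAt (augmented A) c).map π) := by
  rw [reduceAt_map π h, map_augmented]
  refine (hπ.admissibleAt ?_).admissible
  rw [← map_augmented, submatrix_map, ← RingHom.mapMatrix_apply, ← RingHom.map_det]
  exact (h.map π).ne_zero

/-- The hexagon condition for the exchange is read off from the other exchanges. -/
theorem IsLiftSystem.admissibleAt_update (L : IsLiftSystem D D₁ π) {A : Matrix X Y R}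
    (hπ : D₁.PivotAdmissible (A.map π)) {c : X → X ⊕ Y} {i₀ k₀ : X} {e : X ⊕ Y} {W : Set (X ⊕ Y)}
    (hc : D.AdmissibleAt (augmented A) c) (hk₀ : c i₀ = .inl k₀)
    (hdet : ((augmented A).submatrix id (Function.update c i₀ e)).det ≠ 0)
    (hW : ∀ u v, u ≠ v → u ≠ e → v ≠ e → u ∈ W ∨ v ∈ W)
    (h : ∀ i, ∀ w ∈ W, ((augmented A).submatrix id (Function.update c i w)).det ≠ 0 →
      D.Admissible (reduceAt (augmented A) (Function.update c i w))) :
    D.AdmissibleAt (augmented A) (Function.update c i₀ e) := by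
  have := L.nontrivial_domain
  have := L.nontrivial_codomain
  obtain ⟨⟨g, hg, hgdet⟩, hadm⟩ := hc
  have hunit : IsUnit ((augmented A).submatrix id c).det := ⟨g, hgdet⟩
  have hentry := (det_submatrix_update_ne_zero hunit).1 hdet
  obtain ⟨a, ha, ha'⟩ := exists_unit (hadm.mem i₀ e) hentry
  have hdet' : ((g * a : Rˣ) : R) =
      ((augmented A).submatrix id (Function.update c i₀ e)).det := by
    rw [det_submatrix_update hunit, ← hgdet, ← ha', Units.val_mul]
  have hform : ∀ {i w}, reduceAt (augmented A) c i w ≠ 0 →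
      reduceAt (augmented A) (Function.update c i w) = rowPivot (reduceAt (augmented A) c) i w :=
    fun hiw => reduceAt_update hunit (isUnit_of_mem_elems (hadm.mem _ _) hiw)
  have hcol : ∀ i, reduceAt (augmented A) c i (.inl k₀) = (1 : Matrix X X R) i i₀ := fun i => by
    rw [← reduceAt_submatrix_self hunit, submatrix_apply, hk₀, id]
  refine ⟨⟨g * a, D.units.mul_mem hg ha, hdet'⟩, ?_⟩
  rw [hform hentry]
  refine L.admissible_rowPivot hadm hentry ?_ ?_ (l₀ := .inl k₀) ?_ fun i hi => ?_
  · rw [← hform hentry]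
    exact hπ.admissible_map_reduceAt ⟨_, hdet'⟩
  · refine hexagon_of_admissible_rowPivot hadm hentry hW fun i w hw hiw => ?_
    rw [← hform hiw]
    exact h i w hw ((det_submatrix_update_ne_zero hunit).2 hiw)
  · rw [hcol, one_apply_eq]
    exact _root_.one_ne_zero
  · rw [hcol, one_apply_ne hi]

end

section TwoColLift

variable {R R₁ : Type*} [CommRing R] [CommRing R₁] {X Y : Type*} [DecidableEq X] [DecidableEq Y]
  {D : CrossSystem R} {D₁ : CrossSystem R₁} {π : R →+* R₁}

theorem map_pivot {B : Matrix X Y R} {k : X} {l : Y} (h : B k l ∈ D.elems) :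
    (pivot B k l).map π = pivot (B.map π) k l := by
  ext i j
  simp only [map_apply, pivot, ← map_inverse π h]
  split_ifs <;> simp

/-- `B` lifts a pivot-admissible matrix along `π`, and deleting either of the columns `x` and `y`
makes it pivot-admissible: the situation of a minimal matrix that is not pivot-admissible. -/
structure TwoColLift (D : CrossSystem R) (D₁ : CrossSystem R₁) (π : R →+* R₁) (x y : Y)
    (B : Matrix X Y R) : Prop where
  ne : x ≠ y
  left : D.PivotAdmissible (dropCol B x)
  right : D.PivotAdmissible (dropCol B y)
  map : D₁.PivotAdmissible (B.map π)

namespace TwoColLift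

variable {x y : Y} {B : Matrix X Y R}

theorem symm (h : TwoColLift D D₁ π x y B) : TwoColLift D D₁ π y x B :=
  ⟨h.ne.symm, h.right, h.left, h.map⟩

theorem mem (h : TwoColLift D D₁ π x y B) (i : X) (j : Y) : B i j ∈ D.elems := by
  by_cases hj : j = x
  · subst hj; rw [← dropCol_of_ne B h.ne i]; exact h.right.mem _ _
  · rw [← dropCol_of_ne B hj i]; exact h.left.mem _ _

theorem cross (h : TwoColLift D D₁ π x y B) {i j : X} {u v : Y} (hu : u ≠ x) (hv : v ≠ x)
    (hiv : B i v ≠ 0) (hju : B j u ≠ 0) : D.Cross B i j u v := by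
  have := h.left.admissible.cross (i := i) (j := j) (u := u) (v := v)
    (by rwa [dropCol_of_ne _ hv]) (by rwa [dropCol_of_ne _ hu])
  simpa only [CrossSystem.Cross, dropCol_of_ne _ hv, dropCol_of_ne _ hu] using this

theorem pivot (L : IsLiftSystem D D₁ π) (h : TwoColLift D D₁ π x y B) {k : X} {l : Y}
    (hlx : l ≠ x) (hly : l ≠ y) (hkl : B k l ≠ 0) : TwoColLift D D₁ π x y (pivot B k l) := by
  refine ⟨h.ne, ?_, ?_, ?_⟩
  · rw [← pivot_dropCol _ hlx]
    exact h.left.pivot (by rwa [dropCol_of_ne _ hlx])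
  · rw [← pivot_dropCol _ hly]
    exact h.right.pivot (by rwa [dropCol_of_ne _ hly])
  · rw [map_pivot (h.mem k l)]
    exact h.map.pivot (L.map_ne_zero (h.mem k l) hkl)

theorem admissible (h : TwoColLift D D₁ π x y B)
    (hxy : ∀ i j, B i y ≠ 0 → B j x ≠ 0 → D.Cross B i j x y) : D.Admissible B := by
  refine ⟨h.mem, fun {i j u v} hiv hju => ?_⟩
  by_cases hu : u = x
  · subst hu
    by_cases hv : v = y
    · subst hv; exact hxy i j hiv hju
    · exact h.symm.cross h.ne hv hiv hju
  · by_cases hv : v = x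
    · subst hv
      by_cases huy : u = y
      · subst huy; exact (hxy j i hju hiv).symm
      · exact h.symm.cross huy h.ne hiv hju
    · exact h.cross hu hv hiv hju

end TwoColLift

theorem card_update_update_lt {X E : Type*} [Fintype X] [DecidableEq X] [DecidableEq E]
    {F : Finset E} {c : X → E} {i₀ : X} (hi₀ : c i₀ ∈ F) {e w : E} (he : e ∉ F) (hw : w ∉ F)
    (i : X) : (Finset.univ.filter fun j =>
        Function.update (Function.update c i₀ e) i w j ∈ F).card <
      (Finset.univ.filter fun j => c j ∈ F).card := by
  refine Finset.card_lt_card ⟨fun j hj => ?_, fun hsub => ?_⟩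
  · rw [Finset.mem_filter_univ] at hj ⊢
    by_cases hji : j = i
    · subst hji; exact absurd hj (by simpa using hw)
    · rw [Function.update_of_ne hji] at hj
      by_cases hj₀ : j = i₀
      · subst hj₀; exact hi₀
      · rwa [Function.update_of_ne hj₀] at hj
  · have := hsub (x := i₀) (by simpa using hi₀)
    rw [Finset.mem_filter_univ] at this
    by_cases hi : i₀ = i
    · subst hi; exact hw (by simpa using this)
    · exact he (by simpa [Function.update_of_ne hi] using this)

theorem IsLiftSystem.admissibleAt_of_twoColLift [Fintype X] (L : IsLiftSystem D D₁ π)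
    {A : Matrix X Y R} {x y : Y} {S : Set (Matrix X Y R)} (hS : ∀ B ∈ S, TwoColLift D D₁ π x y B)
    (hA : A ∈ S) (hpivot : ∀ B ∈ S, ∀ k l, l ≠ x → l ≠ y → B k l ≠ 0 → pivot B k l ∈ S)
    (hcross : ∀ B ∈ S, ∀ i j, B i y ≠ 0 → B j x ≠ 0 → D.Cross B i j x y) {c : X → X ⊕ Y}
    (hdet : ((augmented A).submatrix id c).det ≠ 0) : D.AdmissibleAt (augmented A) c := by
  obtain ⟨F, hF⟩ : ∃ F : Finset (X ⊕ Y), F = {.inr x, .inr y} := ⟨_, rfl⟩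
  induction hn : (Finset.univ.filter fun i => c i ∈ F).card using Nat.strong_induction_on
    generalizing c with
  | _ n ih =>
  by_cases hc : ∃ i, c i ∈ F
  · obtain ⟨i₀, hi₀⟩ := hc
    obtain ⟨k₀, hk₀⟩ := exists_update_inl_det_ne_zero A hdet i₀
    set c' := Function.update c i₀ (.inl k₀) with hc'
    have hadm : ∀ i w, w ∉ F → ((augmented A).submatrix id (Function.update c' i w)).det ≠ 0 →
        D.AdmissibleAt (augmented A) (Function.update c' i w) := fun i w hw hd =>
      ih _ (hn ▸ card_update_update_lt hi₀ (by simp [hF]) hw i) hd rfl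
    have hadm' := hadm i₀ (.inl k₀) (by simp [hF]) (by simpa [hc'] using hk₀)
    have hback : Function.update c' i₀ (c i₀) = c := by simp [hc']
    rw [hc', Function.update_idem, ← hc'] at hadm'
    rw [← hback]
    refine L.admissibleAt_update (hS A hA).map hadm' (Function.update_self ..) (by rwa [hback])
      (W := {w | w ∉ F}) (fun u v huv hu hv => ?_) fun i w hw hd => (hadm i w hw hd).admissible
    rw [hF, Finset.mem_insert, Finset.mem_singleton] at hi₀
    simp only [hF, Set.mem_ofPred_eq, Finset.mem_insert, Finset.mem_singleton]
    rcases hi₀ with h | h <;> grind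
  · push Not at hc
    exact admissibleAt_of_invariant (W := {l | l ≠ x ∧ l ≠ y})
      (fun B hB => (hS B hB).admissible (hcross B hB))
      (fun B hB k l hl => hpivot B hB k l hl.1 hl.2) hA
      (fun i l hl => by simpa [hF, hl] using hc i) hdet

theorem IsLiftSystem.pivotAdmissible_of_twoColLift [Finite X] (L : IsLiftSystem D D₁ π)
    {A : Matrix X Y R} {x y : Y} (h : TwoColLift D D₁ π x y A) {S : Set (Matrix X Y R)} (hA : A ∈ S)
    (hpivot : ∀ B ∈ S, TwoColLift D D₁ π x y B →
      ∀ k l, l ≠ x → l ≠ y → B k l ≠ 0 → pivot B k l ∈ S)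
    (hcross : ∀ B ∈ S, TwoColLift D D₁ π x y B →
      ∀ i j, B i y ≠ 0 → B j x ≠ 0 → D.Cross B i j x y) : D.PivotAdmissible A :=
  have := Fintype.ofFinite X
  have := L.nontrivial_domain
  pivotAdmissible_of_admissibleAt fun _ hdet =>
    L.admissibleAt_of_twoColLift (S := {B | B ∈ S ∧ TwoColLift D D₁ π x y B}) (fun _ hB => hB.2)
      ⟨hA, h⟩ (fun B hB k l hlx hly hkl =>
        ⟨hpivot B hB.1 hB.2 k l hlx hly hkl, hB.2.pivot L hlx hly hkl⟩)
      (fun B hB => hcross B hB.1 hB.2) hdet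

end TwoColLift

/-! ### Paths between rows -/

theorem pivot_ne_zero_of_eq_zero {R X Y : Type*} [CommRing R] [DecidableEq X] [DecidableEq Y]
    {D : CrossSystem R} {A : Matrix X Y R} (hA : ∀ i j, A i j ∈ D.elems) {i k : X} {j l : Y}
    (hij : A i j = 0) (hil : A i l ≠ 0) (hkl : A k l ≠ 0) (hkj : A k j ≠ 0) :
    pivot A k l i j ≠ 0 := by
  have hik : i ≠ k := by rintro rfl; exact hkj hij
  have hjl : j ≠ l := by rintro rfl; exact hil hij
  rw [pivot_other _ hik hjl, hij, zero_sub, neg_ne_zero, mul_assoc]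
  exact mul_ne_zero_of_mem_elems (hA _ _) hil
    (mul_ne_zero_of_mem_elems (inverse_mem_elems (hA _ _)) (inverse_ne_zero (hA _ _) hkl) hkj)

section Linked

variable {R : Type*} [CommRing R] {X Y : Type*}

/-- `U` and `V` split the matrix `A`, restricted to the columns in `W`, into two blocks. -/
def Splits (W : Set Y) (A : Matrix X Y R) (U : Set X) (V : Set Y) : Prop :=
  ∀ a, ∀ l ∈ W, A a l ≠ 0 → (a ∈ U ↔ l ∈ V)

/-- Rows `i` and `j` are in the same block of every splitting of `A`, restricted to the columns in
`W`: they are in the same component of its bipartite graph. -/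
def Linked (W : Set Y) (A : Matrix X Y R) (i j : X) : Prop :=
  ∀ U V, Splits W A U V → i ∈ U → j ∈ U

/-- The graph on the rows of `A` in which two rows are adjacent if they have nonzero entries in a
common column from `W`. -/
def rowGraph (W : Set Y) (A : Matrix X Y R) : SimpleGraph X :=
  SimpleGraph.fromRel fun a b => ∃ l ∈ W, A a l ≠ 0 ∧ A b l ≠ 0

variable {W : Set Y} {A : Matrix X Y R} {i j k : X}

theorem rowGraph_adj : (rowGraph W A).Adj i j ↔ i ≠ j ∧ ∃ l ∈ W, A i l ≠ 0 ∧ A j l ≠ 0 := by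
  simp only [rowGraph, SimpleGraph.fromRel_adj, and_comm (a := A j _ ≠ 0), or_self]

theorem exists_walk_of_common_col {l : Y} (hl : l ∈ W) (hi : A i l ≠ 0) (hj : A j l ≠ 0) :
    ∃ p : (rowGraph W A).Walk i j, p.length ≤ 1 := by
  by_cases h : i = j
  · subst h; exact ⟨.nil, by simp⟩
  · exact ⟨(rowGraph_adj.2 ⟨h, l, hl, hi, hj⟩).toWalk, le_rfl⟩

theorem Linked.symm (h : Linked W A i j) : Linked W A j i := by
  intro U V hUV hj
  by_contra hi
  exact h Uᶜ Vᶜ (fun a l hl hal => not_congr (hUV a l hl hal)) hi hj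

theorem Linked.trans (h : Linked W A i j) (h' : Linked W A j k) : Linked W A i k :=
  fun U V hUV hi => h' U V hUV (h U V hUV hi)

theorem linked_of_common_col {l : Y} (hl : l ∈ W) (hi : A i l ≠ 0) (hj : A j l ≠ 0) :
    Linked W A i j :=
  fun _ _ hUV h => (hUV _ l hl hj).2 ((hUV _ l hl hi).1 h)

theorem Linked.reachable (h : Linked W A i j) : (rowGraph W A).Reachable i j := by
  refine h {a | (rowGraph W A).Reachable i a}
    {l | ∃ a, (rowGraph W A).Reachable i a ∧ A a l ≠ 0}
    (fun a l hl hal => ⟨fun h => ⟨a, h, hal⟩, ?_⟩) (SimpleGraph.Reachable.refl i)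
  rintro ⟨b, hb, hbl⟩
  exact hb.trans (exists_walk_of_common_col hl hbl hal).nonempty

theorem exists_walk_of_rows_eq {B : Matrix X Y R} (q : (rowGraph W A).Walk i j)
    (h : ∀ v ∈ q.support, B v = A v) :
    ∃ q' : (rowGraph W B).Walk i j, q'.length = q.length := by
  refine ⟨q.transfer _ ?_, q.length_transfer _⟩
  rintro ⟨a, b⟩ he
  have hab := rowGraph_adj.1 (q.adj_of_mem_edges he)
  rw [← h a (q.fst_mem_support_of_mem_edges he), ← h b (q.snd_mem_support_of_mem_edges he)] at hab
  exact rowGraph_adj.2 hab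

variable [DecidableEq X] [DecidableEq Y]

theorem Splits.pivot {l : Y} (hl : l ∈ W) (hkl : A k l ≠ 0) {U : Set X} {V : Set Y}
    (h : Splits W A U V) : Splits W (pivot A k l) U V := by
  have hs := h k l hl hkl
  intro a m hm ham
  by_cases hak : a = k
  · subst hak
    by_cases hml : m = l
    · subst hml; exact hs
    · rw [pivot_row _ _ hml] at ham
      exact h a m hm (right_ne_zero_of_mul ham)
  · by_cases hml : m = l
    · subst hml
      rw [pivot_col _ _ hak, neg_ne_zero] at ham
      exact h a m hm (left_ne_zero_of_mul ham)
    · by_cases h0 : A a m = 0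
      · rw [pivot_other _ hak hml, h0, zero_sub, neg_ne_zero] at ham
        rw [h a l hl (left_ne_zero_of_mul (left_ne_zero_of_mul ham)), ← hs,
          h k m hm (right_ne_zero_of_mul ham)]
      · exact h a m hm h0

theorem Linked.pivot [Nontrivial R] {l : Y} (hl : l ∈ W) (hkl : IsUnit (A k l))
    (h : Linked W A i j) : Linked W (pivot A k l) i j := by
  intro U V hUV
  refine h U V ?_
  rw [← pivot_pivot A hkl]
  refine hUV.pivot hl ?_
  rw [pivot_same]
  exact hkl.ringInverse.ne_zero

variable {D : CrossSystem R}

/-- Pivoting in the second step of a walk without chords makes the first inner row adjacent to the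
third one. -/
theorem exists_walk_pivot (hA : ∀ k l, A k l ∈ D.elems) {k₁ k₂ k₃ : X} {l₁ l₂ l₃ : Y}
    (hl₁ : l₁ ∈ W) (hl₃ : l₃ ∈ W) (hi₁ : A i l₁ ≠ 0) (hk₁₁ : A k₁ l₁ ≠ 0) (hk₁₂ : A k₁ l₂ ≠ 0)
    (hk₂₂ : A k₂ l₂ ≠ 0) (hk₂₃ : A k₂ l₃ ≠ 0) (hk₃₃ : A k₃ l₃ ≠ 0) (hi₂ : A i l₂ = 0)
    (hk₂₁ : A k₂ l₁ = 0) (hk₁₃ : A k₁ l₃ = 0) (q : (rowGraph W A).Walk k₃ j)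
    (hq : ∀ v ∈ q.support, A v l₂ = 0) :
    ∃ p : (rowGraph W (pivot A k₂ l₂)).Walk i j, p.length ≤ q.length + 2 := by
  have hrow : ∀ v, A v l₂ = 0 → pivot A k₂ l₂ v = A v := fun v hv =>
    funext (pivot_row_of_zero _ (by rintro rfl; exact hk₂₂ hv) hv)
  have hl : l₁ ≠ l₂ := by rintro rfl; exact hi₁ hi₂
  obtain ⟨p₁, hp₁⟩ := exists_walk_of_common_col (A := pivot A k₂ l₂) (i := i) (j := k₁) hl₁
    (by rwa [hrow i hi₂]) (by rwa [pivot_col_of_zero _ hl hk₂₁])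
  obtain ⟨p₂, hp₂⟩ := exists_walk_of_common_col (A := pivot A k₂ l₂) (j := k₃) hl₃
    (pivot_ne_zero_of_eq_zero hA hk₁₃ hk₁₂ hk₂₂ hk₂₃)
    (by rwa [hrow k₃ (hq k₃ q.start_mem_support)])
  obtain ⟨q', hq'⟩ := exists_walk_of_rows_eq (B := pivot A k₂ l₂) q fun v hv => hrow v (hq v hv)
  refine ⟨p₁.append (p₂.append q'), ?_⟩
  simp only [SimpleGraph.Walk.length_append, hq']
  omega

theorem exists_pivot_dist_lt (hA : ∀ k l, A k l ∈ D.elems) (hij : (rowGraph W A).Reachable i j)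
    (h : 2 < (rowGraph W A).dist i j) :
    ∃ k, ∃ l ∈ W, A k l ≠ 0 ∧ A i l = 0 ∧ A j l = 0 ∧
      (rowGraph W (pivot A k l)).Reachable i j ∧
      (rowGraph W (pivot A k l)).dist i j < (rowGraph W A).dist i j := by
  obtain ⟨p, hp⟩ := hij.exists_walk_length_eq_dist
  have hmin : ∀ p' : (rowGraph W A).Walk i j, p.length ≤ p'.length := fun p' =>
    hp ▸ SimpleGraph.dist_le p'
  rw [← hp] at h ⊢
  rcases p with _ | @⟨_, k₁, _, h₁, _ | @⟨_, k₂, _, h₂, _ | @⟨_, k₃, _, h₃, q⟩⟩⟩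
  iterate 3 simp at h
  obtain ⟨-, l₁, hl₁, hi₁, hk₁₁⟩ := rowGraph_adj.1 h₁
  obtain ⟨-, l₂, hl₂, hk₁₂, hk₂₂⟩ := rowGraph_adj.1 h₂
  obtain ⟨-, l₃, hl₃, hk₂₃, hk₃₃⟩ := rowGraph_adj.1 h₃
  simp only [SimpleGraph.Walk.length_cons] at hmin ⊢
  have hno_skip : ∀ l ∈ W, A i l ≠ 0 → A k₂ l = 0 := by
    intro l hl hi
    by_contra hk
    obtain ⟨p', hp'⟩ := exists_walk_of_common_col hl hi hk
    have := hmin (p'.append (.cons h₃ q))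
    simp only [SimpleGraph.Walk.length_append, SimpleGraph.Walk.length_cons] at this
    omega
  have hno_chord : ∀ v ∈ q.support, ∀ l ∈ W, A k₁ l ≠ 0 → A v l = 0 := by
    intro v hv l hl hk
    by_contra hvl
    obtain ⟨p', hp'⟩ := exists_walk_of_common_col hl hk hvl
    have := hmin (.cons h₁ (p'.append (q.dropUntil v hv)))
    have := q.length_dropUntil_le_length hv
    simp only [SimpleGraph.Walk.length_append, SimpleGraph.Walk.length_cons] at *
    omega
  have hi₂ : A i l₂ = 0 := not_imp_comm.1 (hno_skip l₂ hl₂) hk₂₂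
  have hk₁₃ : A k₁ l₃ = 0 := not_imp_comm.1 (hno_chord k₃ q.start_mem_support l₃ hl₃) hk₃₃
  have hq₂ : ∀ v ∈ q.support, A v l₂ = 0 := fun v hv => hno_chord v hv l₂ hl₂ hk₁₂
  obtain ⟨p', hp'⟩ := exists_walk_pivot hA hl₁ hl₃ hi₁ hk₁₁ hk₁₂ hk₂₂ hk₂₃ hk₃₃ hi₂
    (hno_skip l₁ hl₁ hi₁) hk₁₃ q hq₂
  exact ⟨k₂, l₂, hl₂, hk₂₂, hi₂, hq₂ j q.end_mem_support, p'.reachable,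
    ((SimpleGraph.dist_le p').trans hp').trans_lt (by omega)⟩

theorem linked_induction {S Q : Matrix X Y R → Prop} (hmem : ∀ A, S A → ∀ k l, A k l ∈ D.elems)
    (hpivot : ∀ A k l, S A → l ∈ W → A k l ≠ 0 → A i l = 0 → A j l = 0 →
      S (pivot A k l) ∧ (Q (pivot A k l) → Q A))
    (heq : ∀ A, i = j → Q A)
    (hcommon : ∀ A, S A → ∀ l ∈ W, A i l ≠ 0 → A j l ≠ 0 → Q A)
    (hmiddle : ∀ A, S A → ∀ k, ∀ l₁ ∈ W, ∀ l₂ ∈ W, A i l₁ ≠ 0 → A k l₁ ≠ 0 → A k l₂ ≠ 0 →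
      A j l₂ ≠ 0 → A i l₂ = 0 → A j l₁ = 0 → Q A)
    (hA : S A) (hij : Linked W A i j) : Q A := by
  replace hij := hij.reachable
  induction hn : (rowGraph W A).dist i j using Nat.strong_induction_on generalizing A with
  | _ n ih =>
  subst hn
  obtain ⟨p, hp⟩ := hij.exists_walk_length_eq_dist
  by_cases hlong : 2 < (rowGraph W A).dist i j
  · obtain ⟨k, l, hl, hkl, hil, hjl, hij', hlt⟩ := exists_pivot_dist_lt (hmem A hA) hij hlong
    obtain ⟨hS, hQ⟩ := hpivot A k l hA hl hkl hil hjl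
    exact hQ (ih _ hlt hS hij' rfl)
  rw [← hp] at hlong
  rcases p with _ | @⟨_, k, _, h₁, _ | ⟨h₂, _ | _⟩⟩
  · exact heq A rfl
  · obtain ⟨-, l, hl, hil, hjl⟩ := rowGraph_adj.1 h₁
    exact hcommon A hA l hl hil hjl
  · obtain ⟨-, l₁, hl₁, hil₁, hkl₁⟩ := rowGraph_adj.1 h₁
    obtain ⟨-, l₂, hl₂, hkl₂, hjl₂⟩ := rowGraph_adj.1 h₂
    by_cases hil₂ : A i l₂ = 0
    · by_cases hjl₁ : A j l₁ = 0
      · exact hmiddle A hA k l₁ hl₁ l₂ hl₂ hil₁ hkl₁ hkl₂ hjl₂ hil₂ hjl₁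
      · exact hcommon A hA l₁ hl₁ hil₁ hjl₁
    · exact hcommon A hA l₂ hl₂ hil₂ hjl₂
  · simp only [SimpleGraph.Walk.length_cons] at hlong
    omega

end Linked

section

variable {R R₁ : Type*} [CommRing R] [CommRing R₁] {X Y : Type*} [DecidableEq X] [DecidableEq Y]
  {D : CrossSystem R} {D₁ : CrossSystem R₁} {π : R →+* R₁} {x y : Y} {B B' : Matrix X Y R}
  {i j k : X} {l l₁ l₂ : Y}

namespace TwoColLift

theorem cross_of_common (L : IsLiftSystem D D₁ π) (h : TwoColLift D D₁ π x y B) (hlx : l ≠ x)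
    (hly : l ≠ y) (hil : B i l ≠ 0) (hjl : B j l ≠ 0) (hiy : B i y ≠ 0) (hjx : B j x ≠ 0) :
    D.Cross B i j x y :=
  L.cross_trans_col h.mem h.map.admissible hil hjl hiy hjx
    (h.symm.cross h.ne hly hil hjx) (h.cross hlx h.ne.symm hiy hjl)

/-- After pivoting in `(k, l₁)` the rows `i` and `j` share the column `l₂`, and the entry in row `i`
and column `x` has been multiplied by `1 - p`, where `p` is an allowed cross ratio of `B`. -/
theorem cross_of_middle_of_ne (L : IsLiftSystem D D₁ π) (h : TwoColLift D D₁ π x y B)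
    (hl₁x : l₁ ≠ x) (hl₁y : l₁ ≠ y) (hl₂x : l₂ ≠ x) (hl₂y : l₂ ≠ y) (hil₁ : B i l₁ ≠ 0)
    (hkl₁ : B k l₁ ≠ 0) (hkl₂ : B k l₂ ≠ 0) (hjl₂ : B j l₂ ≠ 0) (hil₂ : B i l₂ = 0)
    (hjl₁ : B j l₁ = 0) (hky : B k y = 0) (hix : B i x ≠ 0) (hiy : B i y ≠ 0) (hjx : B j x ≠ 0)
    (hne : B i x * B k l₁ ≠ B i l₁ * B k x) : D.Cross B i j x y := by
  have hik : i ≠ k := by rintro rfl; exact hkl₂ hil₂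
  have hjk : j ≠ k := by rintro rfl; exact hkl₁ hjl₁
  have hrow_j : ∀ m, MatrixLift.pivot B k l₁ j m = B j m := pivot_row_of_zero _ hjk hjl₁
  have hcol_y : MatrixLift.pivot B k l₁ i y = B i y := pivot_col_of_zero _ hl₁y.symm hky i
  obtain ⟨t, ht, htB⟩ := (h.pivot L hl₁x hl₁y hkl₁).cross_of_common L (i := i) (j := j) hl₂x hl₂y
    (pivot_ne_zero_of_eq_zero h.mem hil₂ hil₁ hkl₁ hkl₂) (by rwa [hrow_j]) (by rwa [hcol_y])
    (by rwa [hrow_j])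
  obtain ⟨p, hp, hpB⟩ := h.symm.cross (i := i) (j := k) (u := l₁) (v := x) hl₁y h.ne hix hkl₁
  have hpivot : MatrixLift.pivot B k l₁ i x = (1 - p) * B i x := by
    rw [pivot_other _ hik hl₁x.symm]
    linear_combination -Ring.inverse (B k l₁) * hpB - p * B i x * mul_inverse (h.mem k l₁) hkl₁
  have hp₁ := L.one_sub_mem_ratios p hp
  have hp₀ : 1 - p ≠ 0 := fun h₀ => hne (by linear_combination (B i x * B k l₁) * h₀ - hpB)
  refine L.cross_of_eq_mul h.mem h.map.admissible hiy hjx ht (L.inverse_mem_ratios _ hp₁ hp₀) ?_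
  rw [hrow_j, hrow_j, hcol_y, hpivot] at htB
  linear_combination Ring.inverse (1 - p) * htB -
    B i x * B j y * mul_inverse (L.ratios_subset hp₁) hp₀

theorem cross_of_middle_of_eq (L : IsLiftSystem D D₁ π) (h : TwoColLift D D₁ π x y B)
    (hl₁x : l₁ ≠ x) (hl₁y : l₁ ≠ y) (hl₂x : l₂ ≠ x) (hil₁ : B i l₁ ≠ 0) (hkl₁ : B k l₁ ≠ 0)
    (hkl₂ : B k l₂ ≠ 0) (hjl₂ : B j l₂ ≠ 0) (hil₂ : B i l₂ = 0) (hjl₁ : B j l₁ = 0)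
    (hky : B k y = 0) (hiy : B i y ≠ 0) (hjx : B j x ≠ 0)
    (hi : B i x * B k l₁ = B i l₁ * B k x) (hj : B j x * B k l₂ = B j l₂ * B k x) :
    D.Cross B i j x y := by
  have hik : i ≠ k := by rintro rfl; exact hkl₂ hil₂
  have hjk : j ≠ k := by rintro rfl; exact hkl₁ hjl₁
  have hl : l₂ ≠ l₁ := by rintro rfl; exact hil₁ hil₂
  have hrow_j : ∀ m, MatrixLift.pivot B k l₁ j m = B j m := pivot_row_of_zero _ hjk hjl₁
  have hcol_y : MatrixLift.pivot B k l₁ i y = B i y := pivot_col_of_zero _ hl₁y.symm hky i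
  obtain ⟨t, ht, htB⟩ := (h.pivot L hl₁x hl₁y hkl₁).cross (i := i) (j := j) (u := l₂) (v := y)
    hl₂x h.ne.symm (by rwa [hcol_y]) (by rwa [hrow_j])
  rw [pivot_other _ hik hl, hil₂, zero_sub, hrow_j, hrow_j, hcol_y] at htB
  refine L.cross_of_eq_neg h.mem h.map.admissible hiy hjx ht ?_
  apply (isUnit_of_mem_elems (h.mem k l₂) hkl₂).mul_left_cancel
  linear_combination (-B i x * B j y * B k l₂) * mul_inverse (h.mem k l₁) hkl₁ +
    B j y * B k l₂ * Ring.inverse (B k l₁) * hi - B k x * htB + t * B i y * hj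

theorem cross_of_middle (L : IsLiftSystem D D₁ π) (h : TwoColLift D D₁ π x y B) (hl₁x : l₁ ≠ x)
    (hl₁y : l₁ ≠ y) (hl₂x : l₂ ≠ x) (hl₂y : l₂ ≠ y) (hil₁ : B i l₁ ≠ 0) (hkl₁ : B k l₁ ≠ 0)
    (hkl₂ : B k l₂ ≠ 0) (hjl₂ : B j l₂ ≠ 0) (hil₂ : B i l₂ = 0) (hjl₁ : B j l₁ = 0)
    (hky : B k y = 0) (hix : B i x ≠ 0) (hiy : B i y ≠ 0) (hjx : B j x ≠ 0) (hjy : B j y ≠ 0) :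
    D.Cross B i j x y := by
  by_cases hi : B i x * B k l₁ = B i l₁ * B k x
  · by_cases hj : B j x * B k l₂ = B j l₂ * B k x
    · exact h.cross_of_middle_of_eq L hl₁x hl₁y hl₂x hil₁ hkl₁ hkl₂ hjl₂ hil₂ hjl₁ hky hiy hjx
        hi hj
    · exact L.cross_swap h.mem hjx hiy (h.cross_of_middle_of_ne L hl₂x hl₂y hl₁x hl₁y hjl₂ hkl₂
        hkl₁ hil₁ hjl₁ hil₂ hky hjx hjy hix hj)
  · exact h.cross_of_middle_of_ne L hl₁x hl₁y hl₂x hl₂y hil₁ hkl₁ hkl₂ hjl₂ hil₂ hjl₁ hky hix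
      hiy hjx hi

theorem cross_of_linked (L : IsLiftSystem D D₁ π) (h : TwoColLift D D₁ π x y B) (hix : B i x ≠ 0)
    (hiy : B i y ≠ 0) (hjx : B j x ≠ 0) (hjy : B j y ≠ 0)
    (hij : Linked {l | l ≠ x ∧ l ≠ y} B i j) : D.Cross B i j x y := by
  refine linked_induction (D := D) (S := TwoColLift D D₁ π x y)
    (Q := fun B => B i x ≠ 0 → B i y ≠ 0 → B j x ≠ 0 → B j y ≠ 0 → D.Cross B i j x y)
    (fun _ hB => hB.mem) ?pivot ?eq ?common ?middle h hij hix hiy hjx hjy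
  case pivot =>
    rintro B k l hB ⟨hlx, hly⟩ hkl hil hjl
    have hrow_i : ∀ m, MatrixLift.pivot B k l i m = B i m :=
      pivot_row_of_zero _ (by rintro rfl; exact hkl hil) hil
    have hrow_j : ∀ m, MatrixLift.pivot B k l j m = B j m :=
      pivot_row_of_zero _ (by rintro rfl; exact hkl hjl) hjl
    exact ⟨hB.pivot L hlx hly hkl, by simp only [CrossSystem.Cross, hrow_i, hrow_j, imp_self]⟩
  case eq =>
    rintro B rfl - - - -
    exact cross_same_row B i x y
  case common =>
    rintro B hB l ⟨hlx, hly⟩ hil hjl - hiy hjx -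
    exact hB.cross_of_common L hlx hly hil hjl hiy hjx
  case middle =>
    rintro B hB k l₁ ⟨hl₁x, hl₁y⟩ l₂ ⟨hl₂x, hl₂y⟩ hil₁ hkl₁ hkl₂ hjl₂ hil₂ hjl₁ hix hiy hjx hjy
    by_cases hky : B k y = 0
    · exact hB.cross_of_middle L hl₁x hl₁y hl₂x hl₂y hil₁ hkl₁ hkl₂ hjl₂ hil₂ hjl₁ hky
        hix hiy hjx hjy
    by_cases hkx : B k x = 0
    · exact L.cross_swap hB.mem hjx hiy (hB.symm.cross_of_middle L hl₁y hl₁x hl₂y hl₂x hil₁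
        hkl₁ hkl₂ hjl₂ hil₂ hjl₁ hkx hiy hix hjy hjx).symm
    · exact L.cross_trans_row hB.mem hB.map.admissible hkx hky hiy hjx
        (hB.cross_of_common L hl₁x hl₁y hil₁ hkl₁ hiy hkx)
        (hB.cross_of_common L hl₂x hl₂y hkl₂ hjl₂ hky hjx)

end TwoColLift

/-- `B` and `B'` are pivot-admissible matrices with the same image that differ only in column `y`:
two lifts to be compared when column `y` is added to a matrix with a unique lift. -/
structure SameOff (D : CrossSystem R) (π : R →+* R₁) (y : Y) (B B' : Matrix X Y R) : Prop where
  left : D.PivotAdmissible B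
  right : D.PivotAdmissible B'
  map : B.map π = B'.map π
  eq : ∀ i j, j ≠ y → B i j = B' i j

namespace SameOff

theorem pivot (h : SameOff D π y B B') (hl : l ≠ y) (hkl : B k l ≠ 0) :
    SameOff D π y (pivot B k l) (pivot B' k l) := by
  refine ⟨h.left.pivot hkl, h.right.pivot (by rwa [← h.eq k l hl]), ?_, fun i j hj => ?_⟩
  · rw [map_pivot (h.left.mem _ _), map_pivot (h.right.mem _ _), h.map]
  · simp only [MatrixLift.pivot, h.eq _ _ hl, h.eq _ _ hj]

theorem map_eq (h : SameOff D π y B B') (i : X) (j : Y) : π (B i j) = π (B' i j) :=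
  congrFun (congrFun h.map i) j

theorem eq_zero_iff (L : IsLiftSystem D D₁ π) (h : SameOff D π y B B') (i : X) (j : Y) :
    B' i j = 0 ↔ B i j = 0 := by
  rw [← L.map_eq_zero (h.right.mem i j), ← h.map_eq, L.map_eq_zero (h.left.mem i j)]

theorem ratio_of_common (L : IsLiftSystem D D₁ π) (h : SameOff D π y B B') (hl : l ≠ y)
    (hil : B i l ≠ 0) (hjl : B j l ≠ 0) (hiy : B i y ≠ 0) :
    B' i y * B j y = B' j y * B i y := by
  obtain ⟨t, ht, htB⟩ := h.left.admissible.cross (i := i) (j := j) (u := l) (v := y) hiy hjl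
  obtain ⟨s, hs, hsB⟩ := h.right.admissible.cross (i := i) (j := j) (u := l) (v := y)
    (by rwa [Ne, h.eq_zero_iff L]) (by rwa [← h.eq _ _ hl])
  have hts : t = s := by
    apply L.injOn ht hs
    have htπ := congrArg π htB
    have hsπ := congrArg π hsB
    simp only [map_mul, ← h.map_eq] at htπ hsπ
    apply ((isUnit_of_mem_elems (h.left.mem i y) hiy).map π).mul_left_cancel
    apply ((isUnit_of_mem_elems (h.left.mem j l) hjl).map π).mul_left_cancel
    linear_combination hsπ - htπ
  rw [← h.eq _ _ hl, ← h.eq _ _ hl, ← hts] at hsB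
  apply (isUnit_of_mem_elems (h.left.mem i l) hil).mul_left_cancel
  linear_combination B' i y * htB - B i y * hsB

theorem ratio_of_middle (L : IsLiftSystem D D₁ π) (h : SameOff D π y B B') (hl₁ : l₁ ≠ y)
    (hl₂ : l₂ ≠ y) (hil₁ : B i l₁ ≠ 0) (hkl₁ : B k l₁ ≠ 0) (hkl₂ : B k l₂ ≠ 0) (hjl₂ : B j l₂ ≠ 0)
    (hil₂ : B i l₂ = 0) (hjl₁ : B j l₁ = 0) (hky : B k y = 0) (hiy : B i y ≠ 0) :
    B' i y * B j y = B' j y * B i y := by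
  have hky' : B' k y = 0 := (h.eq_zero_iff L k y).2 hky
  have hjk : j ≠ k := by rintro rfl; exact hkl₁ hjl₁
  have hrow_j : ∀ m, MatrixLift.pivot B k l₁ j m = B j m := pivot_row_of_zero _ hjk hjl₁
  have hrow_j' : ∀ m, MatrixLift.pivot B' k l₁ j m = B' j m :=
    pivot_row_of_zero _ hjk (by rwa [← h.eq _ _ hl₁])
  have hcol_y : MatrixLift.pivot B k l₁ i y = B i y := pivot_col_of_zero _ hl₁.symm hky i
  have hcol_y' : MatrixLift.pivot B' k l₁ i y = B' i y := pivot_col_of_zero _ hl₁.symm hky' i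
  have := (h.pivot hl₁ hkl₁).ratio_of_common L (i := i) (j := j) hl₂
    (pivot_ne_zero_of_eq_zero h.left.mem hil₂ hil₁ hkl₁ hkl₂) (by rwa [hrow_j]) (by rwa [hcol_y])
  rwa [hcol_y, hcol_y', hrow_j, hrow_j'] at this

theorem ratio_of_linked (L : IsLiftSystem D D₁ π) (h : SameOff D π y B B') (hiy : B i y ≠ 0)
    (hij : Linked {l | l ≠ y} B i j) : B' i y * B j y = B' j y * B i y := by
  refine linked_induction (D := D) (S := D.PivotAdmissible)
    (Q := fun B => ∀ B', SameOff D π y B B' → B i y ≠ 0 → B' i y * B j y = B' j y * B i y)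
    (fun _ hB => hB.mem) ?pivot ?eq ?common ?middle h.left hij B' h hiy
  case pivot =>
    intro B k l hB hl hkl hil hjl
    refine ⟨hB.pivot hkl, fun hQ B' h => ?_⟩
    have hik : i ≠ k := by rintro rfl; exact hkl hil
    have hjk : j ≠ k := by rintro rfl; exact hkl hjl
    have := hQ _ (h.pivot hl hkl)
    rwa [pivot_row_of_zero _ hik hil, pivot_row_of_zero _ hjk hjl,
      pivot_row_of_zero _ hik (by rwa [← h.eq _ _ hl]),
      pivot_row_of_zero _ hjk (by rwa [← h.eq _ _ hl])] at this
  case eq =>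
    rintro B rfl B' - -
    rfl
  case common =>
    intro B _ l hl hil hjl B' h hiy
    exact h.ratio_of_common L hl hil hjl hiy
  case middle =>
    intro B hB k l₁ hl₁ l₂ hl₂ hil₁ hkl₁ hkl₂ hjl₂ hil₂ hjl₁ B' h hiy
    by_cases hky : B k y = 0
    · exact h.ratio_of_middle L hl₁ hl₂ hil₁ hkl₁ hkl₂ hjl₂ hil₂ hjl₁ hky hiy
    · apply (isUnit_of_mem_elems (hB.mem k y) hky).mul_left_cancel
      linear_combination B j y * h.ratio_of_common L hl₁ hil₁ hkl₁ hiy +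
        B i y * h.ratio_of_common L hl₂ hkl₂ hjl₂ hky

end SameOff

end

/-! ### Uniqueness of lifts -/

section

variable {R R₁ : Type*} [CommRing R] [CommRing R₁] {X Y : Type*} {D : CrossSystem R}
  {D₁ : CrossSystem R₁} {π : R →+* R₁}

/-- The units of a cross system that `π` maps to `1`: the scaling factors by which two lifts of the
same matrix can differ. -/
def kernelUnits (D : CrossSystem R) (π : R →+* R₁) : Subgroup Rˣ :=
  D.units ⊓ (Units.map (π : R →* R₁)).ker

theorem map_kernelUnits {g : Rˣ} (hg : g ∈ kernelUnits D π) : π g = 1 :=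
  congrArg Units.val (MonoidHom.mem_ker.1 hg.2)

theorem ScalingEquiv.map_eq {A B : Matrix X Y R} (h : ScalingEquiv (kernelUnits D π) A B) :
    A.map π = B.map π := by
  obtain ⟨r, c, hr, hc, rfl⟩ := h
  ext i j
  simp [scale, map_kernelUnits (hr i), map_kernelUnits (hc j)]

theorem ScalingEquiv.mono {K K' : Subgroup Rˣ} (hK : K ≤ K') {A B : Matrix X Y R}
    (h : ScalingEquiv K A B) : ScalingEquiv K' A B :=
  let ⟨r, c, hr, hc, e⟩ := h
  ⟨r, c, fun i => hK (hr i), fun j => hK (hc j), e⟩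

theorem IsLiftSystem.exists_kernelUnits_mul_eq (L : IsLiftSystem D D₁ π) {a b : R}
    (ha : a ∈ D.elems) (hb : b ∈ D.elems) (h : π a = π b) : ∃ t ∈ kernelUnits D π, b = t * a := by
  by_cases ha₀ : a = 0
  · rw [ha₀, map_zero, eq_comm, L.map_eq_zero hb] at h
    exact ⟨1, Subgroup.one_mem _, by rw [h, ha₀, mul_zero]⟩
  have hb₀ : b ≠ 0 := fun hb₀ => ha₀ (by rwa [hb₀, map_zero, L.map_eq_zero ha] at h)
  obtain ⟨g, hg, rfl⟩ := exists_unit ha ha₀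
  obtain ⟨g', hg', rfl⟩ := exists_unit hb hb₀
  have hmap : Units.map (π : R →* R₁) g' = Units.map (π : R →* R₁) g := Units.ext h.symm
  refine ⟨g' / g, ⟨D.units.div_mem hg' hg, ?_⟩, by simp [div_eq_mul_inv]⟩
  exact MonoidHom.mem_ker.2 (by rw [map_div, hmap, div_self'])

theorem Linked.of_map {B : Matrix X Y R} {W : Set Y} {i j : X} (h : Linked W (B.map π) i j) :
    Linked W B i j :=
  fun U V hUV => h U V fun a l hl hal => hUV a l hl fun h₀ => hal (by rw [map_apply, h₀, map_zero])

variable [DecidableEq Y] {x y : Y}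

theorem map_dropCol (π : R →+* R₁) (A : Matrix X Y R) (x : Y) :
    (dropCol A x).map π = dropCol (A.map π) x := by
  ext i j
  by_cases hj : j = x
  · subst hj; simp
  · simp [dropCol_of_ne _ hj]

theorem dropCol_comm (A : Matrix X Y R) (x y : Y) :
    dropCol (dropCol A x) y = dropCol (dropCol A y) x := by
  ext i j
  by_cases hx : j = x <;> by_cases hy : j = y <;> simp [dropCol, hx, hy]

theorem eq_of_dropCol_eq (hxy : x ≠ y) {A B : Matrix X Y R} (hx : dropCol A x = dropCol B x)
    (hy : dropCol A y = dropCol B y) : A = B := by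
  ext i j
  by_cases hj : j = x
  · subst hj
    simpa only [dropCol_of_ne _ hxy] using congrFun (congrFun hy i) j
  · simpa only [dropCol_of_ne _ hj] using congrFun (congrFun hx i) j

theorem exists_dropCol_eq (hxy : x ≠ y) {A B : Matrix X Y R} (hA : ∀ i, A i x = 0)
    (hB : ∀ i, B i y = 0) (h : dropCol A y = dropCol B x) :
    ∃ C, dropCol C x = A ∧ dropCol C y = B := by
  refine ⟨fun i j => if j = y then A i j else B i j, ?_, ?_⟩
  · ext i j
    by_cases hx : j = x
    · simp [dropCol, hx, hA]
    · by_cases hy : j = y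
      · simp [dropCol, hy, hxy.symm]
      · simpa [dropCol, hx, hy] using (congrFun (congrFun h i) j).symm
  · ext i j
    by_cases hy : j = y
    · simp [dropCol, hy, hB]
    · simp [dropCol, hy]

variable [DecidableEq X]

theorem SameOff.exists_row_multiplier (L : IsLiftSystem D D₁ π) {B B' : Matrix X Y R}
    (h : SameOff D π y B B') : ∃ ρ : X → Rˣ, (∀ i, ρ i ∈ kernelUnits D π) ∧
      (∀ i, B' i y = ρ i * B i y) ∧ ∀ i j, Linked {l | l ≠ y} B i j → ρ i = ρ j := by
  have hcomponent : ∀ i, ∃ ρ ∈ kernelUnits D π, ∀ j, Linked {l | l ≠ y} B i j →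
      B' j y = ρ * B j y := by
    intro i
    by_cases hex : ∃ j, Linked {l | l ≠ y} B i j ∧ B j y ≠ 0
    · obtain ⟨j, hij, hjy⟩ := hex
      obtain ⟨t, ht, htB⟩ := L.exists_kernelUnits_mul_eq (h.left.mem j y) (h.right.mem j y)
        (h.map_eq j y)
      refine ⟨t, ht, fun j' hij' => ?_⟩
      have hratio := h.ratio_of_linked L hjy (hij.symm.trans hij')
      apply (isUnit_of_mem_elems (h.left.mem j y) hjy).mul_left_cancel
      linear_combination B j' y * htB - hratio
    · push Not at hex
      refine ⟨1, Subgroup.one_mem _, fun j hij => ?_⟩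
      rw [(h.eq_zero_iff L j y).2 (hex j hij), hex j hij, mul_zero]
  choose ρ hρ hρB using hcomponent
  let s : Setoid X :=
    ⟨Linked {l | l ≠ y} B, ⟨fun _ _ _ _ h => h, Linked.symm, Linked.trans⟩⟩
  exact ⟨fun i => ρ (Quotient.mk s i).out, fun i => hρ _,
    fun i => hρB _ i (Quotient.mk_out (s := s) i),
    fun i j hij => congrArg (fun q => ρ q.out) (Quotient.sound (s := s) hij)⟩

theorem SameOff.scalingEquiv (L : IsLiftSystem D D₁ π) {B B' : Matrix X Y R}
    (h : SameOff D π y B B') : ScalingEquiv (kernelUnits D π) B B' := by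
  obtain ⟨ρ, hρ, hρB, hlinked⟩ := h.exists_row_multiplier L
  have hcol : ∀ l, ∃ γ ∈ kernelUnits D π, (l = y → γ = 1) ∧
      (l ≠ y → ∀ i, B i l ≠ 0 → γ = (ρ i)⁻¹) := by
    intro l
    by_cases hl : l = y
    · exact ⟨1, Subgroup.one_mem _, fun _ => rfl, fun h => absurd hl h⟩
    by_cases hex : ∃ i, B i l ≠ 0
    · obtain ⟨i, hi⟩ := hex
      exact ⟨(ρ i)⁻¹, Subgroup.inv_mem _ (hρ i), fun h => absurd h hl, fun _ j hj => by
        rw [hlinked i j (linked_of_common_col hl hi hj)]⟩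
    · push Not at hex
      exact ⟨1, Subgroup.one_mem _, fun _ => rfl, fun _ i hi => absurd (hex i) hi⟩
  choose γ hγ hγy hγρ using hcol
  refine ⟨ρ, γ, hρ, hγ, ?_⟩
  ext i j
  by_cases hj : j = y
  · rw [scale, hγy j hj, Units.val_one, mul_one, hj, hρB]
  · by_cases hi : B i j = 0
    · rw [scale, ← h.eq i j hj, hi, mul_zero, zero_mul]
    · rw [scale, hγρ j hj i hi, ← h.eq i j hj, mul_right_comm, Units.mul_inv, one_mul]

theorem IsLiftSystem.scalingEquiv_of_support (L : IsLiftSystem D D₁ π) (T : Finset Y)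
    {A A' : Matrix X Y R} (hA : D.PivotAdmissible A) (hA' : D.PivotAdmissible A')
    (hmap : A.map π = A'.map π) (hT : ∀ i, ∀ j ∉ T, A i j = 0) :
    ScalingEquiv (kernelUnits D π) A A' := by
  induction T using Finset.induction_on generalizing A A' with
  | empty =>
    have hzero : A = A' := by
      ext i j
      have : π (A i j) = π (A' i j) := congrFun (congrFun hmap i) j
      rw [hT i j (Finset.notMem_empty j), map_zero, eq_comm, L.map_eq_zero (hA'.mem i j)] at this
      rw [hT i j (Finset.notMem_empty j), this]
    exact hzero ▸ .refl _ _
  | insert y T _ ih =>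
    obtain ⟨r, c, hr, hc, e⟩ := ih (hA.dropCol y) (hA'.dropCol y)
      (by rw [map_dropCol, map_dropCol, hmap]) (by
        intro i j hj
        by_cases hjy : j = y
        · subst hjy; simp
        · rw [dropCol_of_ne _ hjy]
          exact hT i j (by simp [hjy, hj]))
    have hscale : ScalingEquiv (kernelUnits D π) A (scale r c A) := ⟨r, c, hr, hc, rfl⟩
    have hoff : SameOff D π y (scale r c A) A' := by
      refine ⟨hA.scalingEquiv (hscale.mono inf_le_left), hA', hscale.map_eq.symm.trans hmap,
        fun i j hj => ?_⟩
      simpa only [scale, dropCol_of_ne _ hj] using congrFun (congrFun e i) j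
    exact hscale.trans (hoff.scalingEquiv L)

theorem IsLiftSystem.scalingEquiv [Finite Y] (L : IsLiftSystem D D₁ π) {A A' : Matrix X Y R}
    (hA : D.PivotAdmissible A) (hA' : D.PivotAdmissible A') (hmap : A.map π = A'.map π) :
    ScalingEquiv (kernelUnits D π) A A' :=
  have := Fintype.ofFinite Y
  L.scalingEquiv_of_support Finset.univ hA hA' hmap fun _ j hj => absurd (Finset.mem_univ j) hj

/-- `A` has a pivot-admissible lift along `π`. -/
def Liftable (D : CrossSystem R) (π : R →+* R₁) (A : Matrix X Y R₁) : Prop :=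
  ∃ B, D.PivotAdmissible B ∧ B.map π = A

theorem Liftable.transpose {A : Matrix X Y R₁} (h : Liftable D π A) : Liftable D π Aᵀ := by
  obtain ⟨B, hB, rfl⟩ := h
  exact ⟨Bᵀ, hB.transpose, rfl⟩

theorem Liftable.of_pivot [Nontrivial R₁] {A : Matrix X Y R₁} {k : X} {l : Y} (hkl : IsUnit (A k l))
    (h : Liftable D π (pivot A k l)) : Liftable D π A := by
  obtain ⟨B, hB, e⟩ := h
  have hmap : π (B k l) = Ring.inverse (A k l) := by
    rw [← pivot_same A k l, ← e, map_apply]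
  have hne : B k l ≠ 0 := fun h₀ => hkl.ringInverse.ne_zero (by rw [← hmap, h₀, map_zero])
  exact ⟨pivot B k l, hB.pivot hne, by rw [map_pivot (hB.mem k l), e, pivot_pivot _ hkl]⟩

theorem IsLiftSystem.exists_twoColLift [Finite Y] (L : IsLiftSystem D D₁ π) {A : Matrix X Y R₁}
    (hA : D₁.PivotAdmissible A) (hxy : x ≠ y) (hx : Liftable D π (dropCol A x))
    (hy : Liftable D π (dropCol A y)) : ∃ B, TwoColLift D D₁ π x y B ∧ B.map π = A := by
  obtain ⟨Bx, hBx, hBxA⟩ := hx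
  obtain ⟨By, hBy, hByA⟩ := hy
  obtain ⟨r, c, hr, hc, e⟩ := L.scalingEquiv (hBx.dropCol y) (hBy.dropCol x)
    (by rw [map_dropCol, map_dropCol, hBxA, hByA, dropCol_comm])
  have hscale : ScalingEquiv (kernelUnits D π) Bx (scale r c Bx) := ⟨r, c, hr, hc, rfl⟩
  have hzero : ∀ {B : Matrix X Y R} {z : Y}, D.PivotAdmissible B → B.map π = dropCol A z →
      ∀ i, B i z = 0 := by
    intro B z hB hBA i
    rw [← L.map_eq_zero (hB.mem i z), ← map_apply (f := π), hBA, dropCol_same]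
  obtain ⟨B, hBx', hBy'⟩ := exists_dropCol_eq hxy (A := scale r c Bx) (B := By)
    (fun i => by rw [scale, hzero hBx hBxA, mul_zero, zero_mul]) (hzero hBy hByA) (by
      rw [← e]
      ext i j
      by_cases hj : j = y <;> simp [dropCol, scale, hj])
  have hBA : B.map π = A := by
    refine eq_of_dropCol_eq hxy ?_ ?_
    · rw [← map_dropCol, hBx', ← hscale.map_eq, hBxA]
    · rw [← map_dropCol, hBy', hByA]
  refine ⟨B, ⟨hxy, ?_, by rwa [hBy'], by rwa [hBA]⟩, hBA⟩
  rw [hBx']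
  exact hBx.scalingEquiv (hscale.mono inf_le_left)

theorem IsLiftSystem.liftable_of_dropCol [Finite X] [Finite Y] (L : IsLiftSystem D D₁ π)
    {A : Matrix X Y R₁} (hA : D₁.PivotAdmissible A) (hxy : x ≠ y)
    (hx : Liftable D π (dropCol A x)) (hy : Liftable D π (dropCol A y))
    {S : Set (Matrix X Y R₁)} (hAS : A ∈ S)
    (hpivot : ∀ B ∈ S, ∀ k l, l ≠ x → l ≠ y → IsUnit (B k l) → pivot B k l ∈ S)
    (hlinked : ∀ B ∈ S, ∀ i j, B i x ≠ 0 → B i y ≠ 0 → B j x ≠ 0 → B j y ≠ 0 →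
      Linked {l | l ≠ x ∧ l ≠ y} B i j) : Liftable D π A := by
  obtain ⟨B, hB, rfl⟩ := L.exists_twoColLift hA hxy hx hy
  refine ⟨B, L.pivotAdmissible_of_twoColLift (S := {B | B.map π ∈ S}) hB hAS ?_ ?_, rfl⟩
  · intro B hBS hB k l hlx hly hkl
    rw [Set.mem_ofPred_eq, map_pivot (hB.mem k l)]
    exact hpivot _ hBS k l hlx hly ((isUnit_of_mem_elems (hB.mem k l) hkl).map π)
  · intro B hBS hB i j hiy hjx
    by_cases hix : B i x = 0
    · exact cross_of_mul_eq_zero (by rw [hix, zero_mul])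
    by_cases hjy : B j y = 0
    · exact cross_of_mul_eq_zero (by rw [hjy, mul_zero])
    exact hB.cross_of_linked L hix hiy hjx hjy (.of_map (hlinked _ hBS i j
      (L.map_ne_zero (hB.mem i x) hix) (L.map_ne_zero (hB.mem i y) hiy)
      (L.map_ne_zero (hB.mem j x) hjx) (L.map_ne_zero (hB.mem j y) hjy)))

end

section

variable {R R₁ : Type*} [CommRing R] [CommRing R₁] {X Y : Type*} {D : CrossSystem R}
  {D₁ : CrossSystem R₁} {π : R →+* R₁}

/-- All nonzero entries of the matrix are in the same column. -/
def SingleCol (A : Matrix X Y R) : Prop := ∀ i j i' j', A i j ≠ 0 → A i' j' ≠ 0 → j = j'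

theorem IsLiftSystem.exists_lift_matrix (L : IsLiftSystem D D₁ π) {A : Matrix X Y R₁}
    (hA : ∀ i j, A i j ∈ D₁.elems) :
    ∃ B : Matrix X Y R, (∀ i j, B i j ∈ D.elems) ∧ B.map π = A := by
  choose B hB hBA using fun i j => L.exists_lift (hA i j)
  exact ⟨B, hB, by ext i j; exact hBA i j⟩

theorem IsLiftSystem.exists_lift_cross (L : IsLiftSystem D D₁ π) {A : Matrix X Y R₁}
    (hA : D₁.Admissible A) {i k : X} {x y : Y} (hik : i ≠ k) (hxy : x ≠ y) (hiy : A i y ≠ 0)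
    (hkx : A k x ≠ 0) (hky : A k y ≠ 0) :
    ∃ B, (∀ a l, B a l ∈ D.elems) ∧ B.map π = A ∧ D.Cross B i k x y := by
  classical
  obtain ⟨p, hp, hpA⟩ := hA.cross hiy hkx
  obtain ⟨h, hh, rfl⟩ := L.exists_ratios_lift p hp
  obtain ⟨B, hB, rfl⟩ := L.exists_lift_matrix hA.mem
  have hunit := isUnit_of_mem_elems (hB k y) fun h₀ => hky (by rw [map_apply, h₀, map_zero])
  set b := h * (B i y * B k x) * Ring.inverse (B k y)
  have hb : b * B k y = h * (B i y * B k x) := by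
    rw [mul_assoc, Ring.inverse_mul_cancel _ hunit, mul_one]
  refine ⟨fun a l => if a = i ∧ l = x then b else B a l, fun a l => ?_, ?_, h, hh, ?_⟩
  · dsimp only
    split_ifs
    · exact mul_mem (mul_mem (L.ratios_subset hh) (mul_mem (hB _ _) (hB _ _)))
        (inverse_mem_elems (hB _ _))
    · exact hB a l
  · ext a l
    change π (if a = i ∧ l = x then b else B a l) = π (B a l)
    split_ifs with hal
    · obtain ⟨rfl, rfl⟩ := hal
      refine (hunit.map π).mul_right_cancel ?_
      rw [← map_mul, hb, map_mul, map_mul]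
      exact hpA.symm
    · rfl
  · simpa [hik.symm, hxy.symm] using hb

variable [DecidableEq X] [DecidableEq Y] {x y : Y}

theorem exists_ne_zero_row_of_pivot {A : Matrix X Y R} {k i : X} {l m : Y}
    (h : pivot A k l i m ≠ 0) (hkl : A k l ≠ 0) : ∃ m, A i m ≠ 0 := by
  contrapose! h
  have hi : i ≠ k := by rintro rfl; exact hkl (h l)
  rw [pivot_row_of_zero _ hi (h l), h]

theorem exists_ne_zero_col_of_pivot {A : Matrix X Y R} {k i : X} {l m : Y}
    (h : pivot A k l i m ≠ 0) (hkl : A k l ≠ 0) : ∃ i, A i m ≠ 0 := by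
  contrapose! h
  have hm : m ≠ l := by rintro rfl; exact hkl (h k)
  rw [pivot_col_of_zero _ hm (h k), h]

theorem SingleCol.pivot {A : Matrix X Y R} (h : SingleCol A) {k : X} {l : Y} (hkl : A k l ≠ 0) :
    SingleCol (pivot A k l) := by
  intro i j i' j' hij hij'
  obtain ⟨a, ha⟩ := exists_ne_zero_col_of_pivot hij hkl
  obtain ⟨b, hb⟩ := exists_ne_zero_col_of_pivot hij' hkl
  exact h _ _ _ _ ha hb

theorem SingleCol.pivotAdmissible {A : Matrix X Y R} (h : SingleCol A)
    (hA : ∀ i j, A i j ∈ D.elems) : D.PivotAdmissible A := by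
  refine CrossSystem.PivotAdmissible.of_invariant
    (S := {B | (∀ i j, B i j ∈ D.elems) ∧ SingleCol B}) ?_ ?_ ⟨hA, h⟩
  · rintro B ⟨hB, hs⟩
    refine ⟨hB, fun {i j u v} hiv hju => ?_⟩
    obtain rfl := hs _ _ _ _ hiv hju
    exact cross_same_col B i j v
  · rintro B ⟨hB, hs⟩ k l hkl
    refine ⟨fun i j => ?_, hs.pivot hkl⟩
    by_cases hj : j = l
    · subst hj
      by_cases hi : i = k
      · subst hi
        rw [pivot_same]
        exact inverse_mem_elems (hB _ _)
      · rw [pivot_col _ _ hi]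
        exact neg_mem_elems (mul_mem (hB _ _) (inverse_mem_elems (hB _ _)))
    · have hkj : B k j = 0 := not_not.1 fun h₀ => hj (hs _ _ _ _ h₀ hkl)
      rw [pivot_col_of_zero _ hj hkj]
      exact hB _ _

theorem IsLiftSystem.liftable_of_singleCol (L : IsLiftSystem D D₁ π) {A : Matrix X Y R₁}
    (hA : ∀ i j, A i j ∈ D₁.elems) (h : SingleCol A) : Liftable D π A := by
  obtain ⟨B, hB, rfl⟩ := L.exists_lift_matrix hA
  exact ⟨B, SingleCol.pivotAdmissible (fun i j i' j' h₁ h₂ =>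
    h i j i' j' (L.map_ne_zero (hB _ _) h₁) (L.map_ne_zero (hB _ _) h₂)) hB, rfl⟩

theorem IsLiftSystem.pivotAdmissible_of_two_columns [Finite X] (L : IsLiftSystem D D₁ π)
    {B : Matrix X Y R} (hB : ∀ i j, B i j ∈ D.elems) (hπ : D₁.PivotAdmissible (B.map π))
    (hxy : x ≠ y) (hsupp : ∀ i j, B i j ≠ 0 → j = x ∨ j = y)
    (hcross : ∀ i k, B i y ≠ 0 → B k x ≠ 0 → D.Cross B i k x y) : D.PivotAdmissible B := by
  have hdrop : ∀ z w, (∀ j, j = x ∨ j = y → j ≠ z → j = w) →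
      D.PivotAdmissible (dropCol B z) := by
    intro z w hzw
    have hw : ∀ i j, dropCol B z i j ≠ 0 → j = w := by
      intro i j hij
      have hj := ne_of_dropCol_ne_zero hij
      rw [dropCol_of_ne _ hj] at hij
      exact hzw j (hsupp i j hij) hj
    refine SingleCol.pivotAdmissible
      (fun i j i' j' h h' => (hw i j h).trans (hw i' j' h').symm) fun i j => ?_
    by_cases hj : j = z
    · subst hj; rw [dropCol_same]; exact zero_mem_elems
    · rw [dropCol_of_ne _ hj]; exact hB i j
  refine L.pivotAdmissible_of_twoColLift (S := {B}) ⟨hxy, hdrop x y fun j hj => hj.resolve_left,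
    hdrop y x fun j hj => hj.resolve_right, hπ⟩ rfl ?_ ?_
  · rintro _ rfl - i j hjx hjy hij
    exact absurd (hsupp i j hij) (by simp [hjx, hjy])
  · rintro _ rfl -
    exact hcross

theorem IsLiftSystem.liftable_of_two_by_two [Finite X] (L : IsLiftSystem D D₁ π)
    {A : Matrix X Y R₁} (hA : D₁.PivotAdmissible A) {i k : X} (hxy : x ≠ y)
    (hsupp : ∀ a l, A a l ≠ 0 → (a = i ∨ a = k) ∧ (l = x ∨ l = y)) : Liftable D π A := by
  suffices h : ∃ B : Matrix X Y R, (∀ a l, B a l ∈ D.elems) ∧ B.map π = A ∧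
      (B i y ≠ 0 → B k x ≠ 0 → D.Cross B i k x y) ∧
      (B k y ≠ 0 → B i x ≠ 0 → D.Cross B k i x y) by
    obtain ⟨B, hB, rfl, hik, hki⟩ := h
    have hsuppB := fun a l (h : B a l ≠ 0) => hsupp a l (L.map_ne_zero (hB a l) h)
    refine ⟨B, L.pivotAdmissible_of_two_columns hB hA hxy (fun a l h => (hsuppB a l h).2) ?_, rfl⟩
    intro a b hay hbx
    rcases (hsuppB a y hay).1 with rfl | rfl <;> rcases (hsuppB b x hbx).1 with rfl | rfl
    exacts [cross_same_row _ _ _ _, hik hay hbx, hki hay hbx, cross_same_row _ _ _ _]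
  by_cases hne : i ≠ k ∧ A i y ≠ 0 ∧ A k x ≠ 0 ∧ A k y ≠ 0
  · obtain ⟨hik, hiy, hkx, hky⟩ := hne
    obtain ⟨B, hB, hBA, hcross⟩ := L.exists_lift_cross hA.admissible hik hxy hiy hkx hky
    exact ⟨B, hB, hBA, fun _ _ => hcross, fun hky hix => L.cross_swap hB hix hky hcross⟩
  obtain ⟨B, hB, rfl⟩ := L.exists_lift_matrix hA.mem
  refine ⟨B, hB, rfl, fun hiy hkx => ?_, fun hky _ => ?_⟩
  · by_cases hik : i = k
    · subst hik; exact cross_same_row _ _ _ _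
    refine cross_of_mul_eq_zero ?_
    have hky : B k y = 0 := by_contra fun hky =>
      hne ⟨hik, L.map_ne_zero (hB _ _) hiy, L.map_ne_zero (hB _ _) hkx, L.map_ne_zero (hB _ _) hky⟩
    rw [hky, mul_zero]
  · by_cases hik : i = k
    · subst hik; exact cross_same_row _ _ _ _
    refine cross_of_mul_eq_zero (mul_eq_zero_of_ne_zero_imp_eq_zero fun hkx => ?_)
    by_contra hiy
    exact hne ⟨hik, L.map_ne_zero (hB _ _) hiy, L.map_ne_zero (hB _ _) hkx,
      L.map_ne_zero (hB _ _) hky⟩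

end

/-! ### Connected dominating sets -/

section

variable {V : Type*} {G : SimpleGraph V} {S : Set V} {u w : V}

/-- The vertices outside `S` with a neighbour in `S`. -/
def vertexBoundary (G : SimpleGraph V) (S : Set V) : Set V :=
  {w | w ∉ S ∧ ∃ s ∈ S, G.Adj s w}

theorem vertexBoundary_singleton (v : V) : vertexBoundary G {v} = G.neighborSet v := by
  ext w
  simp only [vertexBoundary, Set.mem_ofPred_eq, Set.mem_singleton_iff, exists_eq_left,
    SimpleGraph.mem_neighborSet, and_iff_right_iff_imp]
  exact fun h => h.ne'

theorem vertexBoundary_subset_support : vertexBoundary G S ⊆ G.support :=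
  fun _ ⟨_, _, _, h⟩ => h.mem_support_right

theorem insert_sdiff_subset_vertexBoundary_insert (huw : G.Adj u w) (hw : w ∉ S) :
    insert w (vertexBoundary G S \ {u}) ⊆ vertexBoundary G (insert u S) := by
  rintro t (rfl | ⟨⟨ht, s, hs, hst⟩, htu⟩)
  · exact ⟨by simp [huw.ne', hw], u, Set.mem_insert _ _, huw⟩
  · exact ⟨by simpa [ht] using htu, s, Set.mem_insert_of_mem _ hs, hst⟩

theorem ncard_vertexBoundary_le_insert [Finite V] (hu : u ∈ vertexBoundary G S)
    (huw : G.Adj u w) (hw : w ∉ S ∪ vertexBoundary G S) :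
    (vertexBoundary G S).ncard ≤ (vertexBoundary G (insert u S)).ncard := by
  rw [Set.mem_union, not_or] at hw
  rw [← Set.ncard_exchange hw.2 hu]
  exact Set.ncard_le_ncard (insert_sdiff_subset_vertexBoundary_insert huw hw.1)

theorem connected_induce_insert (hS : (G.induce S).Connected) (hu : u ∈ vertexBoundary G S) :
    (G.induce (insert u S)).Connected := by
  obtain ⟨-, s, hs, hsu⟩ := hu
  rw [Set.insert_eq, Set.union_comm]
  exact SimpleGraph.connected_induce_union hS.preconnected
    SimpleGraph.Preconnected.of_subsingleton hs rfl hsu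

theorem exists_connected_induce_dominating [Finite V] {v : V} (hv : 3 ≤ (G.neighborSet v).ncard) :
    ∃ S, v ∈ S ∧ (G.induce S).Connected ∧ 3 ≤ (vertexBoundary G S).ncard ∧
      ∀ u w, u ∈ S ∪ vertexBoundary G S → G.Adj u w → w ∈ S ∪ vertexBoundary G S := by
  obtain ⟨S, ⟨hvS, hS, hcard⟩, hmax⟩ := (Set.toFinite {S : Set V | v ∈ S ∧
    (G.induce S).Connected ∧ 3 ≤ (vertexBoundary G S).ncard}).exists_maximal
      ⟨{v}, rfl, SimpleGraph.connected_iff _ |>.2 ⟨.of_subsingleton, ⟨⟨v, rfl⟩⟩⟩,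
        by rwa [vertexBoundary_singleton]⟩
  refine ⟨S, hvS, hS, hcard, fun u w hu huw => ?_⟩
  by_contra hw
  -- Otherwise `insert u S` is larger, with `w` in place of `u` in its boundary.
  have huS : u ∉ S := fun hu => hw (by
    by_cases hwS : w ∈ S
    · exact Or.inl hwS
    · exact Or.inr ⟨hwS, u, hu, huw⟩)
  have hu := hu.resolve_left huS
  exact huS (hmax ⟨Set.mem_insert_of_mem _ hvS, connected_induce_insert hS hu,
    hcard.trans (ncard_vertexBoundary_le_insert hu huw hw)⟩ (Set.subset_insert _ _)
      (Set.mem_insert _ _))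

theorem iff_of_preconnected_induce (hS : (G.induce S).Preconnected) {χ : V → Prop}
    (hχ : ∀ s ∈ S, ∀ t ∈ S, G.Adj s t → (χ s ↔ χ t)) {s t : V} (hs : s ∈ S) (ht : t ∈ S) :
    χ s ↔ χ t := by
  obtain ⟨q⟩ := hS ⟨s, hs⟩ ⟨t, ht⟩
  suffices h : ∀ {a b : S}, (G.induce S).Walk a b → (χ a ↔ χ b) from h q
  intro a b q
  induction q with
  | nil => rfl
  | cons hab _ ih => exact (hχ _ (Subtype.coe_prop _) _ (Subtype.coe_prop _) hab).trans ih

end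

section

variable {R : Type*} [CommRing R] {X Y : Type*} {A : Matrix X Y R} {S : Set (X ⊕ Y)}

/-- The bipartite graph of a matrix: row `i` and column `j` are adjacent if `A i j ≠ 0`. -/
def bipartiteGraph (A : Matrix X Y R) : SimpleGraph (X ⊕ Y) where
  Adj
    | .inl i, .inr j => A i j ≠ 0
    | .inr j, .inl i => A i j ≠ 0
    | _, _ => False
  symm := ⟨by rintro (i | j) (i' | j') <;> exact id⟩
  loopless := ⟨by rintro (i | j) <;> exact id⟩

@[simp]
theorem bipartiteGraph_adj_inl_inr {i : X} {j : Y} :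
    (bipartiteGraph A).Adj (.inl i) (.inr j) ↔ A i j ≠ 0 := Iff.rfl

@[simp]
theorem bipartiteGraph_adj_inr_inl {i : X} {j : Y} :
    (bipartiteGraph A).Adj (.inr j) (.inl i) ↔ A i j ≠ 0 := Iff.rfl

@[simp]
theorem not_bipartiteGraph_adj_inl_inl {i i' : X} :
    ¬ (bipartiteGraph A).Adj (.inl i) (.inl i') := id

@[simp]
theorem not_bipartiteGraph_adj_inr_inr {j j' : Y} :
    ¬ (bipartiteGraph A).Adj (.inr j) (.inr j') := id

@[simp]
theorem inl_mem_support_bipartiteGraph {i : X} :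
    .inl i ∈ (bipartiteGraph A).support ↔ ∃ j, A i j ≠ 0 := by
  simp [SimpleGraph.mem_support]

@[simp]
theorem inr_mem_support_bipartiteGraph {j : Y} :
    .inr j ∈ (bipartiteGraph A).support ↔ ∃ i, A i j ≠ 0 := by
  simp [SimpleGraph.mem_support]

theorem bipartiteGraph_adj_swap {u w : X ⊕ Y} :
    (bipartiteGraph Aᵀ).Adj u.swap w.swap ↔ (bipartiteGraph A).Adj u w := by
  rcases u with i | j <;> rcases w with i' | j' <;> exact Iff.rfl

theorem swap_mem_support_bipartiteGraph {u : X ⊕ Y} :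
    u.swap ∈ (bipartiteGraph Aᵀ).support ↔ u ∈ (bipartiteGraph A).support := by
  rcases u with i | j <;> simp

theorem exists_ne_inl_or_inr_mem_of_three_le_ncard {T : Set (X ⊕ Y)} (h : 3 ≤ T.ncard) :
    (∃ i i', i ≠ i' ∧ .inl i ∈ T ∧ .inl i' ∈ T) ∨ ∃ j j', j ≠ j' ∧ .inr j ∈ T ∧ .inr j' ∈ T := by
  obtain ⟨a, b, c, ha, hb, hc, hab, hac, hbc⟩ :=
    (Set.two_lt_ncard_iff (Set.finite_of_ncard_pos (by lia))).1 h
  rcases a with i | j <;> rcases b with i' | j' <;> rcases c with i'' | j'' <;> grind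

/-- All nonzero rows are in the same component of the bipartite graph. -/
def ConnectedMatrix (A : Matrix X Y R) : Prop :=
  ∀ i j, (∃ m, A i m ≠ 0) → (∃ m, A j m ≠ 0) → Linked Set.univ A i j

theorem ConnectedMatrix.support_subset (hA : ConnectedMatrix A) {T : Set (X ⊕ Y)}
    (hT : ∀ u w, u ∈ T → (bipartiteGraph A).Adj u w → w ∈ T) {v : X ⊕ Y} (hv : v ∈ T)
    (hv' : v ∈ (bipartiteGraph A).support) : (bipartiteGraph A).support ⊆ T := by
  obtain ⟨i₀, hi₀, hi₀'⟩ : ∃ i, .inl i ∈ T ∧ ∃ j, A i j ≠ 0 := by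
    rcases v with i | j
    · exact ⟨i, hv, by simpa using hv'⟩
    · obtain ⟨i, hij⟩ := inr_mem_support_bipartiteGraph.1 hv'
      exact ⟨i, hT _ _ hv hij, j, hij⟩
  have hrow : ∀ i, (∃ j, A i j ≠ 0) → .inl i ∈ T := fun i hi =>
    hA i₀ i hi₀' hi (Sum.inl ⁻¹' T) (Sum.inr ⁻¹' T)
      (fun i j _ hij => ⟨fun h => hT (.inl i) (.inr j) h hij, fun h => hT (.inr j) (.inl i) h hij⟩)
      hi₀
  rintro (i | j) h
  · exact hrow i (inl_mem_support_bipartiteGraph.1 h)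
  · obtain ⟨i, hij⟩ := inr_mem_support_bipartiteGraph.1 h
    exact hT (.inl i) (.inr j) (hrow i ⟨j, hij⟩) hij

/-- A connected dominating set of the bipartite graph of a matrix, disregarding zero rows and zero
columns. A column outside it can be deleted without disconnecting the matrix. -/
structure IsCore (A : Matrix X Y R) (S : Set (X ⊕ Y)) : Prop where
  connected : ((bipartiteGraph A).induce S).Connected
  support_subset : (bipartiteGraph A).support ⊆ S ∪ vertexBoundary (bipartiteGraph A) S

theorem IsCore.transpose (h : IsCore A S) : IsCore Aᵀ (Sum.swap ⁻¹' S) where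
  connected := by
    let f : bipartiteGraph A →g bipartiteGraph Aᵀ := ⟨Sum.swap, bipartiteGraph_adj_swap.2⟩
    refine h.connected.map (SimpleGraph.induceHom f fun v hv => ?_) ?_
    · simpa [f] using hv
    · rintro ⟨v, hv⟩
      exact ⟨⟨v.swap, hv⟩, Subtype.ext v.swap_swap⟩
  support_subset := by
    intro v hv
    obtain ⟨v, rfl⟩ := Sum.swap_rightInverse.surjective v
    rcases h.support_subset (swap_mem_support_bipartiteGraph.1 hv) with hvS | ⟨hvS, s, hs, hsv⟩
    · exact Or.inl (by simpa using hvS)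
    · exact Or.inr ⟨by simpa using hvS, s.swap, by simpa using hs, bipartiteGraph_adj_swap.2 hsv⟩

theorem IsCore.linked (h : IsCore A S) {W : Set Y} (hW : ∀ j, .inr j ∈ S → j ∈ W) {i i' : X}
    (hi : ∃ m, A i m ≠ 0) (hi' : ∃ m, A i' m ≠ 0) : Linked W A i i' := by
  intro U V hUV
  let χ : X ⊕ Y → Prop := Sum.elim (· ∈ U) (· ∈ V)
  have hχ : ∀ s ∈ S, ∀ t ∈ S, (bipartiteGraph A).Adj s t → (χ s ↔ χ t) := by
    rintro (i | j) hs (i' | j') ht hst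
    exacts [hst.elim, hUV i j' (hW _ ht) hst, (hUV i' j (hW _ hs) hst).symm, hst.elim]
  have hrow : ∀ i, (∃ m, A i m ≠ 0) → ∃ s ∈ S, χ (.inl i) ↔ χ s := by
    intro i hi
    rcases h.support_subset (inl_mem_support_bipartiteGraph.2 hi) with hiS | ⟨-, i' | j, hj, hij⟩
    exacts [⟨_, hiS, Iff.rfl⟩, hij.elim, ⟨_, hj, hUV i j (hW _ hj) hij⟩]
  obtain ⟨s, hs, his⟩ := hrow i hi
  obtain ⟨t, ht, hit⟩ := hrow i' hi'
  exact ((his.trans (iff_of_preconnected_induce h.connected.preconnected hχ hs ht)).trans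
    hit.symm).1

/-- Some row or column has at least three nonzero entries. -/
def HasBranch (A : Matrix X Y R) : Prop := ∃ v, 3 ≤ ((bipartiteGraph A).neighborSet v).ncard

theorem ConnectedMatrix.exists_isCore [Finite X] [Finite Y] (hA : ConnectedMatrix A)
    (hb : HasBranch A) : ∃ S, IsCore A S ∧ 3 ≤ (vertexBoundary (bipartiteGraph A) S).ncard := by
  obtain ⟨v, hv⟩ := hb
  obtain ⟨S, hvS, hS, hcard, hclosed⟩ := exists_connected_induce_dominating hv
  obtain ⟨w, hvw⟩ := Set.nonempty_of_ncard_ne_zero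
    (s := (bipartiteGraph A).neighborSet v) (by lia)
  exact ⟨S, ⟨hS, hA.support_subset hclosed (Or.inl hvS) ⟨w, hvw⟩⟩, hcard⟩

theorem hasBranch_of_row [Finite X] [Finite Y] {k : X} {x y z : Y} (hxy : x ≠ y) (hxz : x ≠ z)
    (hyz : y ≠ z) (hx : A k x ≠ 0) (hy : A k y ≠ 0) (hz : A k z ≠ 0) : HasBranch A :=
  ⟨.inl k, (Set.two_lt_ncard_iff (Set.toFinite _)).2
    ⟨.inr x, .inr y, .inr z, hx, hy, hz, by simpa, by simpa, by simpa⟩⟩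

theorem hasBranch_of_col [Finite X] [Finite Y] {i j k : X} {x : Y} (hij : i ≠ j) (hik : i ≠ k)
    (hjk : j ≠ k) (hi : A i x ≠ 0) (hj : A j x ≠ 0) (hk : A k x ≠ 0) : HasBranch A :=
  ⟨.inr x, (Set.two_lt_ncard_iff (Set.toFinite _)).2
    ⟨.inl i, .inl j, .inl k, hi, hj, hk, by simpa, by simpa, by simpa⟩⟩

theorem eq_or_eq_of_row [Finite X] [Finite Y] (hb : ¬ HasBranch A) {k : X} {x y z : Y}
    (hxy : x ≠ y) (hx : A k x ≠ 0) (hy : A k y ≠ 0) (hz : A k z ≠ 0) : z = x ∨ z = y := by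
  by_contra! h
  exact hb (hasBranch_of_row hxy h.1.symm h.2.symm hx hy hz)

theorem eq_or_eq_of_col [Finite X] [Finite Y] (hb : ¬ HasBranch A) {i j k : X} {x : Y}
    (hij : i ≠ j) (hi : A i x ≠ 0) (hj : A j x ≠ 0) (hk : A k x ≠ 0) : k = i ∨ k = j := by
  by_contra! h
  exact hb (hasBranch_of_col hij h.1.symm h.2.symm hi hj hk)

theorem ConnectedMatrix.exists_row_two (hc : ConnectedMatrix A) (hs : ¬ SingleCol A) :
    ∃ k x y, x ≠ y ∧ A k x ≠ 0 ∧ A k y ≠ 0 := by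
  contrapose! hs
  intro i j i' j' hij hij'
  by_contra hne
  refine hij' (hs i' j j' hne (hc i i' ⟨j, hij⟩ ⟨j', hij'⟩ {a | A a j ≠ 0} {j}
    (fun a l _ hal => ⟨fun h => ?_, ?_⟩) hij))
  · by_contra hl
    exact h (hs a l j hl hal)
  · rintro rfl
    exact hal

theorem ConnectedMatrix.exists_corner [Finite X] [Finite Y] (hc : ConnectedMatrix A)
    (hs : ¬ SingleCol A) (hst : ¬ SingleCol Aᵀ) (hb : ¬ HasBranch A) :
    ∃ i k x y, i ≠ k ∧ x ≠ y ∧ A i x ≠ 0 ∧ A k x ≠ 0 ∧ A k y ≠ 0 := by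
  obtain ⟨k, x, y, hxy, hx, hy⟩ := hc.exists_row_two hs
  contrapose! hst
  suffices h : ∀ a l, A a l ≠ 0 → a = k from
    fun l a l' a' hal hal' => (h a l hal).trans (h a' l' hal').symm
  intro a l hal
  refine hc k a ⟨x, hx⟩ ⟨l, hal⟩ {k} {x, y} (fun a l _ hal => ⟨?_, fun h => ?_⟩) rfl
  · rintro rfl
    exact eq_or_eq_of_row hb hxy hx hy hal
  · by_contra hak
    rcases h with rfl | rfl
    · exact hy (hst a k _ y hak hxy hal hx)
    · exact hx (hst a k _ x hak hxy.symm hal hy)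

end

/-! ### Existence of lifts -/

section

variable {R : Type*} [CommRing R] {X Y : Type*} [Finite X] [Finite Y] [DecidableEq X]
  [DecidableEq Y] {D : CrossSystem R} {A : Matrix X Y R}

theorem eq_of_col_of_corner (hA : ∀ a l, A a l ∈ D.elems) (hb : ¬ HasBranch A)
    (hbp : ∀ k l, A k l ≠ 0 → ¬ HasBranch (pivot A k l)) {i k j : X} {x y : Y} (hiy : A i y = 0)
    (hix : A i x ≠ 0) (hkx : A k x ≠ 0) (hky : A k y ≠ 0) (hjy : A j y ≠ 0) : j = k := by
  have hik : i ≠ k := by rintro rfl; exact hky hiy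
  have hij : i ≠ j := by rintro rfl; exact hjy hiy
  have hxy : y ≠ x := by rintro rfl; exact hix hiy
  by_contra hjk
  have hjx : A j x = 0 := by
    by_contra hjx
    exact (eq_or_eq_of_col hb hik hix hkx hjx).elim hij.symm hjk
  refine hbp k x hkx (hasBranch_of_col (x := y) hik.symm (Ne.symm hjk) hij ?_
    (pivot_ne_zero_of_eq_zero hA hiy hix hkx hky) ?_)
  · rw [pivot_row _ _ hxy]
    exact mul_ne_zero_of_mem_elems (inverse_mem_elems (hA _ _)) (inverse_ne_zero (hA _ _) hkx) hky
  · rwa [pivot_row_of_zero _ hjk hjx]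

theorem eq_of_row_of_corner (hA : ∀ a l, A a l ∈ D.elems) (hb : ¬ HasBranch A)
    (hbp : ∀ k l, A k l ≠ 0 → ¬ HasBranch (pivot A k l)) {i k : X} {x y z : Y} (hiy : A i y = 0)
    (hix : A i x ≠ 0) (hkx : A k x ≠ 0) (hky : A k y ≠ 0) (hiz : A i z ≠ 0) : z = x := by
  have hik : k ≠ i := by rintro rfl; exact hky hiy
  have hyz : y ≠ z := by rintro rfl; exact hiz hiy
  have hxy : y ≠ x := by rintro rfl; exact hix hiy
  by_contra hzx
  have hkz : A k z = 0 := by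
    by_contra hkz
    exact (eq_or_eq_of_row hb hxy hky hkx hkz).elim hyz.symm hzx
  refine hbp i x hix (hasBranch_of_row (k := k) hxy.symm (Ne.symm hzx) hyz ?_ ?_
    (pivot_ne_zero_of_eq_zero hA hkz hkx hix hiz))
  · rw [pivot_col _ _ hik, neg_ne_zero]
    exact mul_ne_zero_of_mem_elems (hA _ _) hkx (inverse_ne_zero (hA _ _) hix)
  · rwa [pivot_col_of_zero _ hxy hiy]

theorem splits_of_corner (hA : ∀ a l, A a l ∈ D.elems) (hb : ¬ HasBranch A)
    (hbp : ∀ k l, A k l ≠ 0 → ¬ HasBranch (pivot A k l)) {i k : X} {x y : Y} (hik : i ≠ k)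
    (hxy : x ≠ y) (hix : A i x ≠ 0) (hkx : A k x ≠ 0) (hky : A k y ≠ 0) :
    Splits Set.univ A {i, k} {x, y} := by
  refine fun a l _ hal => ⟨?_, ?_⟩
  · rintro (rfl | rfl)
    · by_cases hay : A a y = 0
      · exact Or.inl (eq_of_row_of_corner hA hb hbp hay hix hkx hky hal)
      · exact eq_or_eq_of_row hb hxy hix hay hal
    · exact eq_or_eq_of_row hb hxy hkx hky hal
  · rintro (rfl | rfl)
    · exact eq_or_eq_of_col hb hik hix hkx hal
    · by_cases hil : A i l = 0
      · exact Or.inr (eq_of_col_of_corner hA hb hbp hil hix hkx hky hal)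
      · exact eq_or_eq_of_col hb hik hil hky hal

theorem ConnectedMatrix.exists_two_by_two (hc : ConnectedMatrix A) (hA : ∀ i j, A i j ∈ D.elems)
    (hs : ¬ SingleCol A) (hst : ¬ SingleCol Aᵀ) (hb : ¬ HasBranch A)
    (hbp : ∀ k l, A k l ≠ 0 → ¬ HasBranch (pivot A k l)) :
    ∃ i k x y, x ≠ y ∧ ∀ a l, A a l ≠ 0 → (a = i ∨ a = k) ∧ (l = x ∨ l = y) := by
  obtain ⟨i, k, x, y, hik, hxy, hix, hkx, hky⟩ := hc.exists_corner hs hst hb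
  have hsplit := splits_of_corner hA hb hbp hik hxy hix hkx hky
  refine ⟨i, k, x, y, hxy, fun a l hal => ?_⟩
  have ha := hc i a ⟨x, hix⟩ ⟨l, hal⟩ _ _ hsplit (Or.inl rfl)
  exact ⟨ha, (hsplit a l (Set.mem_univ _) hal).1 ha⟩

end

section

variable {R : Type*} [CommRing R] {X Y : Type*} {A : Matrix X Y R}

theorem support_bipartiteGraph_pivot_subset [DecidableEq X] [DecidableEq Y] {k : X} {l : Y}
    (hkl : A k l ≠ 0) :
    (bipartiteGraph (pivot A k l)).support ⊆ (bipartiteGraph A).support := by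
  rintro (i | j) h
  · obtain ⟨m, h⟩ := inl_mem_support_bipartiteGraph.1 h
    exact inl_mem_support_bipartiteGraph.2 (exists_ne_zero_row_of_pivot h hkl)
  · obtain ⟨m, h⟩ := inr_mem_support_bipartiteGraph.1 h
    exact inr_mem_support_bipartiteGraph.2 (exists_ne_zero_col_of_pivot h hkl)

theorem ConnectedMatrix.pivot [DecidableEq X] [DecidableEq Y] [Nontrivial R]
    (h : ConnectedMatrix A) {k : X} {l : Y} (hkl : IsUnit (A k l)) :
    ConnectedMatrix (pivot A k l) := by
  rintro i j ⟨m, hi⟩ ⟨m', hj⟩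
  exact (h i j (exists_ne_zero_row_of_pivot hi hkl.ne_zero)
    (exists_ne_zero_row_of_pivot hj hkl.ne_zero)).pivot (Set.mem_univ _) hkl

/-- The number of nonzero rows and columns, which is the size of the induction for the lift
theorem. -/
noncomputable def nonzeroLines (A : Matrix X Y R) : ℕ := (bipartiteGraph A).support.ncard

theorem nonzeroLines_transpose (A : Matrix X Y R) : nonzeroLines Aᵀ = nonzeroLines A :=
  Set.ncard_congr (fun v _ => v.swap) (fun v hv => swap_mem_support_bipartiteGraph.1 (by simpa))
    (fun _ _ _ _ h => Sum.swap_leftInverse.injective h)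
    fun v hv => ⟨v.swap, swap_mem_support_bipartiteGraph.2 hv, v.swap_swap⟩

theorem nonzeroLines_dropCol_lt [Finite X] [Finite Y] [DecidableEq Y] {x : Y}
    (hx : ∃ i, A i x ≠ 0) : nonzeroLines (dropCol A x) < nonzeroLines A := by
  have hle : bipartiteGraph (dropCol A x) ≤ bipartiteGraph A := by
    have hA : ∀ i j, dropCol A x i j ≠ 0 → A i j ≠ 0 := fun i j h => by
      rwa [dropCol_of_ne _ (ne_of_dropCol_ne_zero h)] at h
    rintro (i | j) (i' | j') h
    exacts [h, hA _ _ h, hA _ _ h, h]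
  refine Set.ncard_lt_ncard ⟨SimpleGraph.support_mono hle, fun h => ?_⟩ (Set.toFinite _)
  obtain ⟨i, hi⟩ := inr_mem_support_bipartiteGraph.1 (h (inr_mem_support_bipartiteGraph.2 hx))
  exact hi (dropCol_same A x i)

theorem nonzeroLines_pivot_le [Finite X] [Finite Y] [DecidableEq X] [DecidableEq Y]
    {k : X} {l : Y} (hkl : A k l ≠ 0) :
    nonzeroLines (pivot A k l) ≤ nonzeroLines A :=
  Set.ncard_le_ncard (support_bipartiteGraph_pivot_subset hkl) (Set.toFinite _)

end

section

variable {R R₁ : Type*} [CommRing R] [CommRing R₁] {X Y : Type*} [Finite X] [Finite Y]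
  [DecidableEq X] [DecidableEq Y] {D : CrossSystem R} {D₁ : CrossSystem R₁} {π : R →+* R₁}
  {A : Matrix X Y R₁}

theorem IsLiftSystem.liftable_of_isCore (L : IsLiftSystem D D₁ π) (hA : D₁.PivotAdmissible A)
    {S : Set (X ⊕ Y)} (h : IsCore A S) {x y : Y} (hxy : x ≠ y) (hx : .inr x ∉ S) (hy : .inr y ∉ S)
    (hdx : Liftable D π (dropCol A x)) (hdy : Liftable D π (dropCol A y)) : Liftable D π A := by
  have := L.nontrivial_codomain
  refine L.liftable_of_dropCol hA hxy hdx hdy (S := {B | ∀ i j, (∃ m, B i m ≠ 0) →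
    (∃ m, B j m ≠ 0) → Linked {l | l ≠ x ∧ l ≠ y} B i j}) ?_ ?_ ?_
  · refine fun i j => h.linked (W := {l | l ≠ x ∧ l ≠ y}) fun l hl =>
      ⟨fun hlx => hx ?_, fun hly => hy ?_⟩
    exacts [hlx ▸ hl, hly ▸ hl]
  · rintro B hB k l hlx hly hkl i j ⟨m, hi⟩ ⟨m', hj⟩
    exact (hB i j (exists_ne_zero_row_of_pivot hi hkl.ne_zero)
      (exists_ne_zero_row_of_pivot hj hkl.ne_zero)).pivot ⟨hlx, hly⟩ hkl
  · exact fun B hB i j hix _ hjx _ => hB i j ⟨x, hix⟩ ⟨x, hjx⟩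

theorem IsLiftSystem.liftable_of_not_connectedMatrix (L : IsLiftSystem D D₁ π)
    (hA : D₁.PivotAdmissible A) (hc : ¬ ConnectedMatrix A)
    (hd : ∀ x, (∃ i, A i x ≠ 0) → Liftable D π (dropCol A x)) : Liftable D π A := by
  have := L.nontrivial_codomain
  simp only [ConnectedMatrix, Linked, not_forall] at hc
  obtain ⟨i, j, ⟨x, hix⟩, ⟨y, hjy⟩, U, V, hUV, hi, hj⟩ := hc
  have hx : x ∈ V := (hUV i x (Set.mem_univ _) hix).1 hi
  have hy : y ∉ V := fun h => hj ((hUV j y (Set.mem_univ _) hjy).2 h)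
  have hxy : x ≠ y := by rintro rfl; exact hy hx
  refine L.liftable_of_dropCol hA hxy (hd x ⟨i, hix⟩) (hd y ⟨j, hjy⟩)
    (S := {B | Splits Set.univ B U V}) hUV ?_ ?_
  · exact fun B hB k l _ _ hkl => Splits.pivot (Set.mem_univ _) hkl.ne_zero hB
  · intro B hB a b hax hay
    exact absurd ((hB a y (Set.mem_univ _) hay).1 ((hB a x (Set.mem_univ _) hax).2 hx)) hy

theorem IsLiftSystem.liftable_of_hasBranch (L : IsLiftSystem D D₁ π) (hA : D₁.PivotAdmissible A)
    (hc : ConnectedMatrix A) (hb : HasBranch A) (ih : ∀ B : Matrix X Y R₁, D₁.PivotAdmissible B →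
      nonzeroLines B < nonzeroLines A → Liftable D π B) : Liftable D π A := by
  obtain ⟨S, hS, hcard⟩ := hc.exists_isCore hb
  have hsupp := vertexBoundary_subset_support (G := bipartiteGraph A) (S := S)
  obtain ⟨x, y, hxy, hx, hy⟩ | ⟨x, y, hxy, hx, hy⟩ :=
    exists_ne_inl_or_inr_mem_of_three_le_ncard hcard
  · have hdrop : ∀ x, (∃ j, A x j ≠ 0) → Liftable D π (dropCol Aᵀ x) := fun x hx => by
      refine (ih (dropCol Aᵀ x)ᵀ (hA.transpose.dropCol x).transpose ?_).transpose
      rw [nonzeroLines_transpose, ← nonzeroLines_transpose A]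
      exact nonzeroLines_dropCol_lt hx
    exact (L.liftable_of_isCore hA.transpose hS.transpose hxy hx.1 hy.1
      (hdrop x (inl_mem_support_bipartiteGraph.1 (hsupp hx)))
      (hdrop y (inl_mem_support_bipartiteGraph.1 (hsupp hy)))).transpose
  · have hdrop : ∀ x, (∃ i, A i x ≠ 0) → Liftable D π (dropCol A x) := fun x hx =>
      ih _ (hA.dropCol x) (nonzeroLines_dropCol_lt hx)
    exact L.liftable_of_isCore hA hS hxy hx.1 hy.1
      (hdrop x (inr_mem_support_bipartiteGraph.1 (hsupp hx)))
      (hdrop y (inr_mem_support_bipartiteGraph.1 (hsupp hy)))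

/-- Induction on the number of nonzero lines: the lifts obtained after deleting one of two lines are
glued, and the deletions are chosen such that the rest of the matrix stays connected. -/
theorem IsLiftSystem.liftable (L : IsLiftSystem D D₁ π) (hA : D₁.PivotAdmissible A) :
    Liftable D π A := by
  induction hn : nonzeroLines A using Nat.strong_induction_on generalizing A with
  | _ n ih =>
  subst hn
  have ih' : ∀ B : Matrix X Y R₁, D₁.PivotAdmissible B → nonzeroLines B < nonzeroLines A →
      Liftable D π B := fun B hB h => ih _ h hB rfl
  by_cases hc : ConnectedMatrix A
  swap
  · exact L.liftable_of_not_connectedMatrix hA hc fun x hx =>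
      ih' _ (hA.dropCol x) (nonzeroLines_dropCol_lt hx)
  by_cases hs : SingleCol A
  · exact L.liftable_of_singleCol hA.mem hs
  by_cases hst : SingleCol Aᵀ
  · exact (L.liftable_of_singleCol hA.transpose.mem hst).transpose
  by_cases hb : HasBranch A
  · exact L.liftable_of_hasBranch hA hc hb ih'
  by_cases hbp : ∀ k l, A k l ≠ 0 → ¬ HasBranch (pivot A k l)
  · obtain ⟨i, k, x, y, hxy, hsupp⟩ := hc.exists_two_by_two hA.mem hs hst hb hbp
    exact L.liftable_of_two_by_two hA hxy hsupp
  · push Not at hbp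
    obtain ⟨k, l, hkl, hbp⟩ := hbp
    have := L.nontrivial_codomain
    have hunit := isUnit_of_mem_elems (hA.mem k l) hkl
    exact Liftable.of_pivot hunit (L.liftable_of_hasBranch (hA.pivot hkl) (hc.pivot hunit) hbp
      fun B hB h => ih' B hB (h.trans_le (nonzeroLines_pivot_le hkl)))

end

end MatrixLift

/-! ### Lifting functions -/

namespace PartialField

section Fundamentals

variable {P : Type*} [PartialField P]

theorem iota_eq_zero {p : P} : iota p = 0 ↔ p = 0 := by
  rw [← map_zero iota, iota_injective.eq_iff]

theorem iota_mul_iota_inv {p : P} (hp : p ≠ 0) : iota p * iota p⁻¹ = 1 := by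
  rw [← map_mul, mul_inv_cancel₀ hp, map_one]

theorem mem_fundamentals {p : P} : p ∈ fundamentals P ↔ ∃ q : P, iota p + iota q = 1 := by
  refine exists_congr fun q => ?_
  rw [padd_eq_some_iff, iota_neg, map_one]
  constructor <;> intro h <;> linear_combination -h

theorem exists_one_sub {p : P} (hp : p ∈ fundamentals P) :
    ∃ q ∈ fundamentals P, iota p + iota q = 1 := by
  obtain ⟨q, hq⟩ := mem_fundamentals.1 hp
  exact ⟨q, mem_fundamentals.2 ⟨p, by rw [add_comm, hq]⟩, hq⟩

theorem zero_mem_fundamentals : 0 ∈ fundamentals P := mem_fundamentals.2 ⟨1, by simp⟩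

theorem one_mem_fundamentals : 1 ∈ fundamentals P := mem_fundamentals.2 ⟨0, by simp⟩

theorem inv_mem_fundamentals {p : P} (hp : p ∈ fundamentals P) (h0 : p ≠ 0) :
    p⁻¹ ∈ fundamentals P := by
  obtain ⟨q, hq⟩ := mem_fundamentals.1 hp
  refine mem_fundamentals.2 ⟨-(q * p⁻¹), ?_⟩
  rw [iota_neg, map_mul]
  linear_combination -iota p⁻¹ * hq + iota_mul_iota_inv h0

end Fundamentals

section FundamentalLift

variable {P Q : Type*} [PartialField P] [PartialField Q] {u : P → Q}

/-- The laws of a lifting function, together with those that the lift theorem adds to them, without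
reference to a homomorphism. The values of `u` outside the fundamental elements are irrelevant. -/
structure IsFundamentalLift (u : P → Q) : Prop where
  one_sub : ∀ p ∈ fundamentals P, ∀ q ∈ fundamentals P, padd p q = some 1 →
    padd (u p) (u q) = some 1
  inv : ∀ p ∈ fundamentals P, ∀ q ∈ fundamentals P, p * q = 1 → u p * u q = 1
  triple : ∀ p ∈ fundamentals P, ∀ q ∈ fundamentals P, ∀ r ∈ fundamentals P, p * q * r = 1 →
    u p * u q * u r = 1
  two_zero : padd (1 : P) 1 = some 0 → padd (1 : Q) 1 = some 0

namespace IsFundamentalLift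

theorem iota_one_sub (h : IsFundamentalLift u) {p q : P} (hp : p ∈ fundamentals P)
    (hq : q ∈ fundamentals P) (hpq : iota p + iota q = 1) : iota (u p) + iota (u q) = 1 := by
  rw [← map_one iota, ← padd_eq_some_iff] at hpq ⊢
  exact h.one_sub p hp q hq hpq

theorem mul_inv (h : IsFundamentalLift u) {p : P} (hp : p ∈ fundamentals P) (h0 : p ≠ 0) :
    u p * u p⁻¹ = 1 :=
  h.inv p hp p⁻¹ (inv_mem_fundamentals hp h0) (mul_inv_cancel₀ h0)

theorem ne_zero (h : IsFundamentalLift u) {p : P} (hp : p ∈ fundamentals P) (h0 : p ≠ 0) :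
    u p ≠ 0 :=
  left_ne_zero_of_mul_eq_one (h.mul_inv hp h0)

protected theorem map_one (h : IsFundamentalLift u) : u 1 = 1 := by
  have hone : (1 : P) ∈ fundamentals P := one_mem_fundamentals
  have htriple := h.triple 1 hone 1 hone 1 hone (by simp)
  rwa [h.inv 1 hone 1 hone (one_mul 1), one_mul] at htriple

protected theorem map_zero (h : IsFundamentalLift u) : u 0 = 0 := by
  have hsum := h.iota_one_sub zero_mem_fundamentals one_mem_fundamentals (by simp)
  rw [h.map_one, map_one, add_eq_right] at hsum
  exact iota_eq_zero.1 hsum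

protected theorem map_mul (h : IsFundamentalLift u) {p q : P} (hp : p ∈ fundamentals P)
    (hq : q ∈ fundamentals P) (hpq : p * q ∈ fundamentals P) : u (p * q) = u p * u q := by
  by_cases h0 : p * q = 0
  · rw [h0, h.map_zero]
    rcases mul_eq_zero.1 h0 with rfl | rfl <;> simp [h.map_zero]
  · have hinv := h.mul_inv hpq h0
    have htriple := h.triple _ hp _ hq _ (inv_mem_fundamentals hpq h0) (mul_inv_cancel₀ h0)
    exact mul_right_cancel₀ (right_ne_zero_of_mul_eq_one hinv) (hinv.trans htriple.symm)

theorem map_neg_one (h : IsFundamentalLift u) (hn : (-1 : P) ∈ fundamentals P) : u (-1) = -1 := by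
  obtain ⟨q, hq, hsum⟩ := exists_one_sub hn
  have husum := h.iota_one_sub hn hq hsum
  apply iota_injective
  by_cases hq0 : q = 0
  · subst hq0
    rw [map_zero, add_zero, ← map_one iota, iota_injective.eq_iff] at hsum
    have htwo := h.two_zero (by simpa [hsum] using padd_neg (1 : P))
    rw [hsum, h.map_one, ← neg_unique _ _ htwo]
  · have hsq : iota (u (-1)) * iota (u (-1)) = 1 := by
      rw [← map_mul, h.inv _ hn _ hn (by simp), map_one]
    have hinv := iota_mul_iota_inv (h.ne_zero hq hq0)
    rw [iota_neg, map_one]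
    -- `u q = 1 - u (-1)` is invertible and annihilates `u (-1) + 1`.
    linear_combination (iota (u (-1)) + 1) * (-hinv + iota (u q)⁻¹ * husum) - iota (u q)⁻¹ * hsq

/-- With `q = 1 - p` and `q' = 1 + p`, apply `u` to `p * p + q * q' = 1`. -/
theorem map_neg_of_ne_one (h : IsFundamentalLift u) {p : P} (hp : p ∈ fundamentals P)
    (hn : -p ∈ fundamentals P) (hp1 : p ≠ 1) : u (-p) = -u p := by
  obtain ⟨q, hq, hsum⟩ := exists_one_sub hp
  obtain ⟨q', hq', hsum'⟩ := exists_one_sub hn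
  have husum := h.iota_one_sub hp hq hsum
  have husum' := h.iota_one_sub hn hq' hsum'
  have hq0 : q ≠ 0 := by
    rintro rfl
    exact hp1 (iota_injective (by simpa using hsum))
  have hsq : iota (p * p) + iota (q * q') = 1 := by
    rw [iota_neg] at hsum'
    rw [map_mul, map_mul]
    linear_combination iota q' * hsum + hsum' - iota p * hsum'
  have hpp : p * p ∈ fundamentals P := mem_fundamentals.2 ⟨_, hsq⟩
  have hqq : q * q' ∈ fundamentals P := mem_fundamentals.2 ⟨p * p, by rw [add_comm, hsq]⟩
  have husq := h.iota_one_sub hpp hqq hsq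
  rw [h.map_mul hp hp hpp, h.map_mul hq hq' hqq, map_mul, map_mul] at husq
  have hzero : iota (u q) * (iota (u (-p)) + iota (u p)) = 0 := by
    linear_combination -husq + iota (u q) * husum' + (1 + iota (u p)) * husum
  have hinv := iota_mul_iota_inv (h.ne_zero hq hq0)
  apply iota_injective
  rw [iota_neg]
  linear_combination iota (u q)⁻¹ * hzero - (iota (u (-p)) + iota (u p)) * hinv

protected theorem map_neg (h : IsFundamentalLift u) {p : P} (hp : p ∈ fundamentals P)
    (hn : -p ∈ fundamentals P) : u (-p) = -u p := by
  by_cases hp1 : p = 1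
  · subst hp1
    rw [h.map_neg_one hn, h.map_one]
  · exact h.map_neg_of_ne_one hp hn hp1

end IsFundamentalLift

end FundamentalLift

section CrossSystems

open MatrixLift

variable {P Q : Type*} [PartialField P] [PartialField Q] {u : P → Q}

variable (P) in
/-- The nonzero elements and the fundamental elements of `P`, inside its universal ring. -/
noncomputable def ringSystem : CrossSystem (UnivRing P) where
  units := (Units.map (iota : P →*₀ UnivRing P).toMonoidHom).range
  ratios := iota '' fundamentals P
  neg_one_mem := ⟨-1, Units.ext ((iota_neg (1 : P)).trans (by simp))⟩
  zero_mem_ratios := ⟨0, zero_mem_fundamentals, map_zero _⟩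
  one_mem_ratios := ⟨1, one_mem_fundamentals, map_one _⟩

theorem mem_ringSystem_elems {x : UnivRing P} : x ∈ (ringSystem P).elems ↔ ∃ p, iota p = x := by
  constructor
  · rintro (rfl | ⟨_, ⟨p, rfl⟩, rfl⟩)
    · exact ⟨0, map_zero _⟩
    · exact ⟨p, rfl⟩
  · rintro ⟨p, rfl⟩
    by_cases h : p = 0
    · exact .inl (by rw [h, map_zero])
    · exact .inr ⟨_, ⟨Units.mk0 p h, rfl⟩, rfl⟩

namespace IsFundamentalLift

/-- The pairs of nonzero elements of `P` and `Q`, and the graph of `u` on the fundamental elements,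
inside the product of the universal rings. A matrix over this system consists of a matrix over `P`
and a matrix over `Q` whose cross ratios correspond under `u`. -/
noncomputable def pairSystem (h : IsFundamentalLift u) :
    CrossSystem (UnivRing P × UnivRing Q) where
  units := (ringSystem P).units.comap (Units.map (MonoidHom.fst _ _)) ⊓
    (ringSystem Q).units.comap (Units.map (MonoidHom.snd _ _))
  ratios := (fun p => (iota p, iota (u p))) '' fundamentals P
  neg_one_mem := ⟨(ringSystem P).neg_one_mem, (ringSystem Q).neg_one_mem⟩
  zero_mem_ratios := ⟨0, zero_mem_fundamentals, by simp [h.map_zero]⟩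
  one_mem_ratios := ⟨1, one_mem_fundamentals, by simp [h.map_one]⟩

theorem exists_mem_pairSystem_units (h : IsFundamentalLift u) {p : P} {q : Q} (hp : p ≠ 0)
    (hq : q ≠ 0) :
    ∃ g ∈ h.pairSystem.units, (g : UnivRing P × UnivRing Q) = (iota p, iota q) :=
  ⟨MulEquiv.prodUnits.symm (Units.map (iota : P →*₀ UnivRing P).toMonoidHom (.mk0 p hp),
    Units.map (iota : Q →*₀ UnivRing Q).toMonoidHom (.mk0 q hq)),
    ⟨⟨.mk0 p hp, Units.ext rfl⟩, ⟨.mk0 q hq, Units.ext rfl⟩⟩, rfl⟩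

theorem exists_of_mem_pairSystem_elems (h : IsFundamentalLift u) {x : UnivRing P × UnivRing Q}
    (hx : x ∈ h.pairSystem.elems) : ∃ q : Q, iota q = x.2 ∧ (q = 0 ↔ x = 0) := by
  rcases hx with rfl | ⟨g, ⟨-, ⟨q, hq⟩⟩, rfl⟩
  · exact ⟨0, map_zero _, by simp⟩
  · exact ⟨q, congrArg Units.val hq, by simp⟩

theorem isLiftSystem (h : IsFundamentalLift u) :
    IsLiftSystem h.pairSystem (ringSystem P) (RingHom.fst (UnivRing P) (UnivRing Q)) where
  one_ne_zero := one_ne_zero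
  exists_units_lift := by
    rintro _ ⟨p, rfl⟩
    obtain ⟨g, hg, hgp⟩ := h.exists_mem_pairSystem_units p.ne_zero one_ne_zero
    exact ⟨g, hg, Units.ext (congrArg Prod.fst hgp)⟩
  ratios_subset := by
    rintro _ ⟨p, hp, rfl⟩
    by_cases h0 : p = 0
    · exact .inl (by simp [h0, h.map_zero])
    · exact .inr (h.exists_mem_pairSystem_units h0 (h.ne_zero hp h0))
  one_sub_mem_ratios := by
    rintro _ ⟨p, hp, rfl⟩
    obtain ⟨q, hq, hsum⟩ := exists_one_sub hp
    exact ⟨q, hq, Prod.ext (eq_sub_of_add_eq' hsum) (eq_sub_of_add_eq' (h.iota_one_sub hp hq hsum))⟩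
  inverse_mem_ratios := by
    rintro _ ⟨p, hp, rfl⟩ h0
    have hp0 : p ≠ 0 := by
      rintro rfl
      exact h0 (by simp [h.map_zero])
    refine ⟨p⁻¹, inv_mem_fundamentals hp hp0,
      (Ring.inverse_unit (.mkOfMulEqOne _ _ (Prod.ext (iota_mul_iota_inv hp0) ?_))).symm⟩
    exact (map_mul iota _ _).symm.trans (by rw [h.mul_inv hp hp0, map_one, Prod.snd_one])
  mul_mem_ratios := by
    rintro _ ⟨p, hp, rfl⟩ _ ⟨q, hq, rfl⟩ ⟨r, hr, hrpq⟩
    obtain rfl : r = p * q := iota_injective (hrpq.trans (map_mul iota p q).symm)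
    exact ⟨p * q, hr, Prod.ext (map_mul iota p q) (by simp [h.map_mul hp hq hr])⟩
  neg_mem_ratios := by
    rintro _ ⟨p, hp, rfl⟩ ⟨r, hr, hrp⟩
    obtain rfl : r = -p := iota_injective (hrp.trans (iota_neg p).symm)
    exact ⟨-p, hr, Prod.ext (iota_neg p) (by simp [h.map_neg hp hr])⟩
  injOn := by
    rintro _ ⟨p, -, rfl⟩ _ ⟨q, -, rfl⟩ hpq
    obtain rfl : p = q := iota_injective hpq
    rfl
  exists_ratios_lift := by
    rintro _ ⟨p, hp, rfl⟩
    exact ⟨_, ⟨p, hp, rfl⟩, rfl⟩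

end IsFundamentalLift

end CrossSystems

end PartialField

/-! ### Minors of a lift -/

namespace MatrixLift

open Matrix

section Minors

variable {R : Type*} [CommRing R] {X Y : Type*} {D : CrossSystem R}

theorem admissible_of_pivot_mem [DecidableEq X] [DecidableEq Y]
    (hD : ∀ x ∈ D.elems, 1 - x ∈ D.elems → x ∈ D.ratios) {A : Matrix X Y R}
    (hA : ∀ i j, A i j ∈ D.elems) (hp : ∀ k l, A k l ≠ 0 → ∀ i j, pivot A k l i j ∈ D.elems) :
    D.Admissible A := by
  refine ⟨hA, fun {i j u v} hiv hju => ?_⟩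
  by_cases hij : i = j
  · subst hij; exact cross_same_row _ _ _ _
  by_cases huv : u = v
  · subst huv; exact cross_same_col _ _ _ _
  have hinviv := mul_inverse (hA i v) hiv
  have hinvju := mul_inverse (hA j u) hju
  have hsub := mul_mem (hp i v hiv j u) (inverse_mem_elems (hA j u))
  rw [pivot_other _ (Ne.symm hij) huv] at hsub
  refine ⟨A i u * A j v * Ring.inverse (A i v) * Ring.inverse (A j u), hD _ (mul_mem (mul_mem
    (mul_mem (hA i u) (hA j v)) (inverse_mem_elems (hA i v))) (inverse_mem_elems (hA j u))) ?_, ?_⟩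
  · convert hsub using 1
    linear_combination -hinvju
  · linear_combination -(A i u * A j v * (A i v * Ring.inverse (A i v))) * hinvju -
      A i u * A j v * hinviv

theorem exists_det_augmented_eq [Fintype X] [DecidableEq X] (A : Matrix X Y R) {Z : Type*}
    [Fintype Z] [DecidableEq Z] (f : Z ↪ X) (g : Z → Y) :
    ∃ c : X → X ⊕ Y, ((augmented A).submatrix id c).det = (A.submatrix f g).det := by
  classical
  obtain ⟨c, hcf, hcX⟩ : ∃ c : X → X ⊕ Y, (∀ t, c (f t) = .inr (g t)) ∧
      ∀ x, (¬ ∃ t, f t = x) → c x = .inl x :=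
    ⟨Function.extend f (.inr ∘ g) .inl, f.injective.extend_apply _ _, Function.extend_apply' _ _⟩
  refine ⟨c, ?_⟩
  rw [twoBlockTriangular_det' _ (fun x => ∃ t, f t = x)]
  · have hone : toSquareBlockProp ((augmented A).submatrix id c) (fun x => ¬ ∃ t, f t = x) = 1 := by
      ext ⟨i, hi⟩ ⟨j, hj⟩
      simp [toSquareBlockProp, hcX j hj, one_apply]
    let e : Z ≃ {x // ∃ t, f t = x} := Equiv.ofInjective f f.injective
    rw [hone, det_one, mul_one, ← det_submatrix_equiv_self e]
    congr 1
    ext s t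
    change augmented A (f s) (c (f t)) = A (f s) (g t)
    exact congrArg (augmented A (f s)) (hcf t)
  · rintro _ ⟨s, rfl⟩ j hj
    rw [submatrix_apply, hcX j hj]
    exact one_apply_ne fun h => hj ⟨s, h⟩

theorem CrossSystem.PivotAdmissible.det_submatrix_mem_elems [Finite X] [DecidableEq X]
    [DecidableEq Y] {A : Matrix X Y R} (hA : D.PivotAdmissible A) {Z : Type*} [Fintype Z]
    [DecidableEq Z] (f : Z ↪ X) (g : Z → Y) :
    (A.submatrix f g).det ∈ D.elems := by
  have := Fintype.ofFinite X
  obtain ⟨c, hc⟩ := exists_det_augmented_eq A f g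
  rw [← hc]
  exact or_iff_not_imp_left.2 fun h0 => (hA.admissibleAt h0).det

variable [Fintype X] [DecidableEq X]

theorem det_reduceAt_submatrix {E : Type*} (N : Matrix X E R) (c c' : X → E) :
    ((reduceAt N c).submatrix id c').det =
      Ring.inverse (N.submatrix id c).det * (N.submatrix id c').det := by
  rw [reduceAt, mul_submatrix_id, det_mul, det_nonsing_inv]

theorem augmented_reduceAt {E : Type*} {N : Matrix X E R} {c : X → E}
    (h : IsUnit (N.submatrix id c).det) :
    augmented (reduceAt N c) = (reduceAt N c).submatrix id (Sum.elim c id) := by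
  ext i (j | e)
  · rw [augmented, ← reduceAt_submatrix_self h]; rfl
  · rfl

theorem mem_elems_of_det_augmented_mem {A : Matrix X Y R}
    (h : ∀ c, ((augmented A).submatrix id c).det ∈ D.elems) (i : X) (j : Y) :
    A i j ∈ D.elems := by
  have hinl : (augmented A).submatrix id Sum.inl = 1 := rfl
  have hij := h (Function.update Sum.inl i (Sum.inr j))
  rwa [det_submatrix_update (by rw [hinl, det_one]; exact isUnit_one), reduceAt_eq_self hinl, hinl,
    det_one, one_mul] at hij

theorem pivotAdmissible_of_det_augmented_mem [DecidableEq Y]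
    (hD : ∀ x ∈ D.elems, 1 - x ∈ D.elems → x ∈ D.ratios) {A : Matrix X Y R}
    (h : ∀ c, ((augmented A).submatrix id c).det ∈ D.elems) : D.PivotAdmissible A := by
  have hpivot : ∀ B : Matrix X Y R, (∀ c, ((augmented B).submatrix id c).det ∈ D.elems) →
      ∀ k l, B k l ≠ 0 → ∀ c, ((augmented (pivot B k l)).submatrix id c).det ∈ D.elems := by
    intro B hB k l hkl c
    have hmem := mem_elems_of_det_augmented_mem hB k l
    have hcomp : c = exchange k l ∘ (exchange k l ∘ c) := by ext i; simp
    rw [hcomp, det_augmented_pivot (isUnit_of_mem_elems hmem hkl)]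
    exact mul_mem (inverse_mem_elems hmem) (hB _)
  exact .of_invariant (S := {B | ∀ c, ((augmented B).submatrix id c).det ∈ D.elems})
    (fun B hB => admissible_of_pivot_mem hD (mem_elems_of_det_augmented_mem hB) fun k l hkl =>
      mem_elems_of_det_augmented_mem (hpivot B hB k l hkl)) hpivot h

theorem pivotAdmissible_reduceAt {E : Type*} [DecidableEq E]
    (hD : ∀ x ∈ D.elems, 1 - x ∈ D.elems → x ∈ D.ratios) {N : Matrix X E R}
    (hN : ∀ c : X → E, (N.submatrix id c).det ∈ D.elems) {c : X → E}
    (hc : (N.submatrix id c).det ≠ 0) : D.PivotAdmissible (reduceAt N c) := by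
  refine pivotAdmissible_of_det_augmented_mem hD fun c' => ?_
  rw [augmented_reduceAt (isUnit_of_mem_elems (hN c) hc), submatrix_submatrix, Function.id_comp,
    det_reduceAt_submatrix]
  exact mul_mem (inverse_mem_elems (hN c)) (hN _)

theorem IsLiftSystem.exists_lift_minors {R₁ E : Type*} [CommRing R₁] [Finite E]
    {D₁ : CrossSystem R₁} {π : R →+* R₁} (L : IsLiftSystem D D₁ π)
    (hD : ∀ x ∈ D₁.elems, 1 - x ∈ D₁.elems → x ∈ D₁.ratios) {N : Matrix X E R₁}
    (hN : ∀ c : X → E, (N.submatrix id c).det ∈ D₁.elems) {c : X → E}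
    (hc : (N.submatrix id c).det ≠ 0) :
    ∃ B : Matrix X E R,
      (∀ (k : ℕ) (f : Fin k ↪ X) (g : Fin k → E), (B.submatrix f g).det ∈ D.elems) ∧
      ∀ c' : X → E, (B.submatrix id c').det = 0 ↔ (N.submatrix id c').det = 0 := by
  classical
  obtain ⟨B, hB, hBN⟩ := L.liftable (pivotAdmissible_reduceAt hD hN hc)
  refine ⟨B, fun k f g => hB.det_submatrix_mem_elems f g, fun c' => ?_⟩
  have hunit := (isUnit_of_mem_elems (hN c) hc).ringInverse
  have hmem := hB.det_submatrix_mem_elems (.refl X) c'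
  rw [Function.Embedding.coe_refl] at hmem
  rw [← L.map_eq_zero hmem, RingHom.map_det, RingHom.mapMatrix_apply, ← submatrix_map, hBN,
    det_reduceAt_submatrix, hunit.mul_right_eq_zero]

end Minors

end MatrixLift

/-! ### Representable matroids -/

namespace PartialField

open Matrix MatrixLift

section Representable

variable {P Q : Type*} [PartialField P] [PartialField Q]

theorem mem_ringSystem_ratios_of_one_sub_mem (x : UnivRing P) (hx : x ∈ (ringSystem P).elems)
    (hx' : 1 - x ∈ (ringSystem P).elems) : x ∈ (ringSystem P).ratios := by
  obtain ⟨p, rfl⟩ := mem_ringSystem_elems.1 hx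
  obtain ⟨q, hq⟩ := mem_ringSystem_elems.1 hx'
  exact ⟨p, mem_fundamentals.2 ⟨q, by rw [hq, add_sub_cancel]⟩, rfl⟩

theorem isPMatrix_iff {X Y : Type*} {A : Matrix X Y P} :
    IsPMatrix A ↔ ∀ (k : ℕ) (f : Fin k ↪ X) (g : Fin k ↪ Y),
      ((A.map iota).submatrix f g).det ∈ (ringSystem P).elems := by
  simp only [IsPMatrix, hasDet_iff_det_map_iota, mem_ringSystem_elems, submatrix_map, eq_comm]

theorem IsPMatrix.det_submatrix_mem_elems {r : ℕ} {Y : Type*} {A : Matrix (Fin r) Y P}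
    (hA : IsPMatrix A) (c : Fin r → Y) :
    ((A.map iota).submatrix id c).det ∈ (ringSystem P).elems := by
  by_cases hc : Function.Injective c
  · exact isPMatrix_iff.1 hA r (.refl _) ⟨c, hc⟩
  · obtain ⟨i, j, hij, hne⟩ := Function.not_injective_iff.1 hc
    rw [det_zero_of_column_eq hne fun k => by simp [hij]]
    exact zero_mem_elems

theorem IsPMatrix.exists_hasDet_ne_zero_iff {r : ℕ} {Y : Type*} {A : Matrix (Fin r) Y P}
    (hA : IsPMatrix A) (g : Fin r ↪ Y) : (∃ d, HasDet (A.submatrix id g) d ∧ d ≠ 0) ↔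
      ((A.map iota).submatrix id g).det ≠ 0 := by
  obtain ⟨d, hd⟩ := hA r (.refl _) g
  have hdet := hasDet_iff_det_map_iota.1 hd
  rw [Function.Embedding.coe_refl, ← submatrix_map] at hdet
  constructor
  · rintro ⟨d', hd', h0⟩
    rwa [submatrix_map, hasDet_iff_det_map_iota.1 hd', Ne, iota_eq_zero]
  · intro h0
    exact ⟨d, hd, fun h => h0 (by rw [hdet, h, map_zero])⟩

theorem IsPMatrix.hasRank_iff {r : ℕ} {Y : Type*} {A : Matrix (Fin r) Y P} (hA : IsPMatrix A) :
    HasRank A r ↔ ∃ g : Fin r ↪ Y, ((A.map iota).submatrix id g).det ≠ 0 := by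
  constructor
  · rintro ⟨⟨f, g, d, hd, hd0⟩, -⟩
    refine ⟨g, fun h0 => hd0 (iota_eq_zero.1 ?_)⟩
    let σ : Equiv.Perm (Fin r) :=
      Equiv.ofBijective f (Finite.injective_iff_bijective.1 f.injective)
    have hσ : (A.submatrix f g).map iota = ((A.map iota).submatrix id g).submatrix σ id := rfl
    rw [← hasDet_iff_det_map_iota.1 hd, hσ, det_permute, h0, mul_zero]
  · rintro ⟨g, hg⟩
    refine ⟨⟨.refl _, g, (hA.exists_hasDet_ne_zero_iff g).2 hg⟩, ?_⟩
    rintro k ⟨f, -⟩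
    simpa using Fintype.card_le_of_embedding f

theorem isRepresentable_iff {α : Type*} {M : Matroid α} : IsRepresentable P M ↔
    ∃ (r : ℕ) (A : Matrix (Fin r) M.E P), IsPMatrix A ∧
      (∃ g : Fin r ↪ M.E, ((A.map iota).submatrix id g).det ≠ 0) ∧
      ∀ B : Set M.E, M.IsBase (Subtype.val '' B) ↔ ∃ g : Fin r ↪ M.E, Set.range g = B ∧
        ((A.map iota).submatrix id g).det ≠ 0 := by
  refine exists_congr fun r => exists_congr fun A => and_congr_right fun hA => ?_
  rw [hA.hasRank_iff]
  refine and_congr_right fun _ => forall_congr' fun B => iff_congr Iff.rfl ?_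
  exact exists_congr fun g => and_congr_right fun _ => hA.exists_hasDet_ne_zero_iff g

theorem IsRepresentable.of_det_eq_zero_iff {α : Type*} {M : Matroid α} (hM : IsRepresentable P M)
    (h : ∀ (r : ℕ) (A : Matrix (Fin r) M.E P), IsPMatrix A →
      (∃ g : Fin r ↪ M.E, ((A.map iota).submatrix id g).det ≠ 0) →
      ∃ B : Matrix (Fin r) M.E Q, IsPMatrix B ∧ ∀ g : Fin r ↪ M.E,
        ((B.map iota).submatrix id g).det = 0 ↔ ((A.map iota).submatrix id g).det = 0) :
    IsRepresentable Q M := by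
  rw [isRepresentable_iff] at hM ⊢
  obtain ⟨r, A, hA, hr, hbase⟩ := hM
  obtain ⟨B, hB, hdet⟩ := h r A hA hr
  refine ⟨r, B, hB, hr.imp fun g => mt (hdet g).1, fun C => (hbase C).trans ?_⟩
  exact exists_congr fun g => and_congr_right fun _ => not_congr (hdet g).symm

namespace Hom

variable (φ : Hom P Q)

protected theorem map_zero : φ.toFun 0 = 0 := by
  have h := padd_eq_some_iff.1 (φ.map_padd 0 0 0 (padd_zero 0))
  exact iota_eq_zero.1 (add_eq_left.1 h)

protected theorem map_neg (p : P) : φ.toFun (-p) = -φ.toFun p :=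
  neg_unique _ _ ((φ.map_padd _ _ _ (padd_neg p)).trans (by rw [φ.map_zero]))

theorem association {S : Multiset P} {r : P} (h : Association padd S r) :
    Association padd (S.map φ.toFun) (φ.toFun r) := by
  induction h with
  | leaf p => exact .leaf _
  | node _ _ h ih₁ ih₂ =>
    rw [Multiset.map_add]
    exact .node ih₁ ih₂ (φ.map_padd _ _ _ h)

variable {φ}

theorem eq_zero_iff (h1 : φ.toFun 1 = 1) {p : P} : φ.toFun p = 0 ↔ p = 0 := by
  refine ⟨fun h => by_contra fun hp => ?_, fun h => by rw [h, φ.map_zero]⟩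
  have hmul := φ.map_mul p p⁻¹
  rw [mul_inv_cancel₀ hp, h1, h, zero_mul] at hmul
  exact one_ne_zero hmul

theorem detTerms_map (h1 : φ.toFun 1 = 1) {n : ℕ} (A : Matrix (Fin n) (Fin n) P) :
    detTerms (A.map φ.toFun) = (detTerms A).map φ.toFun := by
  let ψ : P →* Q := ⟨⟨φ.toFun, h1⟩, φ.map_mul⟩
  rw [detTerms, detTerms, Multiset.map_map]
  refine Multiset.map_congr rfl fun σ _ => ?_
  have hprod : φ.toFun (∏ i, A i (σ i)) = ∏ i, φ.toFun (A i (σ i)) := map_prod ψ _ _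
  simp only [Function.comp_apply, map_apply, ← hprod]
  split_ifs
  · rfl
  · exact (φ.map_neg _).symm

theorem hasDet_map (h1 : φ.toFun 1 = 1) {n : ℕ} {A : Matrix (Fin n) (Fin n) P} {d : P}
    (h : HasDet A d) : HasDet (A.map φ.toFun) (φ.toFun d) := by
  obtain ⟨Z, hZ⟩ := h
  refine ⟨Z.map φ.toFun, ?_⟩
  have hassoc := φ.association hZ
  rw [Multiset.map_add, Multiset.map_add, ← detTerms_map h1] at hassoc
  simpa only [Multiset.map_map, Function.comp_def, φ.map_neg] using hassoc

theorem isRepresentable (h1 : φ.toFun 1 = 1) {α : Type*} {M : Matroid α}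
    (hM : IsRepresentable P M) : IsRepresentable Q M := by
  refine hM.of_det_eq_zero_iff fun r A hA _ => ⟨A.map φ.toFun, fun k f g => ?_, fun g => ?_⟩
  · obtain ⟨d, hd⟩ := hA k f g
    exact ⟨_, hasDet_map h1 hd⟩
  · obtain ⟨d, hd⟩ := hA r (.refl _) g
    rw [Function.Embedding.coe_refl] at hd
    rw [submatrix_map, submatrix_map, submatrix_map, hasDet_iff_det_map_iota.1 hd,
      hasDet_iff_det_map_iota.1 (hasDet_map h1 hd), iota_eq_zero, iota_eq_zero, eq_zero_iff h1]

end Hom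

namespace IsFundamentalLift

variable {u : P → Q}

theorem exists_map_iota_eq_map_snd (h : IsFundamentalLift u) {X Y : Type*}
    {B : Matrix X Y (UnivRing P × UnivRing Q)} (hB : ∀ i j, B i j ∈ h.pairSystem.elems) :
    ∃ C : Matrix X Y Q, C.map iota = B.map Prod.snd := by
  choose C hC using fun i j => h.exists_of_mem_pairSystem_elems (hB i j)
  exact ⟨.of C, by ext i j; exact (hC i j).1⟩

theorem isRepresentable (h : IsFundamentalLift u) {α : Type*} {M : Matroid α} [M.Finite]
    (hM : IsRepresentable P M) : IsRepresentable Q M := by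
  refine hM.of_det_eq_zero_iff fun r A hA ⟨g, hg⟩ => ?_
  have := M.ground_finite.to_subtype
  obtain ⟨B, hB, hBA⟩ := h.isLiftSystem.exists_lift_minors mem_ringSystem_ratios_of_one_sub_mem
    hA.det_submatrix_mem_elems hg
  have hmem : ∀ i j, B i j ∈ h.pairSystem.elems := fun i j => by
    simpa using hB 1 ⟨fun _ => i, Function.injective_of_subsingleton _⟩ fun _ => j
  obtain ⟨C, hCB⟩ := h.exists_map_iota_eq_map_snd hmem
  have hdet : ∀ (k : ℕ) (f : Fin k → Fin r) (c : Fin k → M.E),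
      ((C.map iota).submatrix f c).det = (B.submatrix f c).det.2 := fun k f c => by
    rw [hCB]
    exact (RingHom.map_det (RingHom.snd (UnivRing P) (UnivRing Q)) (B.submatrix f c)).symm
  refine ⟨C, isPMatrix_iff.2 fun k f c => ?_, fun c => ?_⟩
  · obtain ⟨q, hq, -⟩ := h.exists_of_mem_pairSystem_elems (hB k f c)
    exact mem_ringSystem_elems.2 ⟨q, by rw [hdet, hq]⟩
  · obtain ⟨q, hq, hq0⟩ := h.exists_of_mem_pairSystem_elems (hB r (.refl _) c)
    rw [Function.Embedding.coe_refl] at hq hq0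
    rw [hdet, ← hq, iota_eq_zero, hq0, hBA]

end IsFundamentalLift

namespace IsLiftingFunction

variable {φ : Hom Q P} {up : fundamentals P → Q}

protected theorem map_one (hup : IsLiftingFunction φ up) : φ.toFun 1 = 1 := by
  have hmul := φ.map_mul 1 (up ⟨1, one_mem_fundamentals⟩)
  rw [one_mul, hup.section_eq] at hmul
  simpa using hmul.symm

theorem isFundamentalLift_extend (hup : IsLiftingFunction φ up)
    (h_two_zero : padd (1 : P) 1 = some 0 → padd (1 : Q) 1 = some 0)
    (h_triple : ∀ p q r : fundamentals P, (p : P) * (q : P) * (r : P) = 1 →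
      up p * up q * up r = 1) :
    IsFundamentalLift (Function.extend Subtype.val up 0) := by
  have hext : ∀ p (hp : p ∈ fundamentals P), Function.extend Subtype.val up 0 p = up ⟨p, hp⟩ :=
    fun p hp => Subtype.val_injective.extend_apply up 0 ⟨p, hp⟩
  constructor
  · intro p hp q hq hpq
    rw [hext p hp, hext q hq]
    exact hup.map_add_one ⟨p, hp⟩ ⟨q, hq⟩ hpq
  · intro p hp q hq hpq
    rw [hext p hp, hext q hq]
    exact hup.map_mul_one ⟨p, hp⟩ ⟨q, hq⟩ hpq
  · intro p hp q hq r hr hpqr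
    rw [hext p hp, hext q hq, hext r hr]
    exact h_triple ⟨p, hp⟩ ⟨q, hq⟩ ⟨r, hr⟩ hpqr
  · exact h_two_zero

end IsLiftingFunction

end Representable

end PartialField

theorem mainTheorem2_general {P : Type*} {Q : Type*} [PartialField P] [PartialField Q]
    (φ : PartialField.Hom Q P) (hφ : φ.toFun 1 = 1) {u : P → Q}
    (hu : PartialField.IsFundamentalLift u) {α : Type*} (M : Matroid α) [M.Finite] :
    PartialField.IsRepresentable P M ↔ PartialField.IsRepresentable Q M :=
  ⟨hu.isRepresentable, PartialField.Hom.isRepresentable hφ⟩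

theorem mainTheorem2 {P : Type*} {Q : Type*} [PartialField P] [PartialField Q]
    (φ : PartialField.Hom Q P) (up : PartialField.fundamentals P → Q)
    (hup : PartialField.IsLiftingFunction φ up)
    (h_two_zero : PartialField.padd (1 : P) 1 = some 0 → PartialField.padd (1 : Q) 1 = some 0)
    (h_two_ne_zero : ∀ s : P, PartialField.padd (1 : P) 1 = some s → s ≠ 0 →
      ∃ t : Q, PartialField.padd (1 : Q) 1 = some t ∧ t ≠ 0)
    (h_triple : ∀ p q r : PartialField.fundamentals P, (p : P) * (q : P) * (r : P) = 1 →
      up p * up q * up r = 1)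
    {α : Type*} (M : Matroid α) [M.Finite] :
    PartialField.IsRepresentable P M ↔ PartialField.IsRepresentable Q M :=
  mainTheorem2_general φ hup.map_one (hup.isFundamentalLift_extend h_two_zero h_triple) M
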